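/- **Setting.** Let $k$ be a field of characteristic $0$. A *graph* is a finite set of half-edges, partitioned into four-element sets (vertices) and also partitioned into one-element sets (external legs) and two-element sets (internal edges). Consider the graphs that are 1PI (connected, and still connected after cutting any one internal edge), have at least one internal edge, and have two or four external legs (self-loops are allowed); $H$ is the polynomial algebra over $k$ on their isomorphism classes, external legs being unlabelled. It is graded by the number of loops $E-V+1$ ($E$ internal edges, $V$ vertices), $H=\bigoplus_{n\ge0}H_n$. Its coproduct is the algebra morphism with $$\Delta(\Gamma)=\sum_{\gamma\subseteq\Gamma}\gamma\otimes\Gamma/\gamma ,$$ the sum being over all sets of internal edges of $\Gamma$ (the empty and the full one included) such that every connected component of the corresponding subgraph $\gamma$ is 1PI with two or four external legs (the half-edges at its vertices that are not in its edges). Here $\gamma$ stands for the product of its components, and $\Gamma/\gamma$ is obtained by shrinking each component with four external legs to a vertex and replacing each component with two external legs by a line; a single vertex without edges and a single line are identified with $1$. The counit $\varepsilon$ vanishes on all graphs. For $r\in\{2,4\}$ and $n\ge1$ let $\Gamma^{(r)}_n\in H_n$ be the sum of $\Gamma/\mathrm{sym}(\Gamma)$ over all isomorphism classes of such graphs $\Gamma$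 with $n$ loops and $r$ *labelled* external legs, where $\mathrm{sym}(\Gamma)$ is the number of automorphisms (as permutations of half-edges) fixing all external legs; the labels are forgotten in $H$. In the completion $\prod_n H_n$ put $$z_g=1+\sum_{n>0}\Gamma^{(4)}_n,\qquad z_\phi=1-\sum_{n>0}\Gamma^{(2)}_n,\qquad z_B=z_g\,z_\phi^{-2}=\sum_{n\ge0}\Gamma_n .$$ The Faà di Bruno Hopf algebra is the polynomial algebra $F=k[a_1,a_2,\dots]$ with $a_0=1$, counit $\varepsilon_F(a_n)=0$ for $n\geq 1$, and $$\Delta_F(a_n)=\sum_{m=0}^n\ \sum_{l_0+\dots+l_m=n-m}a_{l_0}\cdots a_{l_m}\otimes a_m .$$ **Proposition 3.9.** One has $\Gamma_n\in H_n$ for all $n$, and, in the completed tensor product $\prod_n (H\otimes H)_n$, $$\Delta(z_B)=\sum_{m\ge0}z_B^{m+1}\otimes\Gamma_m ,\qquad\text{that is,}\qquad \Delta(\Gamma_n)=\sum_{m=0}^n (z_B^{m+1})_{n-m}\otimes\Gamma_m\quad(n\ge0),$$ where $(\cdot)_j$ is the component of loop order $j$. Consequently there is a Hopf algebra morphism $\Phi:F\to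 H$ with $\Phi(a_n)=\Gamma_n$ for all $n\ge0$: an algebra morphism with $\Delta\circ\Phi=(\Phi\otimes\Phi)\circ\Delta_F$ and $\varepsilon\circ\Phi=\varepsilon_F$, which also commutes with antipodes (convolution inverses of the identity). -/

import Mathlib

open scoped TensorProduct

/-- A graph in half-edge form: `H` is the set of half-edges, the classes of `vert` are the vertices,
the two-element classes of `edge` are the internal edges, and the one-element classes of `edge` are
the external legs. Which vertices and edges are allowed is part of `IsDivergent1PI` below. -/
structure FeynmanGraph (H : Type) where
  vert : Setoid H
  edge : Setoid H

namespace FeynmanGraph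

section basic

variable {H H' : Type}

/-- The graph structure pulled back along a map of half-edges. It is used for bijections
(transport of structure) and for inclusions of subsets of half-edges (restriction). -/
def comap (G : FeynmanGraph H) (f : H' → H) : FeynmanGraph H' where
  vert := G.vert.comap f
  edge := G.edge.comap f

/-- The external legs. -/
def legs (G : FeynmanGraph H) : Set H := {h | ∀ x, G.edge h x → x = h}

/-- The equivalence relation `r` restricted to the set `S`; elements outside of `S` are related
only to themselves. -/
def within (r : Setoid H) (S : Set H) : Setoid H where
  r x y := x = y ∨ (x ∈ S ∧ y ∈ S ∧ r x y)
  iseqv :=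
    { refl := fun _ => Or.inl rfl
      symm := by
        rintro x y (h | ⟨hx, hy, h⟩)
        · exact Or.inl h.symm
        · exact Or.inr ⟨hy, hx, r.symm' h⟩
      trans := by
        rintro x y z (rfl | ⟨hx, hy, h⟩) (rfl | ⟨hy', hz, h'⟩)
        · exact Or.inl rfl
        · exact Or.inr ⟨hy', hz, h'⟩
        · exact Or.inr ⟨hx, hy, h⟩
        · exact Or.inr ⟨hx, hz, r.trans' h h'⟩ }

/-- The graph is non-empty and connected. -/
def IsConnected (G : FeynmanGraph H) : Prop := Nonempty H ∧ G.vert ⊔ G.edge = ⊤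

/-- The graph in which the internal edge containing the half-edge `h` has been cut. -/
def cutEdge (G : FeynmanGraph H) (h : H) : FeynmanGraph H where
  vert := G.vert
  edge := within G.edge {x | ¬ G.edge h x}

/-- The number of loops `E - V + 1` of a connected graph with `E` internal edges and
`V` vertices. -/
noncomputable def loops (G : FeynmanGraph H) : ℕ :=
  {c | c ∈ G.edge.classes ∧ c.ncard = 2}.ncard + 1 - G.vert.classes.ncard

/-- The one-particle irreducible (1PI) graphs of `φ⁴` theory with at least one loop and with two or
four external legs: all vertices are four-valent, an edge consists of one half-edge
(external leg) or of two half-edges (internal edge), there is at least one internal edge, the graph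
is connected, and it stays connected when any internal edge is cut. -/
structure IsDivergent1PI (G : FeynmanGraph H) : Prop where
  four_valent : ∀ h, {x | G.vert h x}.ncard = 4
  edge_le_two : ∀ h, {x | G.edge h x}.ncard ≤ 2
  two_or_four_legs : G.legs.ncard = 2 ∨ G.legs.ncard = 4
  exists_internal : ∃ h, h ∉ G.legs
  connected : G.IsConnected
  irreducible : ∀ h, h ∉ G.legs → (G.cutEdge h).IsConnected

/-- A bijection of half-edges is an isomorphism of graphs if it respects vertices and edges. -/
def IsIso (G : FeynmanGraph H) (G' : FeynmanGraph H') (e : H ≃ H') : Prop :=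
  (∀ x y, G.vert x y ↔ G'.vert (e x) (e y)) ∧ (∀ x y, G.edge x y ↔ G'.edge (e x) (e y))

theorem IsIso.refl (G : FeynmanGraph H) : G.IsIso G (Equiv.refl H) :=
  ⟨fun _ _ => Iff.rfl, fun _ _ => Iff.rfl⟩

theorem IsIso.symm {G : FeynmanGraph H} {G' : FeynmanGraph H'} {e : H ≃ H'} (h : G.IsIso G' e) :
    G'.IsIso G e.symm :=
  ⟨fun x y => by simpa using (h.1 (e.symm x) (e.symm y)).symm,
   fun x y => by simpa using (h.2 (e.symm x) (e.symm y)).symm⟩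

theorem IsIso.trans {H'' : Type} {G : FeynmanGraph H} {G' : FeynmanGraph H'}
    {G'' : FeynmanGraph H''} {e : H ≃ H'} {e' : H' ≃ H''} (h : G.IsIso G' e) (h' : G'.IsIso G'' e') :
    G.IsIso G'' (e.trans e') :=
  ⟨fun x y => (h.1 x y).trans (h'.1 _ _), fun x y => (h.2 x y).trans (h'.2 _ _)⟩

end basic

section subgraphs

variable {H : Type}

/-- A subgraph is given by the set `S` of half-edges of its internal edges. This is the relation of
lying in the same connected component of the spanning subgraph with these edges: its classes
consist of all half-edges at the vertices of one component. -/
def component (G : FeynmanGraph H) (S : Set H) : Setoid H := G.vert ⊔ within G.edge S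

/-- The connected component of the subgraph `S` that contains the half-edge `h`, as a graph of its
own: all half-edges at its vertices that do not belong to `S` become external legs. -/
def componentGraph (G : FeynmanGraph H) (S : Set H) (h : H) :
    FeynmanGraph {x // G.component S h x} :=
  FeynmanGraph.comap ⟨G.vert, within G.edge S⟩ Subtype.val

/-- `S` is the set of half-edges of a (possibly empty) set of internal edges of `G`, and the
connected components of the subgraph with these edges are 1PI with two or four external legs. -/
structure IsDivergentSubgraph (G : FeynmanGraph H) (S : Set H) : Prop where
  internal : ∀ h ∈ S, h ∉ G.legs
  edge_closed : ∀ h ∈ S, ∀ x, G.edge h x → x ∈ S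
  components : ∀ h ∈ S, (G.componentGraph S h).IsDivergent1PI

/-- The external legs of the component of the subgraph `S` that contains `h`, as half-edges
of `G`. -/
def componentLegs (G : FeynmanGraph H) (S : Set H) (h : H) : Set H :=
  {x | x ∉ S ∧ G.component S h x}

/-- The half-edges of the contracted graph: the external legs of the components with
four external legs. (A vertex outside of the subgraph counts as such a component.) -/
def kept (G : FeynmanGraph H) (S : Set H) : Set H :=
  {h | h ∉ S ∧ (G.componentLegs S h).ncard = 4}

/-- The relation between the two external legs of each component of `S` with two external legs. -/
def bridge (G : FeynmanGraph H) (S : Set H) : Setoid H :=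
  within (G.component S) {h | h ∉ S ∧ (G.componentLegs S h).ncard = 2}

/-- The contracted graph: each component of `S` with four external legs is shrunk to a vertex, and
each component of `S` with two external legs is removed, the two edges at its external legs being
joined to one edge. -/
def contract (G : FeynmanGraph H) (S : Set H) : FeynmanGraph {h // h ∈ G.kept S} :=
  FeynmanGraph.comap ⟨G.component S, within G.edge Sᶜ ⊔ G.bridge S⟩ Subtype.val

end subgraphs

/-- The 1PI graphs with two or four external legs and at least one loop, with half-edges
`0, …, n - 1`. -/
def Divergent : Type := {G : Σ n : ℕ, FeynmanGraph (Fin n) // G.2.IsDivergent1PI}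

instance Divergent.setoid : Setoid Divergent where
  r G G' := ∃ e : Fin G.1.1 ≃ Fin G'.1.1, G.1.2.IsIso G'.1.2 e
  iseqv :=
    { refl := fun G => ⟨_, IsIso.refl G.1.2⟩
      symm := fun ⟨_, h⟩ => ⟨_, h.symm⟩
      trans := fun ⟨_, h⟩ ⟨_, h'⟩ => ⟨_, h.trans h'⟩ }

/-- Isomorphism classes of 1PI graphs with two or four (unlabelled) external legs and at least
one loop. -/
def Generator : Type := Quotient Divergent.setoid

/-- A representative of an isomorphism class. -/
noncomputable def Generator.rep (Γ : Generator) : Divergent := Quotient.out Γ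

/-- The number of loops of an isomorphism class of graphs. -/
noncomputable def Generator.loops (Γ : Generator) : ℕ := Γ.rep.1.2.loops

end FeynmanGraph

open FeynmanGraph

/-- The algebra of 1PI Feynman graphs: the polynomial algebra over the isomorphism classes of 1PI
graphs with two or four external legs. The product is the disjoint union, and `1` is the empty
graph. -/
abbrev GraphAlgebra (k : Type*) [Field k] : Type _ := MvPolynomial Generator k

namespace FeynmanGraph

open Classical in
/-- The element of the algebra of graphs given by a graph. Graphs without loops (a single vertex, or
a single line) are identified with `1`. -/
noncomputable def toAlgebra (k : Type*) [Field k] {H : Type} [Finite H] (G : FeynmanGraph H) :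
    GraphAlgebra k :=
  if hG : (G.comap (Finite.equivFin H).symm).IsDivergent1PI then
    MvPolynomial.X (Quotient.mk Divergent.setoid ⟨⟨Nat.card H, _⟩, hG⟩)
  else 1

/-- The product of the connected components of the subgraph `S`. The vertices outside of `S`
contribute the factor `1`. -/
noncomputable def subgraphMonomial (k : Type*) [Field k] {H : Type} [Finite H]
    (G : FeynmanGraph H) (S : Set H) : GraphAlgebra k :=
  ∏ᶠ q : Quotient (G.component S), (G.componentGraph S q.out).toAlgebra k

/-- The coproduct `∑ γ ⊗ G / γ` of a graph, the sum over all subgraphs `γ`, including the empty one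
and `G` itself, whose components are 1PI with two or four external legs. -/
noncomputable def coproduct (k : Type*) [Field k] {H : Type} [Finite H] (G : FeynmanGraph H) :
    GraphAlgebra k ⊗[k] GraphAlgebra k :=
  ∑ᶠ S : {S : Set H // G.IsDivergentSubgraph S},
    G.subgraphMonomial k S.1 ⊗ₜ[k] (G.contract S.1).toAlgebra k

/-- 1PI graphs with `r` labelled external legs, where `r` is two or four, and at least one loop. -/
def LegLabelled (r : ℕ) : Type :=
  {G : Σ n : ℕ, FeynmanGraph (Fin n) × (Fin r → Fin n) //
    G.2.1.IsDivergent1PI ∧ Function.Injective G.2.2 ∧ Set.range G.2.2 = G.2.1.legs}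

/-- Isomorphisms of graphs with labelled external legs respect the labels. -/
instance LegLabelled.setoid (r : ℕ) : Setoid (LegLabelled r) where
  r G G' := ∃ e : Fin G.1.1 ≃ Fin G'.1.1, G.1.2.1.IsIso G'.1.2.1 e ∧ ∀ i, e (G.1.2.2 i) = G'.1.2.2 i
  iseqv :=
    { refl := fun G => ⟨_, IsIso.refl G.1.2.1, fun _ => rfl⟩
      symm := fun ⟨e, h, hl⟩ => ⟨_, h.symm, fun i => by rw [← hl i, Equiv.symm_apply_apply]⟩
      trans := fun ⟨_, h, hl⟩ ⟨_, h', hl'⟩ =>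
        ⟨_, h.trans h', fun i => by rw [Equiv.trans_apply, hl i, hl' i]⟩ }

/-- Isomorphism classes of 1PI graphs with `r` labelled external legs. -/
def LegLabelledClass (r : ℕ) : Type := Quotient (LegLabelled.setoid r)

/-- A representative of an isomorphism class of graphs with labelled external legs. -/
noncomputable def LegLabelledClass.rep {r : ℕ} (Λ : LegLabelledClass r) : LegLabelled r :=
  Quotient.out Λ

/-- The underlying graph of a representative. -/
noncomputable def LegLabelledClass.graph {r : ℕ} (Λ : LegLabelledClass r) :
    FeynmanGraph (Fin Λ.rep.1.1) := Λ.rep.1.2.1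

theorem four_mul_card_vertices {H : Type} [Finite H] (G : FeynmanGraph H)
    (hG : G.IsDivergent1PI) : 4 * G.vert.classes.ncard = Nat.card H := by
  have h := (Setoid.isPartition_classes G.vert).ncard_eq_finsum Set.univ
  have h4 : ∀ t : G.vert.classes, (Set.univ ∩ (t : Set H)).ncard = 4 := by
    rintro ⟨t, y, rfl⟩
    rw [Set.univ_inter, ← hG.four_valent y]
    congr 1
    ext x
    exact ⟨fun h => G.vert.symm' h, fun h => G.vert.symm' h⟩
  have : Fintype G.vert.classes := Fintype.ofFinite _
  rw [finsum_congr h4, finsum_eq_sum_of_fintype, Finset.sum_const, Finset.card_univ,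
    ← Nat.card_eq_fintype_card, Set.ncard_univ, Nat.card_coe_set_eq] at h
  rw [h, smul_eq_mul, mul_comm]

theorem card_le_edges {H : Type} [Finite H] (G : FeynmanGraph H) (hG : G.IsDivergent1PI) :
    Nat.card H ≤ 2 * {c | c ∈ G.edge.classes ∧ c.ncard = 2}.ncard + 4 := by
  classical
  have h := (Setoid.isPartition_classes G.edge).ncard_eq_finsum G.legsᶜ
  have : Fintype G.edge.classes := Fintype.ofFinite _
  have h2 : ∀ t : G.edge.classes,
      (G.legsᶜ ∩ (t : Set H)).ncard ≤ if (t : Set H).ncard = 2 then 2 else 0 := by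
    rintro ⟨t, y, rfl⟩
    have hs : {x | G.edge x y} = {x | G.edge y x} := by
      ext x
      exact ⟨fun h => G.edge.symm' h, fun h => G.edge.symm' h⟩
    have hle := hG.edge_le_two y
    rw [← hs] at hle
    have hsub : (G.legsᶜ ∩ {x | G.edge x y}).ncard ≤ {x | G.edge x y}.ncard :=
      Set.ncard_le_ncard Set.inter_subset_right
    split_ifs with hc
    · exact hsub.trans hle
    · have h1 : {x | G.edge x y}.ncard ≤ 1 := by
        have : {x | G.edge x y}.ncard ≠ 2 := hc
        omega
      rw [Set.ncard_le_one_iff] at h1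
      rw [Nat.le_zero, Set.ncard_eq_zero, Set.eq_empty_iff_forall_notMem]
      rintro x ⟨hx, hxy⟩
      exact hx fun z hz => h1 (G.edge.trans' (G.edge.symm' hz) hxy) hxy
  have h3 : (∑ t : G.edge.classes, if (t : Set H).ncard = 2 then 2 else 0) =
      2 * {c | c ∈ G.edge.classes ∧ c.ncard = 2}.ncard := by
    rw [← Finset.sum_filter, Finset.sum_const, smul_eq_mul, mul_comm, ← Set.ncard_coe_finset,
      ← Set.ncard_image_of_injective _ Subtype.val_injective]
    congr 2
    ext c
    simp [and_comm]
  have hl : G.legs.ncard + G.legsᶜ.ncard = Nat.card H := Set.ncard_add_ncard_compl _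
  rw [finsum_eq_sum_of_fintype] at h
  have h5 := Finset.sum_le_sum fun t (_ : t ∈ Finset.univ) => h2 t
  rw [h3, ← h] at h5
  rcases hG.two_or_four_legs with h6 | h6 <;> omega

theorem card_le_loops {H : Type} [Finite H] (G : FeynmanGraph H) (hG : G.IsDivergent1PI) :
    Nat.card H ≤ 4 * G.loops + 4 := by
  have h1 := G.four_mul_card_vertices hG
  have h2 := G.card_le_edges hG
  unfold loops
  omega

instance {H : Type} [Finite H] : Finite (FeynmanGraph H) :=
  Finite.of_injective
    (fun G : FeynmanGraph H => ((fun x y => G.vert x y : H → H → Prop), fun x y => G.edge x y)) <| by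
    rintro ⟨v, e⟩ ⟨v', e'⟩ h
    obtain ⟨h1, h2⟩ := Prod.mk.inj h
    have hv : v = v' := Setoid.ext fun x y => iff_of_eq (congrFun (congrFun h1 x) y)
    have he : e = e' := Setoid.ext fun x y => iff_of_eq (congrFun (congrFun h2 x) y)
    rw [hv, he]

/-- There are only finitely many graphs with labelled external legs and a given number of loops. -/
instance LegLabelledClass.finite (r n : ℕ) :
    Finite {Λ : LegLabelledClass r // Λ.graph.loops = n} := by
  let f : {Λ : LegLabelledClass r // Λ.graph.loops = n} →
      Σ m : Fin (4 * n + 5), FeynmanGraph (Fin m) × (Fin r → Fin m) := fun Λ =>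
    ⟨⟨Λ.1.rep.1.1, by
      have h := Λ.1.graph.card_le_loops Λ.1.rep.2.1
      rw [Λ.2, Nat.card_fin] at h
      omega⟩, Λ.1.rep.1.2⟩
  let g : (Σ m : Fin (4 * n + 5), FeynmanGraph (Fin m) × (Fin r → Fin m)) →
      Σ m : ℕ, FeynmanGraph (Fin m) × (Fin r → Fin m) := fun x => ⟨x.1, x.2⟩
  refine Finite.of_injective f fun Λ Λ' h => ?_
  have h' : Λ.1.rep.1 = Λ'.1.rep.1 := congrArg g h
  have h2 : Λ.1.rep = Λ'.1.rep := Subtype.ext h'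
  exact Subtype.ext (Quotient.out_injective h2)

/-- The symmetry factor of a graph: the number of its automorphisms (as permutations of the
half-edges) that fix every external leg. -/
noncomputable def symmetryFactor {H : Type} (G : FeynmanGraph H) : ℕ :=
  Nat.card {e : Equiv.Perm H // G.IsIso G e ∧ ∀ h ∈ G.legs, e h = h}

end FeynmanGraph

namespace GraphAlgebra

variable (k : Type*) [Field k]

/-- The (finite) sum `Γ⁽ʳ⁾ₙ` of the 1PI `r`-point graphs with `n` loops, divided by their symmetry factors. The
external legs are distinguished in the enumeration of the graphs (so that the one-loop four-point
graph occurs three times), and not in the algebra. -/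
noncomputable def pointSum (r n : ℕ) : GraphAlgebra k :=
  ∑ᶠ Λ : {Λ : LegLabelledClass r // Λ.graph.loops = n},
    MvPolynomial.C ((Λ.1.graph.symmetryFactor : k)⁻¹) * Λ.1.graph.toAlgebra k

/-- The coproduct of the Hopf algebra of 1PI graphs. -/
noncomputable def comul : GraphAlgebra k →ₐ[k] GraphAlgebra k ⊗[k] GraphAlgebra k :=
  MvPolynomial.aeval fun Γ : Generator => Γ.rep.1.2.coproduct k

/-- The counit of the Hopf algebra of 1PI graphs. -/
noncomputable def counit : GraphAlgebra k →ₐ[k] k :=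
  MvPolynomial.aeval fun _ : Generator => (0 : k)

/- A formal series `∑ hₙ`, with `hₙ` of loop order `n`, in the completion of the algebra of graphs is
written as the power series `∑ hₙ tⁿ`. -/

/-- `z_g = 1 + ∑_{n > 0} Γ⁽⁴⁾ₙ`. -/
noncomputable def zg : PowerSeries (GraphAlgebra k) :=
  PowerSeries.mk fun n => if n = 0 then 1 else pointSum k 4 n

/-- `z_φ = 1 - ∑_{n > 0} Γ⁽²⁾ₙ`. -/
noncomputable def zphi : PowerSeries (GraphAlgebra k) :=
  PowerSeries.mk fun n => if n = 0 then 1 else - pointSum k 2 n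

/-- The inverse of `z_φ`. -/
noncomputable def zphiInv : PowerSeries (GraphAlgebra k) := PowerSeries.invOfUnit (zphi k) 1

theorem zphi_mul_zphiInv : zphi k * zphiInv k = 1 :=
  PowerSeries.mul_invOfUnit _ _ (by simp [zphi])

/-- The formal bare coupling `z_B = z_g z_φ⁻²`. -/
noncomputable def zB : PowerSeries (GraphAlgebra k) := zg k * zphiInv k ^ 2

/-- The component `Γₙ` of loop order `n` of `z_B`. -/
noncomputable def bare (n : ℕ) : GraphAlgebra k := PowerSeries.coeff n (zB k)

end GraphAlgebra

/-- The algebra of the Faà di Bruno Hopf algebra: polynomials in `a₁, a₂, …`. The variable with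
index `n` is `aₙ₊₁`. -/
abbrev FaaDiBruno (k : Type*) [Field k] : Type _ := MvPolynomial ℕ k

namespace FaaDiBruno

variable (k : Type*) [Field k]

/-- The generators `aₙ`, with `a₀ = 1`. -/
noncomputable def a : ℕ → FaaDiBruno k
  | 0 => 1
  | n + 1 => MvPolynomial.X n

/-- The sum `∑_{m ≤ n} ∑_{l₀ + ⋯ + lₘ = n - m} a_{l₀} ⋯ a_{lₘ} ⊗ aₘ`. -/
noncomputable def coproduct (n : ℕ) : FaaDiBruno k ⊗[k] FaaDiBruno k :=
  ∑ m ∈ Finset.range (n + 1), ∑ l ∈ Finset.Nat.antidiagonalTuple (m + 1) (n - m),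
    (∏ i, a k (l i)) ⊗ₜ[k] a k m

/-- The coproduct of the Faà di Bruno Hopf algebra. -/
noncomputable def comul : FaaDiBruno k →ₐ[k] FaaDiBruno k ⊗[k] FaaDiBruno k :=
  MvPolynomial.aeval fun n => coproduct k (n + 1)

/-- The counit of the Faà di Bruno Hopf algebra. -/
noncomputable def counit : FaaDiBruno k →ₐ[k] k := MvPolynomial.aeval fun _ => (0 : k)

end FaaDiBruno

/-- `S` is an antipode for the coproduct `Δ` and the counit `ε` of the algebra `A`: it is a two-sided
inverse of the identity with respect to convolution. -/
def IsAntipode {k A : Type*} [Field k] [CommRing A] [Algebra k A] (Δ : A →ₐ[k] A ⊗[k] A)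
    (ε : A →ₐ[k] k) (S : A →ₗ[k] A) : Prop :=
  ∀ x, LinearMap.mul' k A (TensorProduct.map S LinearMap.id (Δ x)) = algebraMap k A (ε x) ∧
    LinearMap.mul' k A (TensorProduct.map LinearMap.id S (Δ x)) = algebraMap k A (ε x)

/-!
The proof counts graphs on a fixed set of half-edges. For a finite set `H` and `R ⊆ H` with `r`
elements and `s` elements in the complement, let `pieceSum H R` be the sum of all 1PI graphs on `H`
with legs `R` (for `s = 0` and `r = 4`, a single vertex). By orbit counting it is `s! * p_r(s)`,
where `p_r(s)` is the sum of `Γ / sym Γ` over the isomorphism classes with `r` labelled legs and `s`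
internal half-edges (`pieceSum_eq`, `GraphAlgebra.pointSum_eq`). So `P_r = ∑ p_r(s) X ^ s` is an
exponential generating function, and up to the substitution `X ↦ X ^ 4` and a factor `X ^ 2` one has
`P₄ = z_g` and `P₂ = 1 - z_φ`.

In `∑ γ ⊗ G / γ`, summed over all `G` in `pieceSum H R`, a pair `(G, γ)` amounts to a set `S` of
half-edges, an *outer graph* on the complement of `S`, whose vertices have two or four half-edges
(the legs of the components of `γ`), and a filling of each vertex by a graph with these legs. The
fillings of a fixed outer graph contribute a coefficient of `P₂ ^ d * P₄ ^ v`, where `d` and `v`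
count the vertices with two and with four half-edges (`sum_subgraphMonomial`). Forgetting the
bivalent vertices turns the outer graph into `G / γ`, and conversely the outer graphs over a given
1PI graph with `e` internal edges are obtained by inserting `d` bivalent vertices into its edges,
which after division by factorials gives the weight `multichoose e d` (`outerSum_eq`). By the
negative binomial series, the sum over `d` of these weights times `(1 - z_φ) ^ d` is `z_φ ^ (-e)`.
A graph with `n` loops has `V = n + 1`, `e = 2 n` if it has four legs and `V = n`, `e = 2 n - 1` if
it has two, and so the left factor of `Γ⁽ʳ⁾ₙ` in `Δ z_g` and `Δ z_φ` comes from
`z_g ^ V z_φ ^ (-e)`, which is `z_g z_B ^ n` respectively `z_φ z_B ^ n` (`GraphAlgebra.comul_pointSum`).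

The expression `∑ₘ h z_B ^ m ⊗ gₘ` is multiplicative in `(h, g)` (`tensorSeries_mul`), whence the
formula for `Δ z_B = Δ(z_g) Δ(z_φ)⁻²`. It says that `aₙ ↦ Γₙ` respects the coproducts. That it
commutes with the antipodes `S` and `T` holds because `T ∘ Φ` and `Φ ∘ S` are both left convolution
inverses of `Φ`, and convolution with `Φ` on the right is injective: the coproduct of `x` in the
Faà di Bruno algebra is `x ⊗ 1` up to terms of smaller weight on the left
(`FaaDiBruno.eq_zero_of_convolution_eq_zero`).
-/

/-! ### Isomorphism invariance -/

/-- The join of two equivalence relations, tested on colourings: `x` and `y` are related if and only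
if no two-colouring that is constant on the classes of both relations separates them. -/
theorem Setoid.sup_iff_forall {α : Type*} (r s : Setoid α) (x y : α) :
    (r ⊔ s) x y ↔ ∀ P : α → Prop, (∀ a b, r a b → P a → P b) → (∀ a b, s a b → P a → P b) →
      P x → P y := by
  constructor
  · intro h P hr hs
    have : r ⊔ s ≤ Setoid.ker P := sup_le
      (fun a b hab => propext ⟨hr a b hab, hr b a (r.symm' hab)⟩)
      (fun a b hab => propext ⟨hs a b hab, hs b a (s.symm' hab)⟩)
    exact (iff_of_eq (this h)).1
  · intro h
    exact h (fun z => (r ⊔ s) x z) (fun a b hab hx => (r ⊔ s).trans' hx (le_sup_left (a := r) hab))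
      (fun a b hab hx => (r ⊔ s).trans' hx (le_sup_right (a := r) hab)) ((r ⊔ s).refl' x)

namespace FeynmanGraph

variable {H H' : Type}

theorem ext' {G G' : FeynmanGraph H} (hv : ∀ x y, G.vert x y ↔ G'.vert x y)
    (he : ∀ x y, G.edge x y ↔ G'.edge x y) : G = G' := by
  obtain ⟨v, e⟩ := G
  obtain ⟨v', e'⟩ := G'
  have h1 : v = v' := Setoid.ext hv
  have h2 : e = e' := Setoid.ext he
  rw [h1, h2]

@[simp] theorem comap_vert (G : FeynmanGraph H) (f : H' → H) (x y : H') :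
    (G.comap f).vert x y ↔ G.vert (f x) (f y) := Iff.rfl

@[simp] theorem comap_edge (G : FeynmanGraph H) (f : H' → H) (x y : H') :
    (G.comap f).edge x y ↔ G.edge (f x) (f y) := Iff.rfl

theorem comap_comap {H'' : Type} (G : FeynmanGraph H) (f : H' → H) (g : H'' → H') :
    (G.comap f).comap g = G.comap (f ∘ g) := rfl

@[simp] theorem comap_id' (G : FeynmanGraph H) : G.comap (fun x => x) = G := rfl

theorem within_apply (r : Setoid H) (S : Set H) (x y : H) :
    within r S x y ↔ x = y ∨ (x ∈ S ∧ y ∈ S ∧ r x y) := Iff.rfl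

theorem isIso_iff_eq_comap (G : FeynmanGraph H) (G' : FeynmanGraph H') (e : H ≃ H') :
    G.IsIso G' e ↔ G = G'.comap e :=
  ⟨fun h => ext' h.1 h.2, fun h => by subst h; exact ⟨fun _ _ => Iff.rfl, fun _ _ => Iff.rfl⟩⟩

/-- `G` is connected if and only if every two-colouring of its half-edges that is constant on
vertices and on edges is constant. -/
theorem isConnected_iff (G : FeynmanGraph H) : G.IsConnected ↔ Nonempty H ∧
    ∀ P : H → Prop, (∀ a b, G.vert a b → P a → P b) → (∀ a b, G.edge a b → P a → P b) →
      ∀ x y, P x → P y := by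
  refine and_congr_right fun _ => ⟨fun h P hv he x y => ?_, fun h => ?_⟩
  · exact (Setoid.sup_iff_forall G.vert G.edge x y).1 (h ▸ trivial) P hv he
  · rw [eq_top_iff]
    intro x y _
    exact (Setoid.sup_iff_forall G.vert G.edge x y).2 fun P hv he => h P hv he x y

theorem cutEdge_edge (G : FeynmanGraph H) (h x y : H) :
    (G.cutEdge h).edge x y ↔ x = y ∨ (¬ G.edge h x ∧ ¬ G.edge h y ∧ G.edge x y) := Iff.rfl

theorem cutEdge_isConnected_iff (G : FeynmanGraph H) (h : H) : (G.cutEdge h).IsConnected ↔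
    Nonempty H ∧ ∀ P : H → Prop, (∀ a b, G.vert a b → P a → P b) →
      (∀ a b, G.edge a b → ¬ G.edge h a → P a → P b) → ∀ x y, P x → P y := by
  rw [isConnected_iff]
  refine and_congr_right fun _ => forall_congr' fun P => imp_congr Iff.rfl (imp_congr ?_ Iff.rfl)
  refine forall_congr' fun a => forall_congr' fun b => ?_
  rw [cutEdge_edge]
  constructor
  · intro h1 hab ha
    exact h1 (Or.inr ⟨ha, fun hb => ha (G.edge.trans' hb (G.edge.symm' hab)), hab⟩)
  · rintro h1 (rfl | ⟨ha, _, hab⟩)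
    · exact id
    · exact h1 hab ha

section equiv

variable (G : FeynmanGraph H) (e : H' ≃ H)

theorem legs_comap : (G.comap e).legs = e ⁻¹' G.legs := by
  ext h
  constructor
  · intro hh x hx
    have := hh (e.symm x) (by simpa using hx)
    simp [← this]
  · intro hh x hx
    exact e.injective (hh _ hx)

theorem isConnected_comap : (G.comap e).IsConnected ↔ G.IsConnected := by
  rw [isConnected_iff, isConnected_iff]
  refine and_congr e.nonempty_congr ⟨fun h P hv he x y hx => ?_, fun h P hv he x y hx => ?_⟩
  · have := h (fun z => P (e z)) (fun a b hab => hv _ _ hab) (fun a b hab => he _ _ hab)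
      (e.symm x) (e.symm y)
    simp only [Equiv.apply_symm_apply] at this
    exact this hx
  · have := h (fun z => P (e.symm z)) (fun a b hab => hv _ _ (by simpa using hab))
      (fun a b hab => he _ _ (by simpa using hab)) (e x) (e y)
    simp only [Equiv.symm_apply_apply] at this
    exact this hx

theorem cutEdge_comap (h : H') : (G.comap e).cutEdge h = (G.cutEdge (e h)).comap e := by
  refine ext' (fun x y => Iff.rfl) fun x y => ?_
  change (x = y ∨ _) ↔ (e x = e y ∨ _)
  rw [e.apply_eq_iff_eq]
  exact Iff.rfl

theorem ncard_preimage_equiv (S : Set H) : (e ⁻¹' S).ncard = S.ncard :=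
  Set.ncard_preimage_of_injective_subset_range e.injective (by simp)

end equiv

/-- Connected, and still connected after cutting any one internal edge; edges have at most two
half-edges. In contrast to `IsDivergent1PI`, the graph may be a single vertex without internal
edges, and the valencies and the number of legs are free. -/
structure IsOnePI (G : FeynmanGraph H) : Prop where
  edge_le_two : ∀ h, {x | G.edge h x}.ncard ≤ 2
  connected : G.IsConnected
  irreducible : ∀ h, h ∉ G.legs → (G.cutEdge h).IsConnected

theorem isOnePI_comap (G : FeynmanGraph H) (e : H' ≃ H) :
    (G.comap e).IsOnePI ↔ G.IsOnePI := by
  have h1 : ∀ h, {x | (G.comap e).edge h x} = e ⁻¹' {x | G.edge (e h) x} := fun h => rfl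
  constructor
  · rintro ⟨a, b, c⟩
    refine ⟨fun h => ?_, (isConnected_comap G e).1 b, fun h hh => ?_⟩
    · have := a (e.symm h)
      rwa [h1, ncard_preimage_equiv, Equiv.apply_symm_apply] at this
    · have := c (e.symm h) (by rw [legs_comap]; simpa using hh)
      rwa [cutEdge_comap, isConnected_comap, Equiv.apply_symm_apply] at this
  · rintro ⟨a, b, c⟩
    refine ⟨fun h => ?_, (isConnected_comap G e).2 b, fun h hh => ?_⟩
    · rw [h1, ncard_preimage_equiv]
      exact a _
    · rw [cutEdge_comap, isConnected_comap]
      exact c _ (by rwa [legs_comap] at hh)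

theorem isDivergent1PI_iff (G : FeynmanGraph H) : G.IsDivergent1PI ↔
    (∀ h, {x | G.vert h x}.ncard = 4) ∧ G.IsOnePI ∧ (G.legs.ncard = 2 ∨ G.legs.ncard = 4) ∧
      ∃ h, h ∉ G.legs :=
  ⟨fun h => ⟨h.1, ⟨h.2, h.5, h.6⟩, h.3, h.4⟩, fun h => ⟨h.1, h.2.1.1, h.2.2.1, h.2.2.2, h.2.1.2,
    h.2.1.3⟩⟩

theorem four_valent_comap (G : FeynmanGraph H) (e : H' ≃ H) :
    (∀ h, {x | (G.comap e).vert h x}.ncard = 4) ↔ ∀ h, {x | G.vert h x}.ncard = 4 := by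
  have h1 : ∀ h, {x | (G.comap e).vert h x} = e ⁻¹' {x | G.vert (e h) x} := fun h => rfl
  simp only [h1, ncard_preimage_equiv]
  exact ⟨fun h x => by simpa using h (e.symm x), fun h x => h _⟩

theorem isDivergent1PI_comap (G : FeynmanGraph H) (e : H' ≃ H) :
    (G.comap e).IsDivergent1PI ↔ G.IsDivergent1PI := by
  rw [isDivergent1PI_iff, isDivergent1PI_iff, four_valent_comap, isOnePI_comap, legs_comap,
    ncard_preimage_equiv]
  refine and_congr Iff.rfl (and_congr Iff.rfl (and_congr Iff.rfl ?_))
  exact ⟨fun ⟨h, hh⟩ => ⟨e h, hh⟩, fun ⟨h, hh⟩ => ⟨e.symm h, by simpa using hh⟩⟩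

section toAlgebra

variable (k : Type*) [Field k]

theorem toAlgebra_of_not [Finite H] {G : FeynmanGraph H} (hG : ¬ G.IsDivergent1PI) :
    G.toAlgebra k = 1 := by
  unfold toAlgebra
  rw [dif_neg]
  rwa [isDivergent1PI_comap]

theorem toAlgebra_eq_X [Finite H] (G : FeynmanGraph H) {n : ℕ} (e : Fin n ≃ H)
    (h : (G.comap e).IsDivergent1PI) :
    G.toAlgebra k = MvPolynomial.X (Quotient.mk Divergent.setoid ⟨⟨n, G.comap e⟩, h⟩) := by
  unfold toAlgebra
  have hG : G.IsDivergent1PI := (isDivergent1PI_comap G e).1 h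
  rw [dif_pos ((isDivergent1PI_comap G _).2 hG)]
  congr 1
  apply Quotient.sound
  refine ⟨(Finite.equivFin H).symm.trans e.symm, ?_⟩
  rw [isIso_iff_eq_comap]
  change _ = G.comap (fun x => e (e.symm ((Finite.equivFin H).symm x)))
  simp only [Equiv.apply_symm_apply]
  rfl

theorem toAlgebra_comap [Finite H] [Finite H'] (G : FeynmanGraph H) (e : H' ≃ H) :
    (G.comap e).toAlgebra k = G.toAlgebra k := by
  by_cases hG : G.IsDivergent1PI
  · have h := (isDivergent1PI_comap G ((Finite.equivFin H').symm.trans e)).2 hG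
    rw [toAlgebra_eq_X k G _ h, toAlgebra_eq_X k (G.comap e) (Finite.equivFin H').symm h]
    rfl
  · rw [toAlgebra_of_not k hG, toAlgebra_of_not k (fun h => hG ((isDivergent1PI_comap G e).1 h))]

theorem toAlgebra_congr [Finite H] [Finite H'] (G : FeynmanGraph H) (G' : FeynmanGraph H')
    (e : H' ≃ H) (hv : ∀ x y, G'.vert x y ↔ G.vert (e x) (e y))
    (he : ∀ x y, G'.edge x y ↔ G.edge (e x) (e y)) : G'.toAlgebra k = G.toAlgebra k := by
  rw [← toAlgebra_comap k G e]
  congr 1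
  exact ext' hv he

end toAlgebra

section coproductInvariance

variable (k : Type*) [Field k]

theorem component_iff (G : FeynmanGraph H) (S : Set H) (x y : H) :
    G.component S x y ↔ ∀ P : H → Prop, (∀ a b, G.vert a b → P a → P b) →
      (∀ a b, a ∈ S → b ∈ S → G.edge a b → P a → P b) → P x → P y := by
  unfold component
  rw [Setoid.sup_iff_forall]
  refine forall_congr' fun P => imp_congr Iff.rfl (imp_congr ?_ Iff.rfl)
  refine forall_congr' fun a => forall_congr' fun b => ?_
  rw [within_apply]
  exact ⟨fun h ha hb hab => h (Or.inr ⟨ha, hb, hab⟩), fun h => by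
    rintro (rfl | ⟨ha, hb, hab⟩)
    · exact id
    · exact h ha hb hab⟩

theorem component_comap (G : FeynmanGraph H) (e : H' ≃ H) (S : Set H) (x y : H') :
    (G.comap e).component (e ⁻¹' S) x y ↔ G.component S (e x) (e y) := by
  rw [component_iff, component_iff]
  constructor
  · intro h P hv he
    exact h (fun z => P (e z)) (fun a b hab => hv _ _ hab) fun a b ha hb hab => he _ _ ha hb hab
  · intro h P hv he
    have := h (fun z => P (e.symm z)) (fun a b hab => hv _ _ (by simpa using hab))
      fun a b ha hb hab => he _ _ (by simpa using ha) (by simpa using hb) (by simpa using hab)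
    simpa using this

theorem vert_le_component (G : FeynmanGraph H) (S : Set H) : G.vert ≤ G.component S := le_sup_left

theorem edge_component {G : FeynmanGraph H} {S : Set H} {x y : H} (hx : x ∈ S) (hy : y ∈ S)
    (h : G.edge x y) : G.component S x y :=
  le_sup_right (a := G.vert) (b := within G.edge S)
    (show within G.edge S x y from Or.inr ⟨hx, hy, h⟩)

/-- The components of `S` in the pulled back graph are the pulled back components. -/
theorem componentGraph_comap (G : FeynmanGraph H) (e : H' ≃ H) (S : Set H) (h : H') :
    (G.comap e).componentGraph (e ⁻¹' S) h = (G.componentGraph S (e h)).comap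
      (e.subtypeEquiv fun x => component_comap G e S h x) := by
  refine ext' (fun x y => Iff.rfl) fun x y => ?_
  change (x.1 = y.1 ∨ _) ↔ (e x.1 = e y.1 ∨ _)
  rw [e.apply_eq_iff_eq]
  exact Iff.rfl

theorem toAlgebra_componentGraph_congr [Finite H] (G : FeynmanGraph H) (S : Set H) {h h' : H}
    (hh : G.component S h h') :
    (G.componentGraph S h).toAlgebra k = (G.componentGraph S h').toAlgebra k :=
  toAlgebra_congr k _ _ (Equiv.subtypeEquivRight fun _ =>
    ⟨fun hx => (G.component S).trans' ((G.component S).symm' hh) hx,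
      fun hx => (G.component S).trans' hh hx⟩)
    (fun _ _ => Iff.rfl) (fun _ _ => Iff.rfl)

theorem subgraphMonomial_comap [Finite H] [Finite H'] (G : FeynmanGraph H) (e : H' ≃ H)
    (S : Set H) : (G.comap e).subgraphMonomial k (e ⁻¹' S) = G.subgraphMonomial k S := by
  unfold subgraphMonomial
  refine finprod_eq_of_bijective (Quotient.congr e fun x y => component_comap G e S x y)
    (Equiv.bijective _) fun q => ?_
  rw [componentGraph_comap, toAlgebra_comap]
  apply toAlgebra_componentGraph_congr
  induction q using Quotient.inductionOn with
  | h x =>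
    rw [Quotient.congr_mk]
    refine (G.component S).trans' ?_
      ((G.component S).symm' (Quotient.mk_out (s := G.component S) (e x)))
    exact (component_comap G e S _ _).1 (Quotient.mk_out (s := (G.comap e).component (e ⁻¹' S)) x)

theorem componentLegs_comap (G : FeynmanGraph H) (e : H' ≃ H) (S : Set H) (h : H') :
    (G.comap e).componentLegs (e ⁻¹' S) h = e ⁻¹' G.componentLegs S (e h) := by
  ext x
  simp [componentLegs, component_comap]

theorem kept_comap (G : FeynmanGraph H) (e : H' ≃ H) (S : Set H) (h : H') :
    h ∈ (G.comap e).kept (e ⁻¹' S) ↔ e h ∈ G.kept S := by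
  simp only [kept, Set.mem_ofPred_eq, Set.mem_preimage, componentLegs_comap, ncard_preimage_equiv]

/-- The relation on half-edges generated by the edges of the contracted graph, tested on
colourings. -/
theorem contract_edge_iff (G : FeynmanGraph H) (S : Set H) (x y : H) :
    (within G.edge Sᶜ ⊔ G.bridge S) x y ↔ ∀ P : H → Prop,
      (∀ a b, a ∉ S → b ∉ S → G.edge a b → P a → P b) →
      (∀ a b, a ∉ S → b ∉ S → (G.componentLegs S a).ncard = 2 → (G.componentLegs S b).ncard = 2 →
        G.component S a b → P a → P b) → P x → P y := by
  rw [Setoid.sup_iff_forall]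
  refine forall_congr' fun P => imp_congr ?_ (imp_congr ?_ Iff.rfl)
  · refine forall_congr' fun a => forall_congr' fun b => ?_
    rw [within_apply]
    exact ⟨fun h ha hb hab => h (Or.inr ⟨ha, hb, hab⟩), fun h => by
      rintro (rfl | ⟨ha, hb, hab⟩)
      · exact id
      · exact h ha hb hab⟩
  · refine forall_congr' fun a => forall_congr' fun b => ?_
    rw [bridge, within_apply]
    exact ⟨fun h ha hb ha' hb' hab => h (Or.inr ⟨⟨ha, ha'⟩, ⟨hb, hb'⟩, hab⟩), fun h => by
      rintro (rfl | ⟨⟨ha, ha'⟩, ⟨hb, hb'⟩, hab⟩)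
      · exact id
      · exact h ha hb ha' hb' hab⟩

theorem contract_comap [Finite H] [Finite H'] (G : FeynmanGraph H) (e : H' ≃ H)
    (S : Set H) : ((G.comap e).contract (e ⁻¹' S)).toAlgebra k = (G.contract S).toAlgebra k := by
  refine toAlgebra_congr k _ _ (e.subtypeEquiv fun x => kept_comap G e S x)
    (fun x y => component_comap G e S x y) fun x y => ?_
  change (within (G.comap e).edge (e ⁻¹' S)ᶜ ⊔ (G.comap e).bridge (e ⁻¹' S)) x.1 y.1 ↔
    (within G.edge Sᶜ ⊔ G.bridge S) (e x.1) (e y.1)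
  rw [contract_edge_iff, contract_edge_iff]
  simp only [componentLegs_comap, ncard_preimage_equiv, component_comap, Set.mem_preimage,
    comap_edge]
  constructor
  · intro h P h1 h2
    exact h (fun z => P (e z)) (fun a b => h1 _ _) fun a b => h2 _ _
  · intro h P h1 h2
    have := h (fun z => P (e.symm z)) (fun a b ha hb hab => h1 _ _ (by simpa using ha)
      (by simpa using hb) (by simpa using hab)) fun a b ha hb ha' hb' hab =>
        h2 _ _ (by simpa using ha) (by simpa using hb) (by simpa using ha') (by simpa using hb')
          (by simpa using hab)
    simpa using this

theorem isDivergentSubgraph_comap (G : FeynmanGraph H) (e : H' ≃ H) (S : Set H) :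
    (G.comap e).IsDivergentSubgraph (e ⁻¹' S) ↔ G.IsDivergentSubgraph S := by
  constructor
  · rintro ⟨h1, h2, h3⟩
    refine ⟨fun h hh => ?_, fun h hh x hx => ?_, fun h hh => ?_⟩
    · have := h1 (e.symm h) (by simpa using hh)
      rw [legs_comap] at this
      simpa using this
    · simpa using h2 (e.symm h) (by simpa using hh) (e.symm x) (by simpa using hx)
    · have := h3 (e.symm h) (by simpa using hh)
      rw [componentGraph_comap, isDivergent1PI_comap] at this
      rwa [Equiv.apply_symm_apply] at this
  · rintro ⟨h1, h2, h3⟩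
    refine ⟨fun h hh => ?_, fun h hh x hx => h2 _ hh _ hx, fun h hh => ?_⟩
    · rw [legs_comap]
      exact h1 _ hh
    · rw [componentGraph_comap, isDivergent1PI_comap]
      exact h3 _ hh

theorem coproduct_comap [Finite H] [Finite H'] (G : FeynmanGraph H) (e : H' ≃ H) :
    (G.comap e).coproduct k = G.coproduct k := by
  unfold coproduct
  symm
  refine finsum_eq_of_bijective ((Equiv.Set.congr e.symm).subtypeEquiv fun S => ?_ :
    {S // G.IsDivergentSubgraph S} ≃ {S // (G.comap e).IsDivergentSubgraph S})
    (Equiv.bijective _) fun S => ?_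
  · change _ ↔ (G.comap e).IsDivergentSubgraph (e.symm '' S)
    rw [Equiv.image_eq_preimage_symm, Equiv.symm_symm, isDivergentSubgraph_comap]
  · change _ = (G.comap e).subgraphMonomial k (e.symm '' S.1) ⊗ₜ[k]
      ((G.comap e).contract (e.symm '' S.1)).toAlgebra k
    rw [Equiv.image_eq_preimage_symm, Equiv.symm_symm, subgraphMonomial_comap, contract_comap]

theorem comul_toAlgebra [Finite H] (G : FeynmanGraph H) (hG : G.IsDivergent1PI) :
    GraphAlgebra.comul k (G.toAlgebra k) = G.coproduct k := by
  rw [toAlgebra_eq_X k G (Finite.equivFin H).symm ((isDivergent1PI_comap _ _).2 hG)]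
  refine (MvPolynomial.aeval_X (fun Γ : Generator => Γ.rep.1.2.coproduct k) _).trans ?_
  obtain ⟨e, he⟩ := Quotient.mk_out (s := Divergent.setoid)
    (⟨⟨Nat.card H, G.comap (Finite.equivFin H).symm⟩, (isDivergent1PI_comap _ _).2 hG⟩ : Divergent)
  rw [isIso_iff_eq_comap] at he
  unfold Generator.rep
  rw [he, coproduct_comap, coproduct_comap]

end coproductInvariance

end FeynmanGraph

namespace FeynmanGraph

variable {H H' : Type}

/-! ### Half-edges, loops and labelled sums -/

theorem sum_ncard_classes [Finite H] (r : Setoid H) [Fintype (Quotient r)] :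
    ∑ q : Quotient r, {x | Quotient.mk r x = q}.ncard = Nat.card H := by
  classical
  have : Fintype H := Fintype.ofFinite H
  rw [Nat.card_eq_fintype_card, ← Finset.card_univ,
    Finset.card_eq_sum_card_fiberwise (f := fun x => Quotient.mk r x) (t := Finset.univ)
      (fun _ _ => Finset.mem_coe.2 (Finset.mem_univ _))]
  refine Finset.sum_congr rfl fun q _ => ?_
  rw [← Set.ncard_coe_finset]
  congr 1
  ext x
  simp

theorem setOf_mk_eq (r : Setoid H) (y : H) :
    {x | Quotient.mk r x = Quotient.mk r y} = {x | r y x} := by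
  ext x
  exact Quotient.eq.trans ⟨r.symm', r.symm'⟩

theorem four_dvd_card [Finite H] (G : FeynmanGraph H) (hG : ∀ h, {x | G.vert h x}.ncard = 4) :
    4 ∣ Nat.card H := by
  classical
  have : Fintype (Quotient G.vert) := Fintype.ofFinite _
  rw [← sum_ncard_classes G.vert]
  refine Finset.dvd_sum fun q _ => ?_
  induction q using Quotient.inductionOn with
  | h y => rw [setOf_mk_eq, hG]

theorem two_mul_edges_add_legs [Finite H] (G : FeynmanGraph H)
    (hG : ∀ h, {x | G.edge h x}.ncard ≤ 2) :
    2 * {c | c ∈ G.edge.classes ∧ c.ncard = 2}.ncard + G.legs.ncard = Nat.card H := by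
  classical
  have : Fintype (Quotient G.edge) := Fintype.ofFinite _
  have hpos : ∀ y, 1 ≤ {x | G.edge y x}.ncard := fun y =>
    (Set.ncard_pos).2 ⟨y, G.edge.refl' y⟩
  have hE : {c | c ∈ G.edge.classes ∧ c.ncard = 2}.ncard =
      ∑ q : Quotient G.edge, if {x | Quotient.mk G.edge x = q}.ncard = 2 then 1 else 0 := by
    rw [← Finset.sum_filter, Finset.sum_const, smul_eq_mul, mul_one, ← Set.ncard_coe_finset]
    symm
    refine Set.ncard_congr (fun q _ => {x | Quotient.mk G.edge x = q}) ?_ ?_ ?_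
    · intro q hq
      refine ⟨?_, by simpa using hq⟩
      induction q using Quotient.inductionOn with
      | h y => exact ⟨y, by ext x; exact Quotient.eq⟩
    · intro q q' _ _ h
      induction q using Quotient.inductionOn with
      | h y =>
        have : y ∈ {x | Quotient.mk G.edge x = q'} := h ▸ (rfl : Quotient.mk G.edge y = _)
        exact this
    · rintro c ⟨⟨y, rfl⟩, hc⟩
      have : {x | Quotient.mk G.edge x = Quotient.mk G.edge y} = {x | G.edge x y} := by
        ext x; exact Quotient.eq
      exact ⟨Quotient.mk G.edge y, by simpa [this] using hc, this⟩
  have hL : G.legs.ncard =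
      ∑ q : Quotient G.edge, if {x | Quotient.mk G.edge x = q}.ncard = 1 then 1 else 0 := by
    rw [← Finset.sum_filter, Finset.sum_const, smul_eq_mul, mul_one, ← Set.ncard_coe_finset]
    have key : ∀ y, y ∈ G.legs ↔ {x | G.edge y x}.ncard = 1 := by
      intro y
      rw [Set.ncard_eq_one]
      constructor
      · intro hy
        exact ⟨y, Set.eq_singleton_iff_unique_mem.2 ⟨G.edge.refl' y, hy⟩⟩
      · rintro ⟨a, ha⟩ x hx
        have h1 : x ∈ ({a} : Set H) := ha ▸ hx
        have h2 : y ∈ ({a} : Set H) := ha ▸ G.edge.refl' y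
        rw [Set.mem_singleton_iff] at h1 h2
        rw [h1, h2]
    refine Set.ncard_congr (fun y _ => Quotient.mk G.edge y) ?_ ?_ ?_
    · intro y hy
      simpa [setOf_mk_eq] using (key y).1 hy
    · intro y y' hy _ h
      exact (hy _ (Quotient.eq.1 h)).symm
    · intro q hq
      induction q using Quotient.inductionOn with
      | h y => exact ⟨y, (key y).2 (by simpa [setOf_mk_eq] using hq), rfl⟩
  rw [hE, hL, Finset.mul_sum, ← Finset.sum_add_distrib, ← sum_ncard_classes G.edge]
  refine Finset.sum_congr rfl fun q _ => ?_
  induction q using Quotient.inductionOn with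
  | h y =>
    rw [setOf_mk_eq]
    have h1 := hpos y
    have h2 := hG y
    split_ifs <;> omega

/-- The number of half-edges of a divergent graph in terms of its loop order and number of legs. -/
theorem card_add_four [Finite H] (G : FeynmanGraph H) (hG : G.IsDivergent1PI) :
    Nat.card H + 4 = 4 * G.loops + 2 * G.legs.ncard := by
  have h1 := G.four_mul_card_vertices hG
  have h2 := two_mul_edges_add_legs G hG.edge_le_two
  have h3 : 1 ≤ Nat.card H := by
    have := hG.connected.1
    exact Nat.card_pos
  unfold loops
  rcases hG.two_or_four_legs with h | h <;> omega

theorem loops_comap [Finite H] [Finite H'] (G : FeynmanGraph H) (hG : G.IsDivergent1PI)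
    (e : H' ≃ H) : (G.comap e).loops = G.loops := by
  have h1 := card_add_four G hG
  have h2 := card_add_four (G.comap e) ((isDivergent1PI_comap G e).2 hG)
  rw [legs_comap, ncard_preimage_equiv, Nat.card_congr e] at h2
  omega

theorem exists_generator (k : Type*) [Field k] [Finite H] (G : FeynmanGraph H)
    (hG : G.IsDivergent1PI) :
    ∃ Γ : Generator, G.toAlgebra k = MvPolynomial.X Γ ∧ Γ.loops = G.loops := by
  refine ⟨_, toAlgebra_eq_X k G (Finite.equivFin H).symm ((isDivergent1PI_comap _ _).2 hG), ?_⟩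
  obtain ⟨e, he⟩ := Quotient.mk_out (s := Divergent.setoid)
    (⟨⟨Nat.card H, G.comap (Finite.equivFin H).symm⟩, (isDivergent1PI_comap _ _).2 hG⟩ : Divergent)
  rw [isIso_iff_eq_comap] at he
  unfold Generator.loops Generator.rep
  rw [he, loops_comap _ ((isDivergent1PI_comap _ _).2 hG), loops_comap _ hG]

noncomputable instance [Finite H] : Fintype (FeynmanGraph H) := Fintype.ofFinite _

open Classical in
/-- The four-valent graphs on the half-edges `H` that are connected and irreducible and whose set of
external legs is `R`. If `R` has two or four elements and is not everything, these are the divergent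
graphs with legs `R`; if `R` is everything and has four elements, it is the single vertex. -/
noncomputable def pieces (H : Type) [Finite H] (R : Set H) : Finset (FeynmanGraph H) :=
  Finset.univ.filter fun G => (∀ h, {x | G.vert h x}.ncard = 4) ∧ G.IsOnePI ∧ G.legs = R

theorem mem_pieces [Finite H] {R : Set H} {G : FeynmanGraph H} : G ∈ pieces H R ↔
    (∀ h, {x | G.vert h x}.ncard = 4) ∧ G.IsOnePI ∧ G.legs = R := by
  simp [pieces]

theorem isDivergent1PI_of_mem_pieces [Finite H] {R : Set H} {G : FeynmanGraph H}
    (hG : G ∈ pieces H R) (hR : R.ncard = 2 ∨ R.ncard = 4) (hne : R ≠ Set.univ) :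
    G.IsDivergent1PI := by
  rw [mem_pieces] at hG
  rw [isDivergent1PI_iff, hG.2.2]
  exact ⟨hG.1, hG.2.1, hR, (Set.ne_univ_iff_exists_notMem R).1 hne⟩

section pieceSum

variable (k : Type*) [Field k]

/-- The sum of the graphs in `pieces H R`, as elements of the algebra of graphs. -/
noncomputable def pieceSum (H : Type) [Finite H] (R : Set H) : GraphAlgebra k :=
  ∑ G ∈ pieces H R, G.toAlgebra k

theorem comap_mem_pieces [Finite H] [Finite H'] {G : FeynmanGraph H} {R : Set H} (e : H' ≃ H) :
    G.comap e ∈ pieces H' (e ⁻¹' R) ↔ G ∈ pieces H R := by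
  rw [mem_pieces, mem_pieces, four_valent_comap, isOnePI_comap, legs_comap,
    e.surjective.preimage_injective.eq_iff]

theorem pieceSum_preimage [Finite H] [Finite H'] (e : H' ≃ H) (R : Set H) :
    pieceSum k H' (e ⁻¹' R) = pieceSum k H R := by
  unfold pieceSum
  refine Finset.sum_nbij' (fun G => G.comap e.symm) (fun G => G.comap e) ?_ ?_ ?_ ?_ ?_
  · intro G hG
    rw [← comap_mem_pieces e, comap_comap, e.symm_comp_self]
    exact hG
  · intro G hG
    exact (comap_mem_pieces e).2 hG
  · intro G _
    rw [comap_comap]; simp [Function.comp_def]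
  · intro G _
    rw [comap_comap]; simp [Function.comp_def]
  · intro G _
    rw [toAlgebra_comap]

open Nat in
/-- The sum of the `r`-point graphs with `s` internal half-edges, divided by `s!`. By orbit counting
this is the sum over isomorphism classes with legs fixed, divided by the symmetry factors. -/
noncomputable def pieceCoeff (r s : ℕ) : GraphAlgebra k :=
  (s ! : k)⁻¹ • pieceSum k (Fin s ⊕ Fin r) (Set.range Sum.inr)

open Nat in
theorem pieceSum_eq [CharZero k] [Finite H] (R : Set H) :
    pieceSum k H R = ((Rᶜ.ncard)! : k) • pieceCoeff k R.ncard Rᶜ.ncard := by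
  classical
  have e1 : (Rᶜ : Set H) ≃ Fin Rᶜ.ncard := Finite.equivFinOfCardEq rfl
  have e2 : R ≃ Fin R.ncard := Finite.equivFinOfCardEq rfl
  let e : Fin Rᶜ.ncard ⊕ Fin R.ncard ≃ H :=
    ((Equiv.sumCongr e1 e2).symm.trans (Equiv.sumComm _ _)).trans (Equiv.Set.sumCompl R)
  have he : e ⁻¹' R = Set.range Sum.inr := by
    ext x
    rcases x with x | x
    · have : e (Sum.inl x) = (e1.symm x : H) := by simp [e]
      have h1 : (e1.symm x : H) ∉ R := (e1.symm x).2
      simp [this, h1]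
    · have : e (Sum.inr x) = (e2.symm x : H) := by simp [e]
      simp [this]
  have h := pieceSum_preimage k e R
  rw [he] at h
  unfold pieceCoeff
  rw [h, smul_smul, mul_inv_cancel₀ (Nat.cast_ne_zero.2 (Nat.factorial_ne_zero _)), one_smul]

theorem pieceCoeff_eq_zero {r s : ℕ} (h : ¬ 4 ∣ s + r) : pieceCoeff k r s = 0 := by
  unfold pieceCoeff pieceSum
  rw [Finset.sum_eq_zero, smul_zero]
  intro G hG
  have := four_dvd_card G (mem_pieces.1 hG).1
  simp only [Nat.card_eq_fintype_card, Fintype.card_sum, Fintype.card_fin] at this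
  exact absurd this h

theorem pieceCoeff_four_zero : pieceCoeff k 4 0 = 1 := by
  unfold pieceCoeff pieceSum
  have hu : (Set.range Sum.inr : Set (Fin 0 ⊕ Fin 4)) = Set.univ := by
    ext x
    rcases x with x | x
    · exact x.elim0
    · simp
  have hp : pieces (Fin 0 ⊕ Fin 4) (Set.range Sum.inr) = {⟨⊤, ⊥⟩} := by
    ext G
    rw [mem_pieces, Finset.mem_singleton, hu]
    constructor
    · rintro ⟨-, h2, h3⟩
      have hE : ∀ x y, G.edge x y ↔ x = y := by
        refine fun x y => ⟨fun h => ?_, fun h => h ▸ G.edge.refl' x⟩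
        have : x ∈ G.legs := h3 ▸ Set.mem_univ x
        exact (this y h).symm
      refine ext' (fun x y => ⟨fun _ => trivial, fun _ => ?_⟩) hE
      refine ((isConnected_iff G).1 h2.connected).2 (fun z => G.vert x z) ?_ ?_ x y (G.vert.refl' x)
      · exact fun a b hab ha => G.vert.trans' ha hab
      · intro a b hab ha
        rwa [← (hE a b).1 hab]
    · rintro rfl
      have hl : ∀ h : Fin 0 ⊕ Fin 4, h ∈ (⟨⊤, ⊥⟩ : FeynmanGraph (Fin 0 ⊕ Fin 4)).legs :=
        fun h x hx => (show h = x from hx).symm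
      refine ⟨fun h => ?_, ⟨fun h => ?_, ?_, fun h hh => absurd (hl h) hh⟩,
        Set.eq_univ_of_forall hl⟩
      · have : {x | (⊤ : Setoid (Fin 0 ⊕ Fin 4)) h x} = Set.univ :=
          Set.eq_univ_of_forall fun _ => trivial
        change {x | (⊤ : Setoid (Fin 0 ⊕ Fin 4)) h x}.ncard = 4
        rw [this, Set.ncard_univ]
        simp
      · have : {x | (⊥ : Setoid (Fin 0 ⊕ Fin 4)) h x} = {h} := by
          ext x
          exact ⟨fun hx => (show h = x from hx).symm, fun hx => (show h = x from hx.symm)⟩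
        change {x | (⊥ : Setoid (Fin 0 ⊕ Fin 4)) h x}.ncard ≤ 2
        rw [this, Set.ncard_singleton]
        norm_num
      · exact ⟨⟨Sum.inr 0⟩, by rw [eq_top_iff]; exact le_sup_left⟩
  rw [hp, Finset.sum_singleton, toAlgebra_of_not]
  · simp
  · intro h
    obtain ⟨x, hx⟩ := h.exists_internal
    exact hx fun y hy => (show x = y from hy).symm

end pieceSum

end FeynmanGraph

namespace FeynmanGraph

/-! ### Orbit counting -/

theorem comap_symm_eq_iff {H H' : Type} {G : FeynmanGraph H} {G' : FeynmanGraph H'} {e : H ≃ H'} :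
    G.comap e.symm = G' ↔ G = G'.comap e := by
  constructor
  · rintro rfl
    rw [comap_comap, e.symm_comp_self]
    rfl
  · rintro rfl
    rw [comap_comap, e.self_comp_symm]
    rfl

variable {r : ℕ}

/-- The graph `G` with legs `0, …, r - 1` belongs to the class `Λ` of graphs with labelled legs. -/
def HasClass {H : Type} (ρ : Fin r → H) (G : FeynmanGraph H) (Λ : LegLabelledClass r) : Prop :=
  ∃ e : Fin Λ.rep.1.1 ≃ H, Λ.graph = G.comap e ∧ ∀ i, e (Λ.rep.1.2.2 i) = ρ i

theorem LegLabelledClass.isDivergent1PI (Λ : LegLabelledClass r) : Λ.graph.IsDivergent1PI :=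
  Λ.rep.2.1

theorem LegLabelledClass.range_legs (Λ : LegLabelledClass r) :
    Set.range Λ.rep.1.2.2 = Λ.graph.legs := Λ.rep.2.2.2

theorem LegLabelledClass.legs_ncard (Λ : LegLabelledClass r) : Λ.graph.legs.ncard = r := by
  rw [← Λ.range_legs, ← Set.image_univ, Set.ncard_image_of_injective _ Λ.rep.2.2.1, Set.ncard_univ,
    Nat.card_fin]

variable {s : ℕ}

theorem HasClass.unique {H : Type} {ρ : Fin r → H} {G : FeynmanGraph H} {Λ Λ' : LegLabelledClass r}
    (h : HasClass ρ G Λ) (h' : HasClass ρ G Λ') : Λ = Λ' := by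
  obtain ⟨e, he, hl⟩ := h
  obtain ⟨e', he', hl'⟩ := h'
  refine Quotient.out_equiv_out.1 ⟨e.trans e'.symm, ?_, fun i => ?_⟩
  · refine (isIso_iff_eq_comap Λ.graph Λ'.graph _).2 ?_
    rw [he, he', comap_comap]
    congr 1
    ext x
    exact (e'.apply_symm_apply (e x)).symm
  · exact (Equiv.symm_apply_eq e').2 ((hl i).trans (hl' i).symm)

theorem exists_hasClass (hr : r = 2 ∨ r = 4) (hs : 0 < s) {G : FeynmanGraph (Fin s ⊕ Fin r)}
    (hG : G ∈ pieces _ (Set.range Sum.inr)) : ∃ Λ : LegLabelledClass r, HasClass Sum.inr G Λ := by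
  have hR : (Set.range (Sum.inr : Fin r → Fin s ⊕ Fin r)).ncard = r := by
    rw [← Set.image_univ, Set.ncard_image_of_injective _ Sum.inr_injective, Set.ncard_univ,
      Nat.card_fin]
  have hD : G.IsDivergent1PI := isDivergent1PI_of_mem_pieces hG (by rwa [hR]) fun h => by
    have : (Sum.inl ⟨0, hs⟩ : Fin s ⊕ Fin r) ∈ Set.range Sum.inr := h ▸ Set.mem_univ _
    simp at this
  let e : Fin (s + r) ≃ Fin s ⊕ Fin r := finSumFinEquiv.symm
  have hL : Set.range (e.symm ∘ Sum.inr) = (G.comap e).legs := by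
    rw [legs_comap, (mem_pieces.1 hG).2.2, Set.range_comp, Equiv.image_eq_preimage_symm,
      Equiv.symm_symm]
  let L : LegLabelled r := ⟨⟨s + r, (G.comap e, e.symm ∘ Sum.inr)⟩,
    (isDivergent1PI_comap G e).2 hD, e.symm.injective.comp Sum.inr_injective, hL⟩
  obtain ⟨f, hf, hf'⟩ := Quotient.mk_out (s := LegLabelled.setoid r) L
  refine ⟨Quotient.mk (LegLabelled.setoid r) L, f.trans e, ?_, fun i => ?_⟩
  · rw [isIso_iff_eq_comap] at hf
    exact hf
  · have := hf' i
    exact (Equiv.eq_symm_apply e).1 this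

open Classical Nat in
/-- Orbit counting: the bijections from a representative to `Fin s ⊕ Fin r` that respect the
labelled legs are acted on by the automorphisms fixing the legs, and the orbits are the graphs in
the class. -/
theorem card_hasClass_mul_symmetryFactor (Λ : LegLabelledClass r) (hm : Λ.rep.1.1 = s + r) :
    ((pieces (Fin s ⊕ Fin r) (Set.range Sum.inr)).filter (HasClass Sum.inr · Λ)).card *
      Λ.graph.symmetryFactor = s ! := by
  set H := Fin s ⊕ Fin r
  let ℓ : Fin r → Fin Λ.rep.1.1 := Λ.rep.1.2.2
  have hℓ : Function.Injective ℓ := Λ.rep.2.2.1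
  have hleg : ∀ x, x ∈ Λ.graph.legs ↔ ∃ i, ℓ i = x := fun x => by
    rw [← Λ.range_legs]; exact Iff.rfl
  let E := {e : Fin Λ.rep.1.1 ≃ H // ∀ i, e (ℓ i) = Sum.inr i}
  have hE : Fintype.card E = s ! := by
    let e₀ : Set.range ℓ ≃ Set.range (Sum.inr : Fin r → H) :=
      (Equiv.ofInjective ℓ hℓ).symm.trans (Equiv.ofInjective _ Sum.inr_injective)
    have e₀_apply : ∀ i, (e₀ ⟨ℓ i, i, rfl⟩ : H) = Sum.inr i := fun i => by
      have : (Equiv.ofInjective ℓ hℓ).symm ⟨ℓ i, i, rfl⟩ = i :=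
        Equiv.ofInjective_symm_apply hℓ i
      simp [e₀, this]
    let F : E ≃ {e : Fin Λ.rep.1.1 ≃ H // ∀ x : Set.range ℓ, e x = e₀ x} :=
      Equiv.subtypeEquivRight fun e => ⟨fun h x => by
        obtain ⟨x, i, rfl⟩ := x
        rw [e₀_apply]
        exact h i, fun h i => by
        rw [← e₀_apply]
        exact h ⟨ℓ i, i, rfl⟩⟩
    have hcard1 : Fintype.card ((Set.range ℓ)ᶜ : Set _) = s := by
      rw [Fintype.card_compl_set, Set.card_range_of_injective hℓ, Fintype.card_fin,
        Fintype.card_fin, hm]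
      simp
    have hcard2 : Fintype.card ((Set.range (Sum.inr : Fin r → H))ᶜ : Set _) = s := by
      rw [Fintype.card_compl_set, Set.card_range_of_injective Sum.inr_injective]
      simp
    rw [Fintype.card_congr (F.trans (Equiv.Set.compl e₀)),
      Fintype.card_equiv (Fintype.equivOfCardEq (hcard1.trans hcard2.symm)), hcard1]
  have hmaps : ∀ e ∈ (Finset.univ : Finset E), Λ.graph.comap e.1.symm ∈
      (pieces H (Set.range Sum.inr)).filter (HasClass Sum.inr · Λ) := by
    rintro ⟨e, he⟩ -
    rw [Finset.mem_filter]
    constructor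
    · have hp : Λ.graph ∈ pieces _ Λ.graph.legs := by
        have := (isDivergent1PI_iff _).1 Λ.isDivergent1PI
        exact mem_pieces.2 ⟨this.1, this.2.1, rfl⟩
      have h2 := (comap_mem_pieces e.symm).2 hp
      have h3 : e.symm ⁻¹' Λ.graph.legs = Set.range Sum.inr := by
        ext x
        rw [Set.mem_preimage, hleg]
        constructor
        · rintro ⟨i, hi⟩
          exact ⟨i, by rw [← he i, hi, Equiv.apply_symm_apply]⟩
        · rintro ⟨i, rfl⟩
          exact ⟨i, by rw [← he i, Equiv.symm_apply_apply]⟩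
      rwa [h3] at h2
    · refine ⟨e, ?_, he⟩
      rw [comap_comap, e.symm_comp_self]
      rfl
  -- A bijection in the fibre over `G` differs from a fixed one, `e₀`, by an automorphism.
  rw [← hE, ← Finset.card_univ, Finset.card_eq_sum_card_fiberwise hmaps, Finset.sum_const_nat]
  intro G hG
  obtain ⟨-, e₀, h₀, hl₀⟩ := Finset.mem_filter.1 hG
  unfold symmetryFactor
  rw [← Fintype.card_subtype, ← Nat.card_eq_fintype_card]
  refine Nat.card_congr ?_
  refine ⟨fun e => ⟨e.1.1.trans e₀.symm, ?_, ?_⟩, fun σ => ⟨⟨σ.1.trans e₀, ?_⟩, ?_⟩, ?_, ?_⟩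
  · rw [isIso_iff_eq_comap]
    exact (comap_symm_eq_iff.1 e.2).trans
      (congrArg (fun G' => G'.comap e.1.1) (comap_symm_eq_iff.2 h₀)).symm
  · intro h hh
    obtain ⟨i, rfl⟩ := (hleg h).1 hh
    change e₀.symm (e.1.1 _) = _
    rw [Equiv.symm_apply_eq, e.1.2 i]
    exact (hl₀ i).symm
  · intro i
    change e₀ (σ.1 (ℓ i)) = _
    rw [σ.2.2 _ ((hleg _).2 ⟨i, rfl⟩)]
    exact hl₀ i
  · have h := (isIso_iff_eq_comap _ _ _).1 σ.2.1
    change Λ.graph.comap (σ.1.symm ∘ e₀.symm) = G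
    have h' : Λ.graph.comap σ.1.symm = Λ.graph := comap_symm_eq_iff.2 h
    rw [← comap_comap, h', h₀, comap_comap, e₀.self_comp_symm]
    rfl
  · intro e
    apply Subtype.ext
    apply Subtype.ext
    ext x
    simp
  · intro σ
    apply Subtype.ext
    ext x
    simp

end FeynmanGraph

open Classical in
/-- `Γ⁽ʳ⁾ₙ` as a sum of graphs on a fixed set of half-edges: an `r`-point graph with `n` loops has
`4 * n + r - 4` internal half-edges. -/
theorem GraphAlgebra.pointSum_eq (k : Type*) [Field k] [CharZero k] {r s n : ℕ}
    (hr : r = 2 ∨ r = 4) (hs : 0 < s) (hn : s + 4 = 4 * n + r) :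
    GraphAlgebra.pointSum k r n = pieceCoeff k r s := by
  have : Fintype {Λ : LegLabelledClass r // Λ.graph.loops = n} := Fintype.ofFinite _
  have hm : ∀ Λ : {Λ : LegLabelledClass r // Λ.graph.loops = n}, Λ.1.rep.1.1 = s + r := by
    intro Λ
    have h := card_add_four Λ.1.graph Λ.1.isDivergent1PI
    rw [Λ.2, Λ.1.legs_ncard, Nat.card_fin] at h
    omega
  have key : ∀ G ∈ pieces (Fin s ⊕ Fin r) (Set.range Sum.inr), G.toAlgebra k =
      ∑ Λ : {Λ : LegLabelledClass r // Λ.graph.loops = n},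
        if HasClass Sum.inr G Λ.1 then Λ.1.graph.toAlgebra k else 0 := by
    intro G hG
    obtain ⟨Λ, hΛ⟩ := exists_hasClass hr hs hG
    have hΛn : Λ.graph.loops = n := by
      obtain ⟨e, -, -⟩ := hΛ
      have h := card_add_four Λ.graph Λ.isDivergent1PI
      rw [Λ.legs_ncard, Nat.card_congr e, Nat.card_eq_fintype_card, Fintype.card_sum,
        Fintype.card_fin, Fintype.card_fin] at h
      omega
    rw [Finset.sum_eq_single ⟨Λ, hΛn⟩, if_pos hΛ]
    · obtain ⟨e, he, -⟩ := hΛ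
      rw [he, toAlgebra_comap]
    · intro Λ' _ hne
      exact if_neg fun h => hne (Subtype.ext (h.unique hΛ))
    · exact fun h => absurd (Finset.mem_univ _) h
  unfold pieceCoeff pieceSum GraphAlgebra.pointSum
  rw [finsum_eq_sum_of_fintype, Finset.sum_congr rfl key, Finset.sum_comm, Finset.smul_sum]
  refine Finset.sum_congr rfl fun Λ _ => ?_
  rw [← Finset.sum_filter, Finset.sum_const, ← card_hasClass_mul_symmetryFactor Λ.1 (hm Λ),
    ← Nat.cast_smul_eq_nsmul k, smul_smul, MvPolynomial.C_mul']
  congr 1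
  have hne : (((pieces (Fin s ⊕ Fin r) (Set.range Sum.inr)).filter
      (HasClass Sum.inr · Λ.1)).card : k) ≠ 0 := by
    have := card_hasClass_mul_symmetryFactor Λ.1 (hm Λ)
    intro h0
    rw [Nat.cast_eq_zero.1 h0, zero_mul] at this
    exact (Nat.factorial_ne_zero s) this.symm
  rw [Nat.cast_mul, mul_inv_rev, mul_assoc, inv_mul_cancel₀ hne, mul_one]

/-! ### Distributing labels over components -/

theorem Derivation.leibniz_finset_prod {R A ι : Type*} [CommSemiring R] [CommSemiring A]
    [Algebra R A] [DecidableEq ι] (D : Derivation R A A) (s : Finset ι) (f : ι → A) :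
    D (∏ i ∈ s, f i) = ∑ i ∈ s, (∏ j ∈ s.erase i, f j) * D (f i) := by
  induction s using Finset.induction_on with
  | empty => simp
  | insert a s ha ih =>
    rw [Finset.prod_insert ha, D.leibniz, ih, Finset.sum_insert ha, Finset.erase_insert ha,
      smul_eq_mul, smul_eq_mul, Finset.mul_sum, add_comm]
    congr 1
    refine Finset.sum_congr rfl fun i hi => ?_
    have hai : a ≠ i := fun h => ha (h ▸ hi)
    rw [Finset.erase_insert_of_ne hai,
      Finset.prod_insert (fun h => ha (Finset.mem_of_mem_erase h)), mul_assoc]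

open Nat in
/-- The product formula for exponential generating functions: labels are distributed over the
elements of `B`, and `c` labels at `b` have weight `c! * p b c`. Adding a label is differentiation,
which gives an induction on the number of labels. -/
theorem sum_functions_prod_factorial {A B : Type*} [CommRing A] [Fintype B] [DecidableEq B] (t : ℕ)
    (p : B → ℕ → A) :
    ∑ f : Fin t → B, ∏ b, (((Finset.univ.filter fun i => f i = b).card ! : ℕ) : A) *
      p b (Finset.univ.filter fun i => f i = b).card =
      ((t ! : ℕ) : A) * PowerSeries.coeff t (∏ b, PowerSeries.mk (p b)) := by
  induction t generalizing p with
  | zero =>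
    rw [Fintype.sum_unique, PowerSeries.coeff_zero_eq_constantCoeff, map_prod]
    simp
  | succ t ih =>
    rw [← (Fin.consEquiv fun _ => B).sum_comp, Fintype.sum_prod_type, Nat.factorial_succ,
      Nat.cast_mul, mul_comm ((t + 1 : ℕ) : A), mul_assoc]
    have hd := PowerSeries.coeff_derivative (∏ b, PowerSeries.mk (p b)) t
    rw [Derivation.leibniz_finset_prod, map_sum] at hd
    rw [mul_comm ((t + 1 : ℕ) : A), Nat.cast_add, Nat.cast_one, ← hd, Finset.mul_sum]
    refine Finset.sum_congr rfl fun b₀ _ => ?_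
    -- The factor that is differentiated belongs to the block `b₀` of the first label.
    let q : B → ℕ → A := Function.update p b₀ fun j => ((j + 1 : ℕ) : A) * p b₀ (j + 1)
    have hq : (∏ b ∈ Finset.univ.erase b₀, PowerSeries.mk (p b)) *
        PowerSeries.derivative A (PowerSeries.mk (p b₀)) = ∏ b, PowerSeries.mk (q b) := by
      rw [← Finset.prod_erase_mul _ _ (Finset.mem_univ b₀)]
      congr 1
      · refine Finset.prod_congr rfl fun b hb => ?_
        simp [q, Finset.ne_of_mem_erase hb]
      · ext j
        simp [q, PowerSeries.coeff_derivative, mul_comm]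
    rw [hq, ← ih q]
    refine Finset.sum_congr rfl fun f _ => Finset.prod_congr rfl fun b _ => ?_
    have hc : (Finset.univ.filter fun i => (Fin.consEquiv fun _ => B) (b₀, f) i = b).card =
        (if b₀ = b then 1 else 0) + (Finset.univ.filter fun i => f i = b).card := by
      rw [Fin.card_filter_univ_succ']
      rfl
    rw [hc]
    by_cases hb : b₀ = b
    · subst hb
      rw [if_pos rfl, add_comm 1, Nat.factorial_succ]
      simp only [q, Function.update_self]
      push_cast
      ring
    · rw [if_neg hb, zero_add]
      simp only [q, Function.update_of_ne (Ne.symm hb)]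

namespace FeynmanGraph

variable {H : Type} {B : Type*}

section glue

/-- A family of equivalence relations on the fibres of a map, glued to one relation. -/
def glueSetoid (f : H → B) (p : ∀ b, Setoid {x // f x = b}) : Setoid H where
  r x y := ∃ (b : B) (hx : f x = b) (hy : f y = b), p b ⟨x, hx⟩ ⟨y, hy⟩
  iseqv :=
    { refl := fun _ => ⟨_, rfl, rfl, (p _).refl' _⟩
      symm := fun ⟨b, hx, hy, h⟩ => ⟨b, hy, hx, (p b).symm' h⟩
      trans := by
        rintro x y z ⟨b, hx, rfl, h⟩ ⟨_, rfl, hz, h'⟩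
        exact ⟨_, hx, hz, (p _).trans' h h'⟩ }

theorem glueSetoid_apply {f : H → B} {p : ∀ b, Setoid {x // f x = b}} {b : B} {x y : H}
    (hx : f x = b) (hy : f y = b) : glueSetoid f p x y ↔ p b ⟨x, hx⟩ ⟨y, hy⟩ :=
  ⟨fun ⟨_, hx', _, h⟩ => by subst hx; subst hx'; exact h, fun h => ⟨b, hx, hy, h⟩⟩

theorem glueSetoid_comap {f : H → B} {r : Setoid H} (hr : r ≤ Setoid.ker f) :
    glueSetoid f (fun _ => r.comap Subtype.val) = r :=
  Setoid.ext fun _ y => ⟨fun ⟨_, _, _, h⟩ => h, fun h => ⟨f y, hr h, rfl, h⟩⟩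

end glue

section fills

variable [Finite H] (f : H → B) (S : Set H)

open Classical in
/-- The graphs whose components are the fibres of `f`, each component being a piece, such that `S`
is the set of half-edges of internal edges. -/
noncomputable def fills : Finset (FeynmanGraph H) :=
  Finset.univ.filter fun F => F.vert ≤ Setoid.ker f ∧ F.edge ≤ Setoid.ker f ∧
    ∀ b, F.comap (Subtype.val : {x // f x = b} → H) ∈ pieces _ (Subtype.val ⁻¹' Sᶜ)

theorem mem_fills {f : H → B} {S : Set H} {F : FeynmanGraph H} : F ∈ fills f S ↔
    F.vert ≤ Setoid.ker f ∧ F.edge ≤ Setoid.ker f ∧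
    ∀ b, F.comap (Subtype.val : {x // f x = b} → H) ∈ pieces _ (Subtype.val ⁻¹' Sᶜ) := by
  simp [fills]

theorem sum_fills (k : Type*) [Field k] [Fintype B] :
    ∑ F ∈ fills f S, ∏ b, (F.comap (Subtype.val : {x // f x = b} → H)).toAlgebra k =
      ∏ b, pieceSum k {x // f x = b} (Subtype.val ⁻¹' Sᶜ) := by
  classical
  unfold pieceSum
  rw [Finset.prod_univ_sum]
  refine Finset.sum_nbij' (fun F b => F.comap Subtype.val)
    (fun p => ⟨glueSetoid f fun b => (p b).vert, glueSetoid f fun b => (p b).edge⟩) ?_ ?_ ?_ ?_ ?_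
  · intro F hF
    rw [Fintype.mem_piFinset]
    exact (mem_fills.1 hF).2.2
  · intro p hp
    rw [Fintype.mem_piFinset] at hp
    refine mem_fills.2 ⟨?_, ?_, fun b => ?_⟩
    · rintro x y ⟨b, hx, hy, -⟩
      exact hx.trans hy.symm
    · rintro x y ⟨b, hx, hy, -⟩
      exact hx.trans hy.symm
    · convert hp b using 1
      exact ext' (fun x y => glueSetoid_apply x.2 y.2) fun x y => glueSetoid_apply x.2 y.2
  · intro F hF
    have h := mem_fills.1 hF
    exact congrArg₂ FeynmanGraph.mk (glueSetoid_comap h.1) (glueSetoid_comap h.2.1)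
  · intro p _
    funext b
    exact ext' (fun x y => glueSetoid_apply x.2 y.2) fun x y => glueSetoid_apply x.2 y.2
  · intro F _
    rfl

end fills

/-- A map defined on `S` and a map defined outside of `S`, combined. -/
noncomputable def extendMap {S : Set H} (f : S → B) (g : {x // x ∉ S} → B) (x : H) : B :=
  open Classical in if hx : x ∈ S then f ⟨x, hx⟩ else g ⟨x, hx⟩

theorem extendMap_of_mem {S : Set H} (f : S → B) (g : {x // x ∉ S} → B) {x : H} (hx : x ∈ S) :
    extendMap f g x = f ⟨x, hx⟩ := dif_pos hx

theorem extendMap_of_notMem {S : Set H} (f : S → B) (g : {x // x ∉ S} → B) {x : H} (hx : x ∉ S) :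
    extendMap f g x = g ⟨x, hx⟩ := dif_neg hx

/-- The generating function of the `r`-point pieces, by internal half-edges. -/
noncomputable def pieceSeries (k : Type*) [Field k] (r : ℕ) : PowerSeries (GraphAlgebra k) :=
  PowerSeries.mk (pieceCoeff k r)

open Nat in
/-- The sum over all ways of filling the blocks of a partition `g` of the outer half-edges, the
inner half-edges `S` being distributed over the blocks. -/
theorem sum_prod_pieceSum (k : Type*) [Field k] [CharZero k] [Fintype H] [Fintype B] (S : Set H)
    [Fintype (S → B)] (g : {x // x ∉ S} → B) :
    ∑ f : S → B, ∏ b, pieceSum k {x // extendMap f g x = b} (Subtype.val ⁻¹' Sᶜ) =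
      (S.ncard ! : k) •
        PowerSeries.coeff S.ncard (∏ b, pieceSeries k {x | g x = b}.ncard) := by
  classical
  have e : S ≃ Fin S.ncard := Finite.equivFinOfCardEq rfl
  have h := sum_functions_prod_factorial S.ncard
    (fun b => pieceCoeff k {x | g x = b}.ncard)
  rw [Algebra.smul_def, map_natCast]
  unfold pieceSeries
  rw [← h, ← (Equiv.arrowCongr e (Equiv.refl B)).sum_comp]
  refine Fintype.sum_congr _ _ fun f => Finset.prod_congr rfl fun b _ => ?_
  have h1 : ((Subtype.val : {x // extendMap f g x = b} → H) ⁻¹' Sᶜ).ncard =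
      {x | g x = b}.ncard := by
    refine Set.ncard_congr (fun x hx => ⟨x.1, hx⟩) ?_ ?_ ?_
    · rintro ⟨x, hxb⟩ hx
      have hx' : x ∉ S := hx
      rwa [extendMap_of_notMem f g hx'] at hxb
    · rintro ⟨x, _⟩ ⟨y, _⟩ _ _ hxy
      have hxy' := Subtype.mk.inj hxy
      exact Subtype.ext hxy'
    · rintro ⟨x, hx⟩ hxb
      exact ⟨⟨x, (extendMap_of_notMem f g hx).trans hxb⟩, hx, rfl⟩
  have h2 : ((Subtype.val : {x // extendMap f g x = b} → H) ⁻¹' Sᶜ)ᶜ.ncard =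
      (Finset.univ.filter fun i => (Equiv.arrowCongr e (Equiv.refl B)) f i = b).card := by
    rw [← Set.ncard_coe_finset]
    refine Set.ncard_congr (fun x hx => e ⟨x.1, not_not.1 hx⟩) ?_ ?_ ?_
    · rintro ⟨x, hxb⟩ hx
      have hx' : x ∈ S := not_not.1 hx
      rw [extendMap_of_mem f g hx'] at hxb
      simpa using hxb
    · rintro ⟨x, _⟩ ⟨y, _⟩ _ _ hxy
      have hxy' := Subtype.mk.inj (e.injective hxy)
      exact Subtype.ext hxy'
    · intro i hi
      have hi' : f (e.symm i) = b := by simpa using hi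
      refine ⟨⟨(e.symm i).1, (extendMap_of_mem f g (e.symm i).2).trans hi'⟩,
        fun h => h (e.symm i).2, ?_⟩
      exact e.apply_symm_apply i
  rw [pieceSum_eq, h1, h2, Algebra.smul_def, map_natCast]

end FeynmanGraph

namespace FeynmanGraph

/-! ### Subgraphs, outer graphs and fillings -/

section outer

variable {H : Type}

/-- The edges of a subgraph `S`, with all vertices. -/
def inner (G : FeynmanGraph H) (S : Set H) : FeynmanGraph H := ⟨G.vert, within G.edge S⟩

/-- The graph obtained from `G` by shrinking each component of the subgraph `S` to a vertex. A
component with two external legs becomes a bivalent vertex. -/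
def outer (G : FeynmanGraph H) (S : Set H) : FeynmanGraph {x // x ∉ S} :=
  FeynmanGraph.comap ⟨G.component S, G.edge⟩ Subtype.val

theorem component_eq_sup (G : FeynmanGraph H) (S : Set H) :
    G.component S = (G.inner S).vert ⊔ (G.inner S).edge := rfl

theorem componentGraph_eq (G : FeynmanGraph H) (S : Set H) (h : H) :
    G.componentGraph S h = (G.inner S).comap Subtype.val := rfl

theorem outer_vert {G : FeynmanGraph H} {S : Set H} {x y : {x // x ∉ S}} :
    (G.outer S).vert x y ↔ G.component S x.1 y.1 := Iff.rfl

theorem outer_edge {G : FeynmanGraph H} {S : Set H} {x y : {x // x ∉ S}} :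
    (G.outer S).edge x y ↔ G.edge x.1 y.1 := Iff.rfl

variable {G : FeynmanGraph H} {S : Set H}

theorem notMem_of_edge (hcl : ∀ h ∈ S, ∀ x, G.edge h x → x ∈ S) {x y : H} (hx : x ∉ S)
    (h : G.edge x y) : y ∉ S := fun hy => hx (hcl y hy x (G.edge.symm' h))

theorem legs_outer (hcl : ∀ h ∈ S, ∀ x, G.edge h x → x ∈ S) :
    (G.outer S).legs = Subtype.val ⁻¹' G.legs := by
  ext x
  constructor
  · intro hx y hxy
    exact congrArg Subtype.val (hx ⟨y, notMem_of_edge hcl x.2 hxy⟩ hxy)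
  · intro hx y hxy
    exact Subtype.ext (hx y.1 hxy)

theorem component_invariant {P : H → Prop} (hv : ∀ a b, G.vert a b → P a → P b)
    (he : ∀ a b, a ∈ S → b ∈ S → G.edge a b → P a → P b) {x y : H} (h : G.component S x y) :
    P x → P y := (component_iff G S x y).1 h P hv he

/-- Two-colourings of `G` and of its outer graph correspond to each other, also when edges outside
of `S`, marked by `C`, are cut. -/
theorem colouring_outer_iff (hcl : ∀ h ∈ S, ∀ x, G.edge h x → x ∈ S)
    (hmeet : ∀ x, ∃ y, y ∉ S ∧ G.component S x y) (C : H → Prop) (hC : ∀ a, C a → a ∉ S) :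
    (∀ P : H → Prop, (∀ a b, G.vert a b → P a → P b) →
      (∀ a b, G.edge a b → ¬ C a → P a → P b) → ∀ x y, P x → P y) ↔
    (∀ P : {x // x ∉ S} → Prop, (∀ a b, (G.outer S).vert a b → P a → P b) →
      (∀ a b, (G.outer S).edge a b → ¬ C a.1 → P a → P b) → ∀ x y, P x → P y) := by
  have htr : ∀ {a b c}, G.component S a b → G.component S b c → G.component S a c :=
    fun h h' => (G.component S).trans' h h'
  have hsy : ∀ {a b}, G.component S a b → G.component S b a := fun h => (G.component S).symm' h
  constructor
  · intro h P hv he x y hx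
    let Q : H → Prop := fun z => ∃ w : {x // x ∉ S}, G.component S z w.1 ∧ P w
    have hQ : ∀ z : {x // x ∉ S}, Q z.1 → P z := fun z ⟨w, hw, hPw⟩ => hv w z (hsy hw) hPw
    have hQc : ∀ a b, G.component S a b → Q a → Q b := fun a b hab ⟨w, hw, hPw⟩ =>
      ⟨w, htr (hsy hab) hw, hPw⟩
    refine hQ y (h Q (fun a b hab => hQc a b (vert_le_component G S hab)) ?_ x.1 y.1
      ⟨x, (G.component S).refl' _, hx⟩)
    intro a b hab hCa hQa
    by_cases ha : a ∈ S
    · exact hQc a b (edge_component ha (hcl a ha b hab) hab) hQa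
    · have hb := notMem_of_edge hcl ha hab
      exact ⟨⟨b, hb⟩, (G.component S).refl' _, he ⟨a, ha⟩ ⟨b, hb⟩ hab hCa (hQ ⟨a, ha⟩ hQa)⟩
  · intro h P hv he x y hx
    have hc : ∀ a b, G.component S a b → P a → P b := fun a b hab =>
      component_invariant hv (fun a b ha _ hab => he a b hab fun hCa => hC a hCa ha) hab
    obtain ⟨x', hx', hxx'⟩ := hmeet x
    obtain ⟨y', hy', hyy'⟩ := hmeet y
    exact hc y' y (hsy hyy') (h (fun z => P z.1) (fun a b hab => hc _ _ hab)
      (fun a b hab hCa => he _ _ hab hCa) ⟨x', hx'⟩ ⟨y', hy'⟩ (hc x x' hxx' hx))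

/-- If the components of `S` are irreducible and have external legs, then a graph is 1PI if and only
if its outer graph is. -/
theorem isOnePI_outer_iff (hcl : ∀ h ∈ S, ∀ x, G.edge h x → x ∈ S)
    (hirr : ∀ h ∈ S, ((G.componentGraph S h).cutEdge ⟨h, (G.component S).refl' h⟩).IsConnected)
    (hmeet : ∀ x, ∃ y, y ∉ S ∧ G.component S x y) (he2 : ∀ h, {x | G.edge h x}.ncard ≤ 2)
    [Finite H] : G.IsOnePI ↔ (G.outer S).IsOnePI := by
  have hne : Nonempty H ↔ Nonempty {x // x ∉ S} := ⟨fun ⟨x⟩ => by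
    obtain ⟨y, hy, -⟩ := hmeet x
    exact ⟨⟨y, hy⟩⟩, fun ⟨x⟩ => ⟨x.1⟩⟩
  have hconn : G.IsConnected ↔ (G.outer S).IsConnected := by
    rw [isConnected_iff, isConnected_iff, hne]
    have := colouring_outer_iff hcl hmeet (fun _ => False) (fun _ h => h.elim)
    simp only [not_false_eq_true, true_imp_iff] at this
    rw [this]
  have hcut : ∀ h : {x // x ∉ S}, (G.cutEdge h.1).IsConnected ↔
      ((G.outer S).cutEdge h).IsConnected := by
    intro h
    rw [cutEdge_isConnected_iff, cutEdge_isConnected_iff, hne]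
    rw [colouring_outer_iff hcl hmeet (fun a => G.edge h.1 a)
      (fun a ha => notMem_of_edge hcl h.2 ha)]
    rfl
  constructor
  · rintro ⟨-, h2, h3⟩
    refine ⟨fun h => ?_, hconn.1 h2, fun h hh => ?_⟩
    · refine le_trans ?_ (he2 h.1)
      rw [← Set.ncard_image_of_injective _ Subtype.val_injective]
      refine Set.ncard_le_ncard ?_
      rintro _ ⟨x, hx, rfl⟩
      exact hx
    · rw [legs_outer hcl] at hh
      exact (hcut h).1 (h3 h.1 hh)
  · rintro ⟨-, h2, h3⟩
    refine ⟨he2, hconn.2 h2, fun h hh => ?_⟩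
    by_cases hS : h ∈ S
    · have hG := hconn.2 h2
      rw [isConnected_iff] at hG
      rw [cutEdge_isConnected_iff]
      refine ⟨hG.1, fun P hv he => hG.2 P hv fun a b hab hPa => ?_⟩
      by_cases ha : G.edge h a
      · have haS := hcl h hS a ha
        have hbS := hcl a haS b hab
        have hca : G.component S h a := edge_component hS haS ha
        have hcb : G.component S h b := (G.component S).trans' hca (edge_component haS hbS hab)
        refine ((cutEdge_isConnected_iff _ _).1 (hirr h hS)).2 (fun z => P z.1)
          (fun x y hxy => hv _ _ hxy) ?_ ⟨a, hca⟩ ⟨b, hcb⟩ hPa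
        rintro x y hxy hx
        rcases (within_apply _ _ _ _).1 hxy with h1 | ⟨hxS, hyS, hxy'⟩
        · rw [h1]; exact id
        · exact he _ _ hxy' fun hhx => hx (Or.inr ⟨hS, hxS, hhx⟩)
      · exact he a b hab ha hPa
    · exact (hcut ⟨h, hS⟩).2 (h3 ⟨h, hS⟩ (by rw [legs_outer hcl]; exact hh))

open Classical in
/-- The connected and irreducible graphs with bivalent and four-valent vertices and legs `R`. -/
noncomputable def outerGraphs (L : Type) [Finite L] (R : Set L) : Finset (FeynmanGraph L) :=
  Finset.univ.filter fun O =>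
    (∀ h, {x | O.vert h x}.ncard = 2 ∨ {x | O.vert h x}.ncard = 4) ∧ O.IsOnePI ∧ O.legs = R

theorem mem_outerGraphs {L : Type} [Finite L] {R : Set L} {O : FeynmanGraph L} :
    O ∈ outerGraphs L R ↔ (∀ h, {x | O.vert h x}.ncard = 2 ∨ {x | O.vert h x}.ncard = 4) ∧
      O.IsOnePI ∧ O.legs = R := by
  simp [outerGraphs]

theorem ncard_outer_vert (x : {x // x ∉ S}) :
    {y | (G.outer S).vert x y}.ncard = (G.componentLegs S x.1).ncard := by
  rw [← Set.ncard_image_of_injective _ Subtype.val_injective]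
  congr 1
  ext y
  constructor
  · rintro ⟨y, hy, rfl⟩
    exact ⟨y.2, hy⟩
  · rintro ⟨hy, hxy⟩
    exact ⟨⟨y, hy⟩, hxy, rfl⟩

/-- The graph obtained by forgetting the bivalent vertices: the two edges at a bivalent vertex are
joined to one edge. -/
def smooth {L : Type} (O : FeynmanGraph L) : FeynmanGraph {x // {y | O.vert x y}.ncard = 4} :=
  FeynmanGraph.comap ⟨O.vert, O.edge ⊔ within O.vert {x | {y | O.vert x y}.ncard = 2}⟩ Subtype.val

theorem smooth_edge_iff {L : Type} (O : FeynmanGraph L)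
    (x y : {x // {y | O.vert x y}.ncard = 4}) : O.smooth.edge x y ↔ ∀ P : L → Prop,
      (∀ a b, O.edge a b → P a → P b) →
      (∀ a b, {y | O.vert a y}.ncard = 2 → O.vert a b → P a → P b) → P x.1 → P y.1 := by
  refine (Setoid.sup_iff_forall _ _ _ _).trans ?_
  refine forall_congr' fun P => imp_congr Iff.rfl (imp_congr ?_ Iff.rfl)
  refine forall_congr' fun a => forall_congr' fun b => ?_
  rw [within_apply]
  constructor
  · intro h ha hab
    refine h (Or.inr ⟨ha, ?_, hab⟩)
    have : {y | O.vert b y} = {y | O.vert a y} := by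
      ext y
      exact ⟨fun hy => O.vert.trans' hab hy, fun hy => O.vert.trans' (O.vert.symm' hab) hy⟩
    change {y | O.vert b y}.ncard = 2
    rwa [this]
  · rintro h (rfl | ⟨ha, _, hab⟩)
    · exact id
    · exact h ha hab

theorem toAlgebra_contract (k : Type*) [Field k] [Finite H] :
    (G.contract S).toAlgebra k = (G.outer S).smooth.toAlgebra k := by
  let e : {h // h ∈ G.kept S} ≃ {x // {y | (G.outer S).vert x y}.ncard = 4} :=
    ⟨fun x => ⟨⟨x.1, x.2.1⟩, (ncard_outer_vert _).trans x.2.2⟩,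
      fun x => ⟨x.1.1, x.1.2, (ncard_outer_vert _).symm.trans x.2⟩, fun _ => rfl, fun _ => rfl⟩
  refine toAlgebra_congr k _ _ e (fun x y => Iff.rfl) fun x y => ?_
  rw [smooth_edge_iff]
  refine (contract_edge_iff G S x.1 y.1).trans ?_
  constructor
  · intro h P h1 h2 hx
    let Q : H → Prop := fun z => ∃ hz : z ∉ S, P ⟨z, hz⟩
    obtain ⟨_, hy⟩ := h Q (fun a b ha hb hab ⟨_, hPa⟩ => ⟨hb, h1 ⟨a, ha⟩ ⟨b, hb⟩ hab hPa⟩)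
      (fun a b ha hb ha2 _ hab ⟨_, hPa⟩ =>
        ⟨hb, h2 ⟨a, ha⟩ ⟨b, hb⟩ ((ncard_outer_vert _).trans ha2) hab hPa⟩) ⟨x.2.1, hx⟩
    exact hy
  · intro h P h1 h2 hx
    exact h (fun z => P z.1) (fun a b hab => h1 _ _ a.2 b.2 hab)
      (fun a b ha hab => h2 _ _ a.2 b.2 ((ncard_outer_vert _).symm.trans ha) (by
        have : G.componentLegs S b.1 = G.componentLegs S a.1 := by
          ext z
          exact and_congr_right fun _ => ⟨fun hz => (G.component S).trans' hab hz,
            fun hz => (G.component S).trans' ((G.component S).symm' hab) hz⟩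
        rw [this]
        exact (ncard_outer_vert _).symm.trans ha) hab) hx

end outer

end FeynmanGraph

namespace FeynmanGraph

/-! ### Graphs with given inner and outer graph -/

section filling

variable {H : Type} {S : Set H} {B : Type*}

/-- The graph with inner graph `F` and outer graph `O`: the half-edges in `S` are joined as in `F`,
the others as in `O`. -/
def glueOuter (F : FeynmanGraph H) (O : FeynmanGraph {x // x ∉ S}) : FeynmanGraph H where
  vert := F.vert
  edge :=
    { r := fun x y => (x ∈ S ∧ y ∈ S ∧ F.edge x y) ∨
        ∃ (hx : x ∉ S) (hy : y ∉ S), O.edge ⟨x, hx⟩ ⟨y, hy⟩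
      iseqv :=
        { refl := fun x => by
            by_cases hx : x ∈ S
            · exact Or.inl ⟨hx, hx, F.edge.refl' x⟩
            · exact Or.inr ⟨hx, hx, O.edge.refl' _⟩
          symm := by
            rintro x y (⟨hx, hy, h⟩ | ⟨hx, hy, h⟩)
            · exact Or.inl ⟨hy, hx, F.edge.symm' h⟩
            · exact Or.inr ⟨hy, hx, O.edge.symm' h⟩
          trans := by
            rintro x y z (⟨hx, hy, h⟩ | ⟨hx, hy, h⟩) (⟨hy', hz, h'⟩ | ⟨hy', hz, h'⟩)
            · exact Or.inl ⟨hx, hz, F.edge.trans' h h'⟩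
            · exact absurd hy hy'
            · exact absurd hy' hy
            · exact Or.inr ⟨hx, hz, O.edge.trans' h h'⟩ } }

theorem glueOuter_edge {F : FeynmanGraph H} {O : FeynmanGraph {x // x ∉ S}} {x y : H} :
    (glueOuter F O).edge x y ↔ (x ∈ S ∧ y ∈ S ∧ F.edge x y) ∨
        ∃ (hx : x ∉ S) (hy : y ∉ S), O.edge ⟨x, hx⟩ ⟨y, hy⟩ := Iff.rfl

variable {φ : H → B}

theorem fills_notMem [Finite H] {F : FeynmanGraph H} (hF : F ∈ fills φ S) {x y : H} (hx : x ∉ S)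
    (h : F.edge x y) : y = x := by
  obtain ⟨-, he, hp⟩ := mem_fills.1 hF
  have hl := (mem_pieces.1 (hp (φ x))).2.2
  have hx' : (⟨x, rfl⟩ : {z // φ z = φ x}) ∈ (F.comap Subtype.val).legs := by
    rw [hl]; exact hx
  exact congrArg Subtype.val (hx' ⟨y, (he h).symm⟩ h)

theorem fills_mem [Finite H] {F : FeynmanGraph H} (hF : F ∈ fills φ S) {x : H} (hx : x ∈ S) :
    ∃ y, y ≠ x ∧ F.edge x y := by
  obtain ⟨-, -, hp⟩ := mem_fills.1 hF
  have hl := (mem_pieces.1 (hp (φ x))).2.2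
  have hx' : (⟨x, rfl⟩ : {z // φ z = φ x}) ∉ (F.comap Subtype.val).legs := by
    rw [hl]; exact fun h => h hx
  simp only [legs, Set.mem_ofPred_eq, not_forall] at hx'
  obtain ⟨y, hy, hne⟩ := hx'
  exact ⟨y.1, fun h => hne (Subtype.ext h), hy⟩

theorem fills_edge_mem [Finite H] {F : FeynmanGraph H} (hF : F ∈ fills φ S) {x y : H} (hx : x ∈ S)
    (h : F.edge x y) : y ∈ S := by
  by_contra hy
  exact hy (fills_notMem hF hy (F.edge.symm' h) ▸ hx)

theorem inner_glueOuter [Finite H] {F : FeynmanGraph H} (hF : F ∈ fills φ S)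
    (O : FeynmanGraph {x // x ∉ S}) : (glueOuter F O).inner S = F := by
  refine ext' (fun _ _ => Iff.rfl) fun x y => ?_
  refine (within_apply _ _ _ _).trans ?_
  rw [glueOuter_edge]
  constructor
  · rintro (rfl | ⟨hx, -, ⟨-, -, h⟩ | ⟨hx', -⟩⟩)
    · exact F.edge.refl' _
    · exact h
    · exact absurd hx hx'
  · intro h
    by_cases hx : x ∈ S
    · have hy := fills_edge_mem hF hx h
      exact Or.inr ⟨hx, hy, Or.inl ⟨hx, hy, h⟩⟩
    · exact Or.inl (fills_notMem hF hx h).symm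

theorem fills_sup [Finite H] {F : FeynmanGraph H} (hF : F ∈ fills φ S) :
    F.vert ⊔ F.edge = Setoid.ker φ := by
  obtain ⟨hv, he, hp⟩ := mem_fills.1 hF
  refine le_antisymm (sup_le hv he) fun x y hxy => ?_
  rw [Setoid.sup_iff_forall]
  intro P h1 h2
  exact ((isConnected_iff _).1 (mem_pieces.1 (hp (φ x))).2.1.connected).2 (fun z => P z.1)
    (fun a b hab => h1 _ _ hab) (fun a b hab => h2 _ _ hab) ⟨x, rfl⟩ ⟨y, hxy.symm⟩

theorem component_glueOuter [Finite H] {F : FeynmanGraph H} (hF : F ∈ fills φ S)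
    (O : FeynmanGraph {x // x ∉ S}) (x y : H) :
    (glueOuter F O).component S x y ↔ φ x = φ y := by
  rw [component_eq_sup, inner_glueOuter hF, fills_sup hF]
  rfl

theorem outer_glueOuter [Finite H] {F : FeynmanGraph H} (hF : F ∈ fills φ S)
    {O : FeynmanGraph {x // x ∉ S}} (hO : ∀ x y : {x // x ∉ S}, φ x.1 = φ y.1 ↔ O.vert x y) :
    (glueOuter F O).outer S = O := by
  refine ext' (fun x y => ?_) fun x y => ?_
  · rw [outer_vert, component_glueOuter hF, hO]
  · rw [outer_edge, glueOuter_edge]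
    exact ⟨by rintro (⟨hx, -⟩ | ⟨_, _, h⟩); exacts [absurd hx x.2, h],
      fun h => Or.inr ⟨x.2, y.2, h⟩⟩

theorem glueOuter_closed {F : FeynmanGraph H} {O : FeynmanGraph {x // x ∉ S}} :
    ∀ h ∈ S, ∀ x, (glueOuter F O).edge h x → x ∈ S := by
  rintro h hh x (⟨-, hx, -⟩ | ⟨hh', -⟩)
  · exact hx
  · exact absurd hh hh'

theorem glueOuter_outer (G : FeynmanGraph H) (hcl : ∀ h ∈ S, ∀ x, G.edge h x → x ∈ S) :
    glueOuter (G.inner S) (G.outer S) = G := by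
  refine ext' (fun _ _ => Iff.rfl) fun x y => ?_
  rw [glueOuter_edge]
  constructor
  · rintro (⟨_, _, rfl | ⟨_, _, h⟩⟩ | ⟨_, _, h⟩)
    · exact G.edge.refl' _
    · exact h
    · exact h
  · intro h
    by_cases hx : x ∈ S
    · have hy := hcl x hx y h
      exact Or.inl ⟨hx, hy, Or.inr ⟨hx, hy, h⟩⟩
    · exact Or.inr ⟨hx, notMem_of_edge hcl hx h, h⟩

/-- The number of legs of a component is the valency of the corresponding vertex of the outer
graph. -/
theorem ncard_fibre_legs {O : FeynmanGraph {x // x ∉ S}}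
    (hO : ∀ x y : {x // x ∉ S}, φ x.1 = φ y.1 ↔ O.vert x y) (x : {x // x ∉ S}) :
    ((Subtype.val : {z // φ z = φ x.1} → H) ⁻¹' Sᶜ).ncard = {y | O.vert x y}.ncard := by
  symm
  refine Set.ncard_congr (fun y hy => ⟨y.1, ((hO x y).2 hy).symm⟩) ?_ ?_ ?_
  · rintro ⟨y, hyS⟩ _
    exact hyS
  · rintro ⟨y, _⟩ ⟨z, _⟩ _ _ h
    have h' := Subtype.mk.inj h
    exact Subtype.ext h'
  · rintro ⟨y, hy⟩ hyS
    exact ⟨⟨y, hyS⟩, (hO x ⟨y, hyS⟩).1 hy.symm, rfl⟩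

/-- Filling the vertices of a 1PI outer graph with pieces gives a 1PI graph, in which the inner
edges form a divergent subgraph. -/
theorem glueOuter_mem [Finite H] {F : FeynmanGraph H} (hF : F ∈ fills φ S)
    {O : FeynmanGraph {x // x ∉ S}} (hO : ∀ x y : {x // x ∉ S}, φ x.1 = φ y.1 ↔ O.vert x y)
    (hφ : ∀ x, ∃ y, y ∉ S ∧ φ x = φ y) {R : Set H} (hSR : Disjoint S R)
    (hOR : O ∈ outerGraphs _ (Subtype.val ⁻¹' R)) :
    glueOuter F O ∈ pieces H R ∧ (glueOuter F O).IsDivergentSubgraph S := by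
  obtain ⟨hO4, hO1, hOl⟩ := mem_outerGraphs.1 hOR
  have hfib := fun b => mem_pieces.1 ((mem_fills.1 hF).2.2 b)
  have hFv : ∀ x y, F.vert x y → φ x = φ y := fun x y h => (mem_fills.1 hF).1 h
  have hFe : ∀ x y, F.edge x y → φ x = φ y := fun x y h => (mem_fills.1 hF).2.1 h
  have hcl : ∀ h ∈ S, ∀ x, (glueOuter F O).edge h x → x ∈ S := glueOuter_closed
  have hcomp := component_glueOuter hF O
  have hcg : ∀ h, (glueOuter F O).componentGraph S h =
      (F.comap (Subtype.val : {z // φ z = φ h} → H)).comap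
        (Equiv.subtypeEquivRight fun x => (hcomp h x).trans eq_comm) := by
    intro h
    rw [componentGraph_eq, inner_glueOuter hF]
    rfl
  have h4 : ∀ h, {x | (glueOuter F O).vert h x}.ncard = 4 := by
    intro h
    rw [← (hfib (φ h)).1 ⟨h, rfl⟩, ← Set.ncard_image_of_injective _ Subtype.val_injective]
    congr 1
    ext y
    constructor
    · intro hy
      exact ⟨⟨y, (hFv _ _ hy).symm⟩, hy, rfl⟩
    · rintro ⟨y, hy, rfl⟩
      exact hy
  have hint : ∀ h ∈ S, h ∉ (glueOuter F O).legs := by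
    intro h hh hl
    obtain ⟨y, hne, hy⟩ := fills_mem hF hh
    exact hne (hl y (Or.inl ⟨hh, fills_edge_mem hF hh hy, hy⟩))
  have hl : (glueOuter F O).legs = R := by
    ext x
    by_cases hx : x ∈ S
    · exact ⟨fun h => absurd h (hint x hx), fun h => absurd h (Set.disjoint_left.1 hSR hx)⟩
    · have h1 := legs_outer hcl
      rw [outer_glueOuter hF hO, hOl] at h1
      exact (Set.ext_iff.1 h1 ⟨x, hx⟩).symm
  have he2 : ∀ h, {x | (glueOuter F O).edge h x}.ncard ≤ 2 := by
    intro h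
    by_cases hh : h ∈ S
    · refine le_trans ?_ ((hfib (φ h)).2.1.edge_le_two ⟨h, rfl⟩)
      rw [← Set.ncard_image_of_injective _ Subtype.val_injective]
      refine Set.ncard_le_ncard ?_
      rintro y (⟨-, -, hy⟩ | ⟨hh', -⟩)
      · exact ⟨⟨y, (hFe _ _ hy).symm⟩, hy, rfl⟩
      · exact absurd hh hh'
    · refine le_trans ?_ (hO1.edge_le_two ⟨h, hh⟩)
      rw [← Set.ncard_image_of_injective _ Subtype.val_injective]
      refine Set.ncard_le_ncard ?_
      rintro y (⟨hh', -⟩ | ⟨_, hy', hy⟩)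
      · exact absurd hh' hh
      · exact ⟨⟨y, hy'⟩, hy, rfl⟩
  have hdiv : ∀ h ∈ S, ((glueOuter F O).componentGraph S h).IsDivergent1PI := by
    intro h hh
    rw [hcg, isDivergent1PI_comap]
    refine isDivergent1PI_of_mem_pieces ((mem_fills.1 hF).2.2 (φ h)) ?_ ?_
    · obtain ⟨y, hy, hhy⟩ := hφ h
      rw [hhy, ncard_fibre_legs hO ⟨y, hy⟩]
      exact hO4 _
    · intro hu
      have : (⟨h, rfl⟩ : {z // φ z = φ h}) ∈ (Subtype.val : {z // φ z = φ h} → H) ⁻¹' Sᶜ :=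
        hu ▸ Set.mem_univ _
      exact this hh
  refine ⟨mem_pieces.2 ⟨h4, ?_, hl⟩, ⟨hint, hcl, hdiv⟩⟩
  refine (isOnePI_outer_iff hcl (fun h hh => (hdiv h hh).irreducible _ ?_) ?_ he2).2 ?_
  · rw [hcg, legs_comap, (hfib _).2.2]
    exact fun h' => h' hh
  · intro x
    obtain ⟨y, hy, hxy⟩ := hφ x
    exact ⟨y, hy, (hcomp x y).2 hxy⟩
  · rw [outer_glueOuter hF hO]
    exact hO1

theorem exists_component_notMem [Finite H] {G : FeynmanGraph H} (hG : G.IsDivergentSubgraph S)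
    (x : H) :
    ∃ y, y ∉ S ∧ G.component S x y := by
  by_cases hx : x ∈ S
  · have hd := hG.components x hx
    have hne : (G.componentGraph S x).legs.Nonempty := by
      rw [← Set.ncard_pos]
      rcases hd.two_or_four_legs with h | h <;> omega
    obtain ⟨y, hy⟩ := hne
    refine ⟨y.1, fun hyS => ?_, y.2⟩
    have h1 := hG.internal _ hyS
    simp only [legs, Set.mem_ofPred_eq, not_forall] at h1
    obtain ⟨z, hz, hne⟩ := h1
    have hzS := hG.edge_closed _ hyS z hz
    have := hy ⟨z, (G.component S).trans' y.2 (edge_component hyS hzS hz)⟩ (Or.inr ⟨hyS, hzS, hz⟩)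
    exact hne (congrArg Subtype.val this)
  · exact ⟨x, hx, (G.component S).refl' x⟩

theorem componentGraph_irreducible {G : FeynmanGraph H} (hG : G.IsDivergentSubgraph S) {h : H}
    (hh : h ∈ S) :
    ((G.componentGraph S h).cutEdge ⟨h, (G.component S).refl' h⟩).IsConnected := by
  refine (hG.components h hh).irreducible _ fun hl => ?_
  have h1 := hG.internal _ hh
  simp only [legs, Set.mem_ofPred_eq, not_forall] at h1
  obtain ⟨z, hz, hne⟩ := h1
  have hzS := hG.edge_closed _ hh z hz
  exact hne (congrArg Subtype.val (hl ⟨z, edge_component hh hzS hz⟩ (Or.inr ⟨hh, hzS, hz⟩)))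

/-- Shrinking a divergent subgraph of a 1PI graph gives a 1PI graph with the same legs. -/
theorem outer_mem [Finite H] {G : FeynmanGraph H} (hG : G.IsDivergentSubgraph S) {R : Set H}
    (hp : G ∈ pieces H R) :
    Disjoint S R ∧ G.outer S ∈ outerGraphs _ (Subtype.val ⁻¹' R) := by
  obtain ⟨h4, h1, hl⟩ := mem_pieces.1 hp
  refine ⟨Set.disjoint_left.2 fun x hx hxR => hG.internal x hx (hl ▸ hxR),
    mem_outerGraphs.2 ⟨fun x => ?_, ?_, by rw [legs_outer hG.edge_closed, hl]⟩⟩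
  · have hcl : ∀ z, G.component S x.1 z →
        {y | (G.outer S).vert x y}.ncard = (G.componentLegs S z).ncard := by
      intro z hz
      rw [ncard_outer_vert]
      congr 1
      ext y
      exact and_congr_right fun _ => ⟨fun h => (G.component S).trans' ((G.component S).symm' hz) h,
        fun h => (G.component S).trans' hz h⟩
    by_cases hex : ∃ z ∈ S, G.component S x.1 z
    · obtain ⟨z, hzS, hz⟩ := hex
      have hlegs : (G.componentGraph S z).legs.ncard = (G.componentLegs S z).ncard := by
        rw [← Set.ncard_image_of_injective _ Subtype.val_injective]
        congr 1
        ext y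
        constructor
        · rintro ⟨y, hy, rfl⟩
          refine ⟨fun hyS => ?_, y.2⟩
          have h1 := hG.internal _ hyS
          simp only [legs, Set.mem_ofPred_eq, not_forall] at h1
          obtain ⟨w, hw, hne⟩ := h1
          have hwS := hG.edge_closed _ hyS w hw
          have := hy ⟨w, (G.component S).trans' y.2 (edge_component hyS hwS hw)⟩
            (Or.inr ⟨hyS, hwS, hw⟩)
          exact hne (congrArg Subtype.val this)
        · rintro ⟨hyS, hy⟩
          refine ⟨⟨y, hy⟩, fun w hw => ?_, rfl⟩
          rcases (within_apply _ _ _ _).1 hw with h | ⟨h, -⟩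
          · exact Subtype.ext h.symm
          · exact absurd h hyS
      rw [hcl z hz, ← hlegs]
      exact (hG.components z hzS).two_or_four_legs
    · right
      rw [← h4 x.1, ← Set.ncard_image_of_injective _ Subtype.val_injective]
      congr 1
      have hv : ∀ y, G.component S x.1 y → G.vert x.1 y := fun y hy => by
        refine component_invariant (P := fun w => G.vert x.1 w)
          (fun a b hab ha => G.vert.trans' ha hab) (fun a b ha _ _ hxa => ?_) hy (G.vert.refl' _)
        exact absurd ⟨a, ha, vert_le_component G S hxa⟩ hex
      ext y
      constructor
      · rintro ⟨y, hy, rfl⟩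
        exact hv _ hy
      · intro hy
        have hc : G.component S x.1 y := vert_le_component G S hy
        exact ⟨⟨y, fun hyS => hex ⟨y, hyS, hc⟩⟩, hc, rfl⟩
  · exact (isOnePI_outer_iff hG.edge_closed (fun h hh => componentGraph_irreducible hG hh)
      (exists_component_notMem hG) h1.edge_le_two).1 h1

theorem inner_mem_fills [Finite H] {G : FeynmanGraph H} (hG : G.IsDivergentSubgraph S) {R : Set H}
    (hp : G ∈ pieces H R) (hφ : ∀ x y, G.component S x y ↔ φ x = φ y)
    (hsurj : Function.Surjective φ) : G.inner S ∈ fills φ S := by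
  obtain ⟨h4, h1, hl⟩ := mem_pieces.1 hp
  have hle : (G.inner S).vert ⊔ (G.inner S).edge ≤ Setoid.ker φ := fun x y hxy => (hφ x y).1 hxy
  refine mem_fills.2 ⟨le_sup_left.trans hle, le_sup_right.trans hle, fun b => ?_⟩
  obtain ⟨x₀, rfl⟩ := hsurj b
  have hlegs : ((G.inner S).comap (Subtype.val : {z // φ z = φ x₀} → H)).legs =
      Subtype.val ⁻¹' Sᶜ := by
    ext x
    constructor
    · intro hx hxS
      have h1 := hG.internal _ hxS
      simp only [legs, Set.mem_ofPred_eq, not_forall] at h1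
      obtain ⟨z, hz, hne⟩ := h1
      have hzS := hG.edge_closed _ hxS z hz
      have := hx ⟨z, ((hφ _ _).1 (edge_component hxS hzS hz)).symm.trans x.2⟩
        (Or.inr ⟨hxS, hzS, hz⟩)
      exact hne (congrArg Subtype.val this)
    · intro hx y hy
      rcases (within_apply _ _ _ _).1 hy with h | ⟨h, -⟩
      · exact Subtype.ext h.symm
      · exact absurd h hx
  refine mem_pieces.2 ⟨fun h => ?_, ⟨fun h => ?_, ?_, fun h hh => ?_⟩, hlegs⟩
  · rw [← h4 h.1, ← Set.ncard_image_of_injective _ Subtype.val_injective]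
    congr 1
    ext y
    constructor
    · rintro ⟨y, hy, rfl⟩
      exact hy
    · intro hy
      exact ⟨⟨y, ((hφ _ _).1 (vert_le_component G S hy)).symm.trans h.2⟩, hy, rfl⟩
  · refine le_trans ?_ (h1.edge_le_two h.1)
    rw [← Set.ncard_image_of_injective _ Subtype.val_injective]
    refine Set.ncard_le_ncard ?_
    rintro _ ⟨y, hy, rfl⟩
    rcases (within_apply _ _ _ _).1 hy with h | ⟨_, _, h⟩
    · rw [← h]; exact G.edge.refl' _
    · exact h
  · rw [isConnected_iff]
    refine ⟨⟨⟨x₀, rfl⟩⟩, fun P hv he x y hx => ?_⟩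
    have hc : G.component S x.1 y.1 := (hφ _ _).2 (x.2.trans y.2.symm)
    have hfib : ∀ {a b}, G.component S a b → φ a = φ x₀ → φ b = φ x₀ := fun h ha =>
      ((hφ _ _).1 h).symm.trans ha
    have := component_invariant (P := fun w => ∃ hw : φ w = φ x₀, P ⟨w, hw⟩)
      (fun a b hab ⟨ha, hPa⟩ => ⟨hfib (vert_le_component G S hab) ha, hv ⟨a, ha⟩ ⟨b, _⟩ hab hPa⟩)
      (fun a b haS hbS hab ⟨ha, hPa⟩ => ⟨hfib (edge_component haS hbS hab) ha,
        he ⟨a, ha⟩ ⟨b, _⟩ (Or.inr ⟨haS, hbS, hab⟩) hPa⟩) hc ⟨x.2, hx⟩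
    exact this.2
  · have hhS : h.1 ∈ S := by
      rw [hlegs] at hh
      exact not_not.1 hh
    have hi := componentGraph_irreducible hG hhS
    let e : {x // G.component S h.1 x} ≃ {z // φ z = φ x₀} :=
      Equiv.subtypeEquivRight fun x => by rw [hφ, h.2, eq_comm]
    exact (isConnected_comap _ e).1 (Eq.mp (congrArg IsConnected (cutEdge_comap
      ((G.inner S).comap (Subtype.val : {z // φ z = φ x₀} → H)) e _)) hi)

theorem subgraphMonomial_eq [Finite H] (k : Type*) [Field k] [Fintype B] {G : FeynmanGraph H}
    (hφ : ∀ x y, G.component S x y ↔ φ x = φ y) (hsurj : Function.Surjective φ) :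
    G.subgraphMonomial k S =
      ∏ b, ((G.inner S).comap (Subtype.val : {x // φ x = b} → H)).toAlgebra k := by
  unfold subgraphMonomial
  rw [← finprod_eq_prod_of_fintype]
  let ψ : Quotient (G.component S) → B := Quotient.lift φ fun x y h => (hφ x y).1 h
  refine finprod_eq_of_bijective ψ ⟨?_, fun b => ?_⟩ fun q => ?_
  · intro q q'
    induction q using Quotient.inductionOn with
    | h x =>
      induction q' using Quotient.inductionOn with
      | h y => exact fun h => Quotient.sound ((hφ x y).2 h)
  · obtain ⟨x, rfl⟩ := hsurj b
    exact ⟨Quotient.mk _ x, rfl⟩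
  · have hq : ψ q = φ q.out := by
      conv_lhs => rw [← Quotient.out_eq q]
      rfl
    rw [hq]
    exact toAlgebra_congr k _ _ (Equiv.subtypeEquivRight fun x => by rw [hφ, eq_comm])
      (fun _ _ => Iff.rfl) (fun _ _ => Iff.rfl)

open Classical Nat in
/-- The sum of the subgraph monomials over all graphs with a given subgraph `S` and a given outer
graph. -/
theorem sum_subgraphMonomial [Finite H] (k : Type*) [Field k] [CharZero k] (S R : Set H)
    (O : FeynmanGraph {x // x ∉ S}) (hSR : Disjoint S R)
    (hOR : O ∈ outerGraphs _ (Subtype.val ⁻¹' R)) [Fintype (Quotient O.vert)] :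
    ∑ G ∈ (pieces H R).filter fun G => G.IsDivergentSubgraph S ∧ G.outer S = O,
      G.subgraphMonomial k S = (S.ncard ! : k) • PowerSeries.coeff S.ncard
        (∏ q : Quotient O.vert, pieceSeries k {x | Quotient.mk O.vert x = q}.ncard) := by
  have : Fintype H := Fintype.ofFinite H
  rw [← sum_prod_pieceSum]
  simp_rw [← sum_fills]
  rw [Finset.sum_sigma']
  symm
  have hO : ∀ (f : S → Quotient O.vert) (x y : {x // x ∉ S}),
      extendMap f (Quotient.mk O.vert) x.1 = extendMap f (Quotient.mk O.vert) y.1 ↔ O.vert x y := by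
    intro f x y
    rw [extendMap_of_notMem _ _ x.2, extendMap_of_notMem _ _ y.2]
    exact Quotient.eq
  have hmeet : ∀ (f : S → Quotient O.vert) x, ∃ y, y ∉ S ∧
      extendMap f (Quotient.mk O.vert) x = extendMap f (Quotient.mk O.vert) y := by
    intro f x
    obtain ⟨y, hy⟩ := Quotient.exists_rep (extendMap f (Quotient.mk O.vert) x)
    exact ⟨y.1, y.2, by rw [extendMap_of_notMem _ _ y.2]; exact hy.symm⟩
  have hsurj : ∀ f : S → Quotient O.vert,
      Function.Surjective (extendMap f (Quotient.mk O.vert)) := by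
    intro f q
    obtain ⟨y, hy⟩ := Quotient.exists_rep q
    exact ⟨y.1, by rw [extendMap_of_notMem _ _ y.2]; exact hy⟩
  -- A graph with outer graph `O` is a choice `f` of the vertex of `O` in which each half-edge of
  -- `S` lies, together with a filling `F` of the vertices.
  refine Finset.sum_bij (fun p _ => glueOuter p.2 O) ?_ ?_ ?_ ?_
  · rintro ⟨f, F⟩ hp
    have hF : F ∈ fills (extendMap f (Quotient.mk O.vert)) S := (Finset.mem_sigma.1 hp).2
    have h := glueOuter_mem hF (hO f) (hmeet f) hSR hOR
    exact Finset.mem_filter.2 ⟨h.1, h.2, outer_glueOuter hF (hO f)⟩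
  · rintro ⟨f, F⟩ hp ⟨f', F'⟩ hp' h
    have hF : F ∈ fills (extendMap f (Quotient.mk O.vert)) S := (Finset.mem_sigma.1 hp).2
    have hF' : F' ∈ fills (extendMap f' (Quotient.mk O.vert)) S := (Finset.mem_sigma.1 hp').2
    change glueOuter F O = glueOuter F' O at h
    have hFF : F = F' := by
      rw [← inner_glueOuter hF O, h, inner_glueOuter hF' O]
    have hff : f = f' := by
      funext x
      obtain ⟨y, hy, hxy⟩ := hmeet f x.1
      have hxy' : extendMap f' (Quotient.mk O.vert) x.1 = extendMap f' (Quotient.mk O.vert) y := by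
        rw [← component_glueOuter hF' O, ← h, component_glueOuter hF O]
        exact hxy
      rw [extendMap_of_mem _ _ x.2, extendMap_of_notMem _ _ hy] at hxy hxy'
      exact hxy.trans hxy'.symm
    subst hFF
    subst hff
    rfl
  · intro G hG
    obtain ⟨hGp, hGS, rfl⟩ := Finset.mem_filter.1 hG
    choose m hm hm' using exists_component_notMem hGS
    let f : S → Quotient (G.outer S).vert := fun x => Quotient.mk _ ⟨m x.1, hm x.1⟩
    have hf : ∀ x, extendMap f (Quotient.mk (G.outer S).vert) x = Quotient.mk _ ⟨m x, hm x⟩ := by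
      intro x
      by_cases hx : x ∈ S
      · rw [extendMap_of_mem _ _ hx]
      · rw [extendMap_of_notMem _ _ hx]
        exact Quotient.sound (hm' x)
    have hφ : ∀ x y, G.component S x y ↔ extendMap f (Quotient.mk (G.outer S).vert) x =
        extendMap f (Quotient.mk (G.outer S).vert) y := by
      intro x y
      rw [hf, hf]
      refine Iff.trans ?_ (Quotient.eq (r := (G.outer S).vert)).symm
      rw [outer_vert]
      have tr : ∀ {a b c}, G.component S a b → G.component S b c → G.component S a c :=
        fun h h' => (G.component S).trans' h h'
      have sy : ∀ {a b}, G.component S a b → G.component S b a := fun h => (G.component S).symm' h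
      exact ⟨fun h => tr (sy (hm' x)) (tr h (hm' y)), fun h => tr (hm' x) (tr h (sy (hm' y)))⟩
    refine ⟨⟨f, G.inner S⟩, ?_, glueOuter_outer G hGS.edge_closed⟩
    exact Finset.mem_sigma.2 ⟨Finset.mem_univ _, inner_mem_fills hGS hGp hφ (hsurj f)⟩
  · rintro ⟨f, F⟩ hp
    have hF : F ∈ fills (extendMap f (Quotient.mk O.vert)) S := (Finset.mem_sigma.1 hp).2
    rw [subgraphMonomial_eq k (component_glueOuter hF O) (hsurj f), inner_glueOuter hF]

end filling

end FeynmanGraph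

namespace FeynmanGraph

/-! ### Removing bivalent vertices -/

variable {L : Type}

theorem edge_iff_of_edge_le_two [Finite L] {O : FeynmanGraph L}
    (h2 : ∀ h, {x | O.edge h x}.ncard ≤ 2) {x y : L} (hne : y ≠ x) (h : O.edge x y) (z : L) :
    O.edge x z ↔ z = x ∨ z = y := by
  constructor
  · intro hz
    by_contra hcon
    push Not at hcon
    have h3 : ({z, x, y} : Set L).ncard = 3 :=
      Set.ncard_eq_three.2 ⟨z, x, y, hcon.1, hcon.2, hne.symm, rfl⟩
    have hsub : ({z, x, y} : Set L) ⊆ {w | O.edge x w} := by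
      rintro w (rfl | rfl | rfl)
      · exact hz
      · exact O.edge.refl' _
      · exact h
    have := Set.ncard_le_ncard hsub
    have := h2 x
    omega
  · rintro (rfl | rfl)
    · exact O.edge.refl' _
    · exact h

theorem ncard_pair_le {α : Type*} (a b : α) : ({a, b} : Set α).ncard ≤ 2 := by
  have := Set.ncard_insert_le a {b}
  rwa [Set.ncard_singleton] at this

theorem cutEdge_congr {O : FeynmanGraph L} {u v : L} (huv : O.edge u v) :
    O.cutEdge u = O.cutEdge v := by
  refine ext' (fun _ _ => Iff.rfl) fun p q => ?_
  have : ∀ w, O.edge u w ↔ O.edge v w := fun w =>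
    ⟨fun hw => O.edge.trans' (O.edge.symm' huv) hw, fun hw => O.edge.trans' huv hw⟩
  rw [cutEdge_edge, cutEdge_edge, this, this]

/-- `O` arises from `O'` by inserting a bivalent vertex with half-edges `x` and `y` into the edge
with half-edges `a` and `b`: the new edges are `{x, a}` and `{y, b}`. -/
structure IsInsertion (O : FeynmanGraph L) (x y : L) (O' : FeynmanGraph {z // z ≠ x ∧ z ≠ y})
    (a b : {z // z ≠ x ∧ z ≠ y}) : Prop where
  ne : x ≠ y
  ab : a ≠ b
  pair : ∀ z, O.vert x z ↔ z = x ∨ z = y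
  vert : ∀ z w, O'.vert z w ↔ O.vert z.1 w.1
  edge_x : ∀ z, O.edge x z ↔ z = x ∨ z = a.1
  edge_y : ∀ z, O.edge y z ↔ z = y ∨ z = b.1
  edge_a : ∀ z, O'.edge a z ↔ z = a ∨ z = b
  edge_off : ∀ z w, z ≠ a → z ≠ b → (O'.edge z w ↔ O.edge z.1 w.1)

namespace IsInsertion

variable {O : FeynmanGraph L} {x y : L} {O' : FeynmanGraph {z // z ≠ x ∧ z ≠ y}}
    {a b : {z // z ≠ x ∧ z ≠ y}} (h : IsInsertion O x y O' a b)

include h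

theorem edge_xa : O.edge x a.1 := (h.edge_x _).2 (Or.inr rfl)

theorem edge_yb : O.edge y b.1 := (h.edge_y _).2 (Or.inr rfl)

theorem edge_ab : O'.edge a b := (h.edge_a _).2 (Or.inr rfl)

theorem vert_xy : O.vert x y := (h.pair _).2 (Or.inr rfl)

theorem edge_a' (z : L) : O.edge a.1 z ↔ z = x ∨ z = a.1 := by
  rw [← h.edge_x]
  exact ⟨fun hz => O.edge.trans' h.edge_xa hz, fun hz => O.edge.trans' (O.edge.symm' h.edge_xa) hz⟩

theorem edge_b' (z : L) : O.edge b.1 z ↔ z = y ∨ z = b.1 := by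
  rw [← h.edge_y]
  exact ⟨fun hz => O.edge.trans' h.edge_yb hz, fun hz => O.edge.trans' (O.edge.symm' h.edge_yb) hz⟩

theorem edge_b (z) : O'.edge b z ↔ z = a ∨ z = b := by
  rw [← h.edge_a]
  exact ⟨fun hz => O'.edge.trans' h.edge_ab hz,
    fun hz => O'.edge.trans' (O'.edge.symm' h.edge_ab) hz⟩

theorem pair_y (z : L) : O.vert y z ↔ z = x ∨ z = y := by
  rw [← h.pair]
  exact ⟨fun hz => O.vert.trans' h.vert_xy hz, fun hz => O.vert.trans' (O.vert.symm' h.vert_xy) hz⟩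

/-- Half-edges outside of `x` and `y` are not on the inserted vertex. -/
theorem vert_mem {z w : L} (hz : z ≠ x ∧ z ≠ y) (hzw : O.vert z w) : w ≠ x ∧ w ≠ y := by
  constructor
  · rintro rfl
    rcases (h.pair z).1 (O.vert.symm' hzw) with h1 | h1
    exacts [hz.1 h1, hz.2 h1]
  · rintro rfl
    rcases (h.pair_y z).1 (O.vert.symm' hzw) with h1 | h1
    exacts [hz.1 h1, hz.2 h1]

theorem edge_mem {z : {z // z ≠ x ∧ z ≠ y}} (ha : z ≠ a) (hb : z ≠ b) {w : L}
    (hzw : O.edge z.1 w) : w ≠ x ∧ w ≠ y := by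
  constructor
  · rintro rfl
    rcases (h.edge_x z.1).1 (O.edge.symm' hzw) with h1 | h1
    exacts [z.2.1 h1, ha (Subtype.ext h1)]
  · rintro rfl
    rcases (h.edge_y z.1).1 (O.edge.symm' hzw) with h1 | h1
    exacts [z.2.2 h1, hb (Subtype.ext h1)]

/-- Colourings of `O'` extend to `O`, the inserted half-edges being coloured like `a`. The marks `C`
and `C'` say which edges are cut. -/
theorem colouring_iff (C : L → Prop) (C' : {z // z ≠ x ∧ z ≠ y} → Prop)
    (hoff : ∀ z, z ≠ a → z ≠ b → (C z.1 ↔ C' z)) (hCC : C x ∨ C y ↔ C' a)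
    (hxa : C x ↔ C a.1) (hyb : C y ↔ C b.1) (hab : C' a ↔ C' b)
    (hone : ¬ (C x ∧ C y)) :
    (∀ P : L → Prop, (∀ a b, O.vert a b → P a → P b) →
      (∀ a b, O.edge a b → ¬ C a → P a → P b) → ∀ x y, P x → P y) ↔
    (∀ P : {z // z ≠ x ∧ z ≠ y} → Prop, (∀ a b, O'.vert a b → P a → P b) →
      (∀ a b, O'.edge a b → ¬ C' a → P a → P b) → ∀ x y, P x → P y) := by
  constructor
  · classical
    intro H P hv he p q hp
    -- If the cut edge is `{x, a}`, the new vertex gets the colour of `b`, otherwise that of `a`.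
    let c : Prop := (C x ∧ P b) ∨ (¬ C x ∧ P a)
    let Q : L → Prop := fun z => if hz : z ≠ x ∧ z ≠ y then P ⟨z, hz⟩ else c
    have Qx : Q x ↔ c := by simp [Q]
    have Qy : Q y ↔ c := by simp [Q]
    have Qz : ∀ z : {z // z ≠ x ∧ z ≠ y}, Q z.1 ↔ P z := fun z => by
      simp only [Q]; rw [dif_pos z.2]
    have hPab : ¬ C x → ¬ C y → (P a ↔ P b) := fun h1 h2 => by
      have : ¬ C' a := fun h' => by rcases hCC.2 h' with h3 | h3; exacts [h1 h3, h2 h3]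
      exact ⟨he a b h.edge_ab this, he b a (O'.edge.symm' h.edge_ab) (fun h' => this (hab.2 h'))⟩
    have hxa' : ¬ C x → (Q x ↔ Q a.1) := fun h1 => by
      rw [Qx, Qz]; simp [c, h1]
    have hyb' : ¬ C y → (Q y ↔ Q b.1) := fun h1 => by
      rw [Qy, Qz]
      by_cases h2 : C x
      · simp [c, h2]
      · simp [c, h2, hPab h2 h1]
    refine (Qz q).1 (H Q ?_ ?_ p.1 q.1 ((Qz p).2 hp))
    · intro u v huv hu
      by_cases hu' : u ≠ x ∧ u ≠ y
      · have hv' := h.vert_mem hu' huv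
        exact (Qz ⟨v, hv'⟩).2 (hv ⟨u, hu'⟩ ⟨v, hv'⟩ ((h.vert _ _).2 huv) ((Qz ⟨u, hu'⟩).1 hu))
      · have hv' : ¬ (v ≠ x ∧ v ≠ y) := fun hv' => hu' (h.vert_mem hv' (O.vert.symm' huv))
        simp only [Q, dif_neg hu'] at hu
        simp only [Q, dif_neg hv']
        exact hu
    · intro u v huv hC hu
      by_cases hux : u = x
      · subst hux
        rcases (h.edge_x v).1 huv with rfl | rfl
        · exact hu
        · exact (hxa' hC).1 hu
      by_cases huy : u = y
      · subst huy
        rcases (h.edge_y v).1 huv with rfl | rfl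
        · exact hu
        · exact (hyb' hC).1 hu
      by_cases hua : u = a.1
      · subst hua
        rcases (h.edge_a' v).1 huv with rfl | rfl
        · exact (hxa' (fun h' => hC (hxa.1 h'))).2 hu
        · exact hu
      by_cases hub : u = b.1
      · subst hub
        rcases (h.edge_b' v).1 huv with rfl | rfl
        · exact (hyb' (fun h' => hC (hyb.1 h'))).2 hu
        · exact hu
      have hua' : (⟨u, hux, huy⟩ : {z // z ≠ x ∧ z ≠ y}) ≠ a :=
        fun h' => hua (congrArg Subtype.val h')
      have hub' : (⟨u, hux, huy⟩ : {z // z ≠ x ∧ z ≠ y}) ≠ b :=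
        fun h' => hub (congrArg Subtype.val h')
      have hv' := h.edge_mem hua' hub' huv
      exact (Qz ⟨v, hv'⟩).2 (he ⟨u, hux, huy⟩ ⟨v, hv'⟩ ((h.edge_off _ _ hua' hub').2 huv)
        (fun h' => hC ((hoff _ hua' hub').2 h')) ((Qz ⟨u, hux, huy⟩).1 hu))
  · intro H P hv he
    have hxy : P x ↔ P y := ⟨hv _ _ h.vert_xy, hv _ _ (O.vert.symm' h.vert_xy)⟩
    have hxa' : ¬ C x → (P x ↔ P a.1) := fun h1 =>
      ⟨he _ _ h.edge_xa h1, he _ _ (O.edge.symm' h.edge_xa) (fun h' => h1 (hxa.2 h'))⟩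
    have hyb' : ¬ C y → (P y ↔ P b.1) := fun h1 =>
      ⟨he _ _ h.edge_yb h1, he _ _ (O.edge.symm' h.edge_yb) (fun h' => h1 (hyb.2 h'))⟩
    have hall : ∀ p q : {z // z ≠ x ∧ z ≠ y}, P p.1 → P q.1 := by
      refine H (fun z => P z.1) (fun u v huv => hv _ _ ((h.vert _ _).1 huv)) fun u v huv hC hu => ?_
      have key : ¬ C' a → (P a.1 ↔ P b.1) := fun h1 => by
        have h2 : ¬ (C x ∨ C y) := fun h' => h1 (hCC.1 h')
        rw [not_or] at h2
        rw [← hxa' h2.1, ← hyb' h2.2, hxy]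
      by_cases hua : u = a
      · subst hua
        rcases (h.edge_a v).1 huv with rfl | rfl
        · exact hu
        · exact (key hC).1 hu
      by_cases hub : u = b
      · subst hub
        rcases (h.edge_b v).1 huv with rfl | rfl
        · exact (key (fun h' => hC (hab.1 h'))).2 hu
        · exact hu
      exact he _ _ ((h.edge_off _ _ hua hub).1 huv) (fun h' => hC ((hoff _ hua hub).1 h')) hu
    have hnew : ∃ c : {z // z ≠ x ∧ z ≠ y}, (P x ↔ P c.1) := by
      by_cases h1 : C x
      · exact ⟨b, hxy.trans (hyb' fun h2 => hone ⟨h1, h2⟩)⟩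
      · exact ⟨a, hxa' h1⟩
    have hrep : ∀ z, ∃ c : {z // z ≠ x ∧ z ≠ y}, (P z ↔ P c.1) := by
      intro z
      by_cases hz : z ≠ x ∧ z ≠ y
      · exact ⟨⟨z, hz⟩, Iff.rfl⟩
      · rw [not_and_or, not_not, not_not] at hz
        obtain ⟨c, hc⟩ := hnew
        rcases hz with rfl | rfl
        · exact ⟨c, hc⟩
        · exact ⟨c, hxy.symm.trans hc⟩
    intro p q hp
    obtain ⟨c, hc⟩ := hrep p
    obtain ⟨c', hc'⟩ := hrep q
    exact hc'.2 (hall c c' (hc.1 hp))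

theorem mem_legs_iff (z : {z // z ≠ x ∧ z ≠ y}) : z.1 ∈ O.legs ↔ z ∈ O'.legs := by
  by_cases hua : z = a
  · subst hua
    refine iff_of_false (fun hl => ?_) fun hl => ?_
    · exact z.2.1 (hl x (O.edge.symm' h.edge_xa)).symm
    · exact h.ab (hl b h.edge_ab).symm
  by_cases hub : z = b
  · subst hub
    refine iff_of_false (fun hl => ?_) fun hl => ?_
    · exact z.2.2 (hl y (O.edge.symm' h.edge_yb)).symm
    · exact h.ab (hl a (O'.edge.symm' h.edge_ab))
  constructor
  · intro hl w hw
    exact Subtype.ext (hl w.1 ((h.edge_off _ _ hua hub).1 hw))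
  · intro hl w hw
    have hw' := h.edge_mem hua hub hw
    exact congrArg Subtype.val (hl ⟨w, hw'⟩ ((h.edge_off _ _ hua hub).2 hw))

theorem x_notMem_legs : x ∉ O.legs := fun hl => a.2.1 (hl _ h.edge_xa)

theorem y_notMem_legs : y ∉ O.legs := fun hl => b.2.2 (hl _ h.edge_yb)

theorem isOnePI_iff [Finite L] : O.IsOnePI ↔ O'.IsOnePI := by
  have hne : Nonempty L ↔ Nonempty {z // z ≠ x ∧ z ≠ y} := iff_of_true ⟨x⟩ ⟨a⟩
  have hab1 : a.1 ≠ b.1 := fun h' => h.ab (Subtype.ext h')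
  have hxb : ¬ O.edge x b.1 := fun h' => by
    rcases (h.edge_x _).1 h' with h1 | h1
    exacts [b.2.1 h1, hab1 h1.symm]
  have hxy : ¬ O.edge x y := fun h' => by
    rcases (h.edge_x _).1 h' with h1 | h1
    exacts [h.ne h1.symm, a.2.2 h1.symm]
  have hconn : O.IsConnected ↔ O'.IsConnected := by
    rw [isConnected_iff, isConnected_iff, hne]
    have := h.colouring_iff (fun _ => False) (fun _ => False) (by simp) (by simp) (by simp)
      (by simp)
      (by simp) (by simp)
    simp only [not_false_eq_true, true_imp_iff] at this
    rw [this]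
  have tr : ∀ {p q r}, O.edge p q → O.edge q r → O.edge p r := fun h h' => O.edge.trans' h h'
  have sy : ∀ {p q}, O.edge p q → O.edge q p := fun h => O.edge.symm' h
  have tr' : ∀ {p q r}, O'.edge p q → O'.edge q r → O'.edge p r := fun h h' => O'.edge.trans' h h'
  have sy' : ∀ {p q}, O'.edge p q → O'.edge q p := fun h => O'.edge.symm' h
  have hcx : (O.cutEdge x).IsConnected ↔ (O'.cutEdge a).IsConnected := by
    rw [cutEdge_isConnected_iff, cutEdge_isConnected_iff, hne]
    rw [h.colouring_iff (fun z => O.edge x z) (fun z => O'.edge a z)]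
    · intro z hza hzb
      refine iff_of_false (fun h' => ?_) fun h' => ?_
      · rcases (h.edge_x _).1 h' with h1 | h1
        exacts [z.2.1 h1, hza (Subtype.ext h1)]
      · rcases (h.edge_a _).1 h' with h1 | h1
        exacts [hza h1, hzb h1]
    · exact iff_of_true (Or.inl (O.edge.refl' x)) (O'.edge.refl' a)
    · exact iff_of_true (O.edge.refl' x) h.edge_xa
    · exact iff_of_false hxy hxb
    · exact iff_of_true (O'.edge.refl' a) h.edge_ab
    · exact fun h' => hxy h'.2
  have hcy : (O.cutEdge y).IsConnected ↔ (O'.cutEdge a).IsConnected := by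
    rw [cutEdge_isConnected_iff, cutEdge_isConnected_iff, hne]
    rw [h.colouring_iff (fun z => O.edge y z) (fun z => O'.edge a z)]
    · intro z hza hzb
      refine iff_of_false (fun h' => ?_) fun h' => ?_
      · rcases (h.edge_y _).1 h' with h1 | h1
        exacts [z.2.2 h1, hzb (Subtype.ext h1)]
      · rcases (h.edge_a _).1 h' with h1 | h1
        exacts [hza h1, hzb h1]
    · exact iff_of_true (Or.inr (O.edge.refl' y)) (O'.edge.refl' a)
    · exact iff_of_false (fun h' => hxy (sy h')) fun h' => hxy (tr h.edge_xa (sy h'))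
    · exact iff_of_true (O.edge.refl' y) h.edge_yb
    · exact iff_of_true (O'.edge.refl' a) h.edge_ab
    · exact fun h' => hxy (sy h'.1)
  have hca : (O.cutEdge a.1).IsConnected ↔ (O'.cutEdge a).IsConnected := by
    rw [← hcx, cutEdge_congr h.edge_xa]
  have hcb : (O.cutEdge b.1).IsConnected ↔ (O'.cutEdge b).IsConnected := by
    rw [← cutEdge_congr h.edge_yb, hcy]
    rw [cutEdge_congr h.edge_ab]
  have hcz : ∀ z : {z // z ≠ x ∧ z ≠ y},
      (O.cutEdge z.1).IsConnected ↔ (O'.cutEdge z).IsConnected := by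
    intro z
    by_cases hza : z = a
    · subst hza; exact hca
    by_cases hzb : z = b
    · subst hzb; exact hcb
    have hzx : ¬ O.edge z.1 x := fun h' => (h.edge_mem hza hzb h').1 rfl
    have hzy : ¬ O.edge z.1 y := fun h' => (h.edge_mem hza hzb h').2 rfl
    have hza' : ¬ O'.edge z a := fun h' => by
      rcases (h.edge_a z).1 (sy' h') with h1 | h1
      exacts [hza h1, hzb h1]
    rw [cutEdge_isConnected_iff, cutEdge_isConnected_iff, hne]
    rw [h.colouring_iff (fun w => O.edge z.1 w) (fun w => O'.edge z w)]
    · intro w _ _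
      exact (h.edge_off z w hza hzb).symm
    · exact iff_of_false (by simp [hzx, hzy]) hza'
    · exact iff_of_false hzx fun h' => hzx (tr h' (sy h.edge_xa))
    · exact iff_of_false hzy fun h' => hzy (tr h' (sy h.edge_yb))
    · exact iff_of_false hza' fun h' => hza' (tr' h' (sy' h.edge_ab))
    · exact fun h' => hzx h'.1
  constructor
  · rintro ⟨h1, h2, h3⟩
    refine ⟨fun z => ?_, hconn.1 h2, fun z hz => (hcz z).1 (h3 z.1 fun hl =>
      hz ((h.mem_legs_iff z).1 hl))⟩
    by_cases hzab : z = a ∨ z = b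
    · have : {w | O'.edge z w} = {a, b} := by
        ext w
        rcases hzab with rfl | rfl
        · exact h.edge_a w
        · exact h.edge_b w
      rw [this]
      exact ncard_pair_le a b
    · rw [not_or] at hzab
      refine le_trans ?_ (h1 z.1)
      rw [← Set.ncard_image_of_injective _ Subtype.val_injective]
      refine Set.ncard_le_ncard ?_
      rintro _ ⟨w, hw, rfl⟩
      exact (h.edge_off z w hzab.1 hzab.2).1 hw
  · rintro ⟨h1, h2, h3⟩
    have hac : (O'.cutEdge a).IsConnected := h3 a fun hl => h.ab (hl b h.edge_ab).symm
    refine ⟨fun z => ?_, hconn.2 h2, fun z hz => ?_⟩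
    · by_cases hzx : z = x
      · subst hzx
        have : {w | O.edge z w} = {z, a.1} := by ext w; exact h.edge_x w
        rw [this]
        exact ncard_pair_le _ _
      by_cases hzy : z = y
      · subst hzy
        have : {w | O.edge z w} = {z, b.1} := by ext w; exact h.edge_y w
        rw [this]
        exact ncard_pair_le _ _
      by_cases hza : z = a.1
      · subst hza
        have : {w | O.edge a.1 w} = {x, a.1} := by ext w; exact h.edge_a' w
        rw [this]
        exact ncard_pair_le _ _
      by_cases hzb : z = b.1
      · subst hzb
        have : {w | O.edge b.1 w} = {y, b.1} := by ext w; exact h.edge_b' w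
        rw [this]
        exact ncard_pair_le _ _
      have hza' : (⟨z, hzx, hzy⟩ : {z // z ≠ x ∧ z ≠ y}) ≠ a :=
        fun h' => hza (congrArg Subtype.val h')
      have hzb' : (⟨z, hzx, hzy⟩ : {z // z ≠ x ∧ z ≠ y}) ≠ b :=
        fun h' => hzb (congrArg Subtype.val h')
      refine le_trans ?_ (h1 ⟨z, hzx, hzy⟩)
      rw [← Set.ncard_image_of_injective _ Subtype.val_injective]
      refine Set.ncard_le_ncard ?_
      intro w hw
      exact ⟨⟨w, h.edge_mem hza' hzb' hw⟩, (h.edge_off _ _ hza' hzb').2 hw, rfl⟩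
    · by_cases hzx : z = x
      · subst hzx; exact hcx.2 hac
      by_cases hzy : z = y
      · subst hzy; exact hcy.2 hac
      exact (hcz ⟨z, hzx, hzy⟩).2 (h3 _ fun hl => hz ((h.mem_legs_iff ⟨z, hzx, hzy⟩).2 hl))

theorem ncard_vert (z : {z // z ≠ x ∧ z ≠ y}) :
    {w | O'.vert z w}.ncard = {w | O.vert z.1 w}.ncard := by
  rw [← Set.ncard_image_of_injective _ Subtype.val_injective]
  congr 1
  ext w
  constructor
  · rintro ⟨w, hw, rfl⟩
    exact (h.vert _ _).1 hw
  · intro hw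
    exact ⟨⟨w, h.vert_mem z.2 hw⟩, (h.vert _ _).2 hw, rfl⟩

theorem ncard_vert_x : {w | O.vert x w}.ncard = 2 := by
  have : {w | O.vert x w} = {x, y} := by ext w; exact h.pair w
  rw [this, Set.ncard_pair h.ne]

theorem ncard_vert_y : {w | O.vert y w}.ncard = 2 := by
  have : {w | O.vert y w} = {x, y} := by ext w; exact h.pair_y w
  rw [this, Set.ncard_pair h.ne]

theorem toAlgebra_smooth (k : Type*) [Field k] [Finite L] :
    O'.smooth.toAlgebra k = O.smooth.toAlgebra k := by
  have hnx : ∀ {z}, {w | O.vert z w}.ncard = 4 → z ≠ x ∧ z ≠ y := fun {z} hz => by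
    constructor
    · rintro rfl
      rw [h.ncard_vert_x] at hz; omega
    · rintro rfl
      rw [h.ncard_vert_y] at hz; omega
  let e : {z // {w | O'.vert z w}.ncard = 4} ≃ {z // {w | O.vert z w}.ncard = 4} :=
    ⟨fun z => ⟨z.1.1, (h.ncard_vert _).symm.trans z.2⟩,
      fun z => ⟨⟨z.1, hnx z.2⟩, (h.ncard_vert _).trans z.2⟩, fun _ => rfl, fun _ => rfl⟩
  refine toAlgebra_congr k _ _ e (fun z w => h.vert _ _) fun z w => ?_
  rw [smooth_edge_iff, smooth_edge_iff]
  have hPab : ∀ {P : L → Prop}, (∀ u v, O.edge u v → P u → P v) →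
      (∀ u v, {y | O.vert u y}.ncard = 2 → O.vert u v → P u → P v) → (P a.1 ↔ P b.1) := by
    intro P h1 h2
    have hx : P x ↔ P a.1 := ⟨h1 _ _ h.edge_xa, h1 _ _ (O.edge.symm' h.edge_xa)⟩
    have hy : P y ↔ P b.1 := ⟨h1 _ _ h.edge_yb, h1 _ _ (O.edge.symm' h.edge_yb)⟩
    have hxy : P x ↔ P y :=
      ⟨h2 _ _ h.ncard_vert_x h.vert_xy, h2 _ _ h.ncard_vert_y (O.vert.symm' h.vert_xy)⟩
    rw [← hx, ← hy, hxy]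
  constructor
  · intro H P h1 h2
    refine H (fun z => P z.1) (fun u v huv hu => ?_) fun u v hu huv =>
      h2 _ _ ((h.ncard_vert u).symm.trans hu) ((h.vert _ _).1 huv)
    by_cases hua : u = a
    · subst hua
      rcases (h.edge_a v).1 huv with rfl | rfl
      · exact hu
      · exact (hPab h1 h2).1 hu
    by_cases hub : u = b
    · subst hub
      rcases (h.edge_b v).1 huv with rfl | rfl
      · exact (hPab h1 h2).2 hu
      · exact hu
    exact h1 _ _ ((h.edge_off _ _ hua hub).1 huv) hu
  · classical
    intro H P h1 h2 hz
    have hPab' : P a ↔ P b := ⟨h1 _ _ h.edge_ab, h1 _ _ (O'.edge.symm' h.edge_ab)⟩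
    let Q : L → Prop := fun z => if hz : z ≠ x ∧ z ≠ y then P ⟨z, hz⟩ else P a
    have Qx : Q x ↔ P a := by simp [Q]
    have Qy : Q y ↔ P a := by simp [Q]
    have Qz : ∀ z : {z // z ≠ x ∧ z ≠ y}, Q z.1 ↔ P z := fun z => by
      simp only [Q]; rw [dif_pos z.2]
    refine (Qz w.1).1 (H Q ?_ ?_ ((Qz z.1).2 hz))
    · intro u v huv hu
      by_cases hux : u = x
      · subst hux
        rcases (h.edge_x v).1 huv with rfl | rfl
        · exact hu
        · rwa [Qz, ← Qx]
      by_cases huy : u = y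
      · subst huy
        rcases (h.edge_y v).1 huv with rfl | rfl
        · exact hu
        · rwa [Qz, ← hPab', ← Qy]
      by_cases hua : u = a.1
      · subst hua
        rcases (h.edge_a' v).1 huv with rfl | rfl
        · rwa [Qx, ← Qz]
        · exact hu
      by_cases hub : u = b.1
      · subst hub
        rcases (h.edge_b' v).1 huv with rfl | rfl
        · rwa [Qy, hPab', ← Qz]
        · exact hu
      have hua' : (⟨u, hux, huy⟩ : {z // z ≠ x ∧ z ≠ y}) ≠ a :=
        fun h' => hua (congrArg Subtype.val h')
      have hub' : (⟨u, hux, huy⟩ : {z // z ≠ x ∧ z ≠ y}) ≠ b :=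
        fun h' => hub (congrArg Subtype.val h')
      have hv' := h.edge_mem hua' hub' huv
      exact (Qz ⟨v, hv'⟩).2 (h1 ⟨u, hux, huy⟩ ⟨v, hv'⟩ ((h.edge_off _ _ hua' hub').2 huv)
        ((Qz ⟨u, hux, huy⟩).1 hu))
    · intro u v hu2 huv hu
      by_cases hu' : u ≠ x ∧ u ≠ y
      · have hv' := h.vert_mem hu' huv
        exact (Qz ⟨v, hv'⟩).2 (h2 ⟨u, hu'⟩ ⟨v, hv'⟩ ((h.ncard_vert ⟨u, hu'⟩).trans hu2)
          ((h.vert _ _).2 huv) ((Qz ⟨u, hu'⟩).1 hu))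
      · have hv' : ¬ (v ≠ x ∧ v ≠ y) := fun hv' => hu' (h.vert_mem hv' (O.vert.symm' huv))
        simp only [Q, dif_neg hu'] at hu
        simp only [Q, dif_neg hv']
        exact hu

theorem ncard_bivalent [Finite L] : {z | {w | O.vert z w}.ncard = 2}.ncard =
    {z | {w | O'.vert z w}.ncard = 2}.ncard + 2 := by
  have : {z | {w | O.vert z w}.ncard = 2} =
      Subtype.val '' {z | {w | O'.vert z w}.ncard = 2} ∪ {x, y} := by
    ext z
    constructor
    · intro hz
      by_cases hz' : z ≠ x ∧ z ≠ y
      · exact Or.inl ⟨⟨z, hz'⟩, (h.ncard_vert ⟨z, hz'⟩).trans hz, rfl⟩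
      · rw [not_and_or, not_not, not_not] at hz'
        exact Or.inr hz'
    · rintro (⟨z, hz, rfl⟩ | rfl | rfl)
      · exact (h.ncard_vert z).symm.trans hz
      · exact h.ncard_vert_x
      · exact h.ncard_vert_y
  rw [this, Set.ncard_union_eq, Set.ncard_image_of_injective _ Subtype.val_injective,
    Set.ncard_pair h.ne]
  rw [Set.disjoint_left]
  rintro _ ⟨z, _, rfl⟩ (h1 | h1)
  exacts [z.2.1 h1, z.2.2 h1]

theorem mem_outerGraphs_iff [Finite L] {R : Set L} (hx : x ∉ R) (hy : y ∉ R) :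
    O ∈ outerGraphs L R ↔ O' ∈ outerGraphs _ (Subtype.val ⁻¹' R) := by
  rw [mem_outerGraphs, mem_outerGraphs, h.isOnePI_iff]
  refine and_congr ?_ (and_congr Iff.rfl ?_)
  · constructor
    · intro H z
      rw [h.ncard_vert]
      exact H z.1
    · intro H z
      by_cases hzx : z = x
      · subst hzx; exact Or.inl h.ncard_vert_x
      by_cases hzy : z = y
      · subst hzy; exact Or.inl h.ncard_vert_y
      have := H ⟨z, hzx, hzy⟩
      rwa [h.ncard_vert] at this
  · constructor
    · rintro rfl
      ext z
      exact (h.mem_legs_iff z).symm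
    · intro H
      ext z
      by_cases hzx : z = x
      · subst hzx; exact iff_of_false h.x_notMem_legs hx
      by_cases hzy : z = y
      · subst hzy; exact iff_of_false h.y_notMem_legs hy
      exact (h.mem_legs_iff ⟨z, hzx, hzy⟩).trans (Set.ext_iff.1 H ⟨z, hzx, hzy⟩)

theorem unique_left {O₁ : FeynmanGraph L} (h₁ : IsInsertion O₁ x y O' a b) : O₁ = O := by
  refine ext' (fun z w => ?_) fun z w => ?_
  · by_cases hzx : z = x
    · subst hzx; rw [h.pair, h₁.pair]
    by_cases hzy : z = y
    · subst hzy; rw [h.pair_y, h₁.pair_y]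
    by_cases hw : w ≠ x ∧ w ≠ y
    · rw [← h.vert ⟨z, hzx, hzy⟩ ⟨w, hw⟩, ← h₁.vert ⟨z, hzx, hzy⟩ ⟨w, hw⟩]
    · exact iff_of_false (fun h' => hw (h₁.vert_mem ⟨hzx, hzy⟩ h'))
        fun h' => hw (h.vert_mem ⟨hzx, hzy⟩ h')
  · by_cases hzx : z = x
    · subst hzx; rw [h.edge_x, h₁.edge_x]
    by_cases hzy : z = y
    · subst hzy; rw [h.edge_y, h₁.edge_y]
    by_cases hza : z = a.1
    · subst hza; rw [h.edge_a', h₁.edge_a']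
    by_cases hzb : z = b.1
    · subst hzb; rw [h.edge_b', h₁.edge_b']
    have hza' : (⟨z, hzx, hzy⟩ : {z // z ≠ x ∧ z ≠ y}) ≠ a :=
      fun h' => hza (congrArg Subtype.val h')
    have hzb' : (⟨z, hzx, hzy⟩ : {z // z ≠ x ∧ z ≠ y}) ≠ b :=
      fun h' => hzb (congrArg Subtype.val h')
    by_cases hw : w ≠ x ∧ w ≠ y
    · rw [← h.edge_off ⟨z, hzx, hzy⟩ ⟨w, hw⟩ hza' hzb',
        ← h₁.edge_off ⟨z, hzx, hzy⟩ ⟨w, hw⟩ hza' hzb']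
    · exact iff_of_false (fun h' => hw (h₁.edge_mem hza' hzb' h'))
        fun h' => hw (h.edge_mem hza' hzb' h')

theorem unique_right {O₁ : FeynmanGraph {z // z ≠ x ∧ z ≠ y}} {a₁ b₁}
    (h₁ : IsInsertion O x y O₁ a₁ b₁) : O₁ = O' ∧ a₁ = a := by
  have ha : a₁ = a := by
    rcases (h₁.edge_x a.1).1 h.edge_xa with h' | h'
    · exact absurd h' a.2.1
    · exact (Subtype.ext h').symm
  have hb : b₁ = b := by
    rcases (h₁.edge_y b.1).1 h.edge_yb with h' | h'
    · exact absurd h' b.2.2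
    · exact (Subtype.ext h').symm
  subst ha
  subst hb
  refine ⟨ext' (fun z w => by rw [h.vert, h₁.vert]) fun z w => ?_, rfl⟩
  by_cases hza : z = a₁
  · subst hza; rw [h.edge_a, h₁.edge_a]
  by_cases hzb : z = b₁
  · subst hzb; rw [h.edge_b, h₁.edge_b]
  rw [h.edge_off z w hza hzb, h₁.edge_off z w hza hzb]

end IsInsertion

end FeynmanGraph

namespace FeynmanGraph

/-! ### Counting outer graphs by their bivalent vertices -/

variable {L : Type} {x y : L}

open Classical in
/-- Inserting a bivalent vertex into an edge. The vertices and edges of the new graph are the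
fibres of maps `v` and `w`: the value `none` is the new vertex, and `inr` marks the two new
edges. -/
theorem exists_insertion (hxy : x ≠ y) (O' : FeynmanGraph {z // z ≠ x ∧ z ≠ y})
    {a b : {z // z ≠ x ∧ z ≠ y}} (hab : a ≠ b) (ha : ∀ z, O'.edge a z ↔ z = a ∨ z = b) :
    ∃ O : FeynmanGraph L, IsInsertion O x y O' a b := by
  let v : L → Option (Quotient O'.vert) := fun z =>
    if hz : z ≠ x ∧ z ≠ y then some (Quotient.mk _ ⟨z, hz⟩) else none
  let w : L → Quotient O'.edge ⊕ Bool := fun z =>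
    if z = x ∨ z = a.1 then Sum.inr false else if z = y ∨ z = b.1 then Sum.inr true else
      if hz : z ≠ x ∧ z ≠ y then Sum.inl (Quotient.mk _ ⟨z, hz⟩) else Sum.inr true
  have hab1 : a.1 ≠ b.1 := fun h => hab (Subtype.ext h)
  have hax := a.2.1
  have hay := a.2.2
  have hbx := b.2.1
  have hby := b.2.2
  have hv : ∀ z : {z // z ≠ x ∧ z ≠ y}, v z.1 = some (Quotient.mk _ z) := fun z => dif_pos z.2
  have hvx : v x = none := by simp [v]
  have hvy : v y = none := by simp [v]
  have hwx : ∀ z, w z = Sum.inr false ↔ z = x ∨ z = a.1 := fun z => by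
    simp only [w]; split_ifs <;> simp_all
  have hwy : ∀ z, w z = Sum.inr true ↔ z = y ∨ z = b.1 := fun z => by
    simp only [w]; split_ifs <;> aesop
  have hw : ∀ z : {z // z ≠ x ∧ z ≠ y}, z ≠ a → z ≠ b → w z.1 = Sum.inl (Quotient.mk _ z) := by
    intro z hza hzb
    have h1 : ¬ (z.1 = x ∨ z.1 = a.1) := by
      rintro (h | h)
      exacts [z.2.1 h, hza (Subtype.ext h)]
    have h2 : ¬ (z.1 = y ∨ z.1 = b.1) := by
      rintro (h | h)
      exacts [z.2.2 h, hzb (Subtype.ext h)]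
    simp only [w]
    rw [if_neg h1, if_neg h2, dif_pos z.2]
  refine ⟨⟨Setoid.ker v, Setoid.ker w⟩, hxy, hab, fun z => ?_, fun z z' => ?_, fun z => ?_,
    fun z => ?_, ha, fun z z' hza hzb => ?_⟩
  · change v x = v z ↔ _
    rw [hvx]
    by_cases hz : z ≠ x ∧ z ≠ y
    · rw [hv ⟨z, hz⟩]
      simp [hz.1, hz.2]
    · rw [show v z = none from dif_neg hz]
      rw [not_and_or, not_not, not_not] at hz
      simp [hz]
  · change _ ↔ v z = v z'
    rw [hv, hv, Option.some_inj]
    exact Quotient.eq.symm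
  · change w x = w z ↔ _
    rw [(hwx x).2 (Or.inl rfl), eq_comm, hwx]
  · change w y = w z ↔ _
    rw [(hwy y).2 (Or.inl rfl), eq_comm, hwy]
  · change _ ↔ w z = w z'
    rw [hw z hza hzb]
    have hb : ∀ z, O'.edge b z ↔ z = a ∨ z = b := fun z => by
      have hab' := (ha b).2 (Or.inr rfl)
      rw [← ha]
      exact ⟨fun hz => O'.edge.trans' hab' hz, fun hz => O'.edge.trans' (O'.edge.symm' hab') hz⟩
    by_cases hza' : z' = a
    · subst hza'
      rw [(hwx _).2 (Or.inr rfl)]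
      refine iff_of_false (fun h => ?_) (by simp)
      rcases (ha z).1 (O'.edge.symm' h) with h | h
      exacts [hza h, hzb h]
    by_cases hzb' : z' = b
    · subst hzb'
      rw [(hwy _).2 (Or.inr rfl)]
      refine iff_of_false (fun h => ?_) (by simp)
      rcases (hb z).1 (O'.edge.symm' h) with h | h
      exacts [hza h, hzb h]
    rw [hw z' hza' hzb', Sum.inl_injective.eq_iff]
    exact Quotient.eq.symm

open Classical in
/-- Removing a bivalent vertex that is joined to two other half-edges `a` and `b`. -/
theorem exists_removal (O : FeynmanGraph L) {a b : {z // z ≠ x ∧ z ≠ y}} (hxy : x ≠ y) (hab : a ≠ b)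
    (hv : ∀ z, O.vert x z ↔ z = x ∨ z = y) (hx : ∀ z, O.edge x z ↔ z = x ∨ z = a.1)
    (hy : ∀ z, O.edge y z ↔ z = y ∨ z = b.1) :
    ∃ O' : FeynmanGraph {z // z ≠ x ∧ z ≠ y}, IsInsertion O x y O' a b := by
  let w : {z // z ≠ x ∧ z ≠ y} → Option (Quotient O.edge) := fun z =>
    if z = a ∨ z = b then none else some (Quotient.mk _ z.1)
  refine ⟨⟨O.vert.comap Subtype.val, Setoid.ker w⟩, hxy, hab, hv, fun _ _ => Iff.rfl, hx, hy,
    fun z => ?_, fun z z' hza hzb => ?_⟩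
  · change w a = w z ↔ _
    have hwa : w a = none := if_pos (Or.inl rfl)
    rw [hwa]
    simp only [w]
    split_ifs with h
    · simp [h]
    · simp [h]
  · change w z = w z' ↔ _
    simp only [w]
    rw [if_neg (not_or.2 ⟨hza, hzb⟩)]
    split_ifs with h
    · refine iff_of_false (by simp) fun h' => ?_
      rcases h with rfl | rfl
      · have hxz := (hx z'.1).2 (Or.inr rfl)
        rcases (hx z.1).1 (O.edge.trans' hxz (O.edge.symm' h')) with h1 | h1
        exacts [z.2.1 h1, hza (Subtype.ext h1)]
      · have hyz := (hy z'.1).2 (Or.inr rfl)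
        rcases (hy z.1).1 (O.edge.trans' hyz (O.edge.symm' h')) with h1 | h1
        exacts [z.2.2 h1, hzb (Subtype.ext h1)]
    · rw [Option.some_inj]
      exact Quotient.eq

/-- In a 1PI graph with legs and internal edges, a bivalent vertex has no legs and no self-loop, and
hence arises by insertion. -/
theorem exists_isInsertion [Finite L] {O : FeynmanGraph L} (hO : O.IsOnePI) (hl : O.legs.Nonempty)
    (hne : O.legs ≠ Set.univ) (hxy : x ≠ y) (hv : ∀ z, O.vert x z ↔ z = x ∨ z = y) :
    x ∉ O.legs ∧ y ∉ O.legs ∧ ∃ O' a b, IsInsertion O x y O' a b := by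
  obtain ⟨h2, hc, hi⟩ := hO
  have hvxy : O.vert x y := (hv y).2 (Or.inr rfl)
  have hvy : ∀ z, O.vert y z ↔ z = x ∨ z = y := fun z => by
    rw [← hv]
    exact ⟨fun hz => O.vert.trans' hvxy hz, fun hz => O.vert.trans' (O.vert.symm' hvxy) hz⟩
  have hpv : ∀ a b, O.vert a b → (a = x ∨ a = y) → (b = x ∨ b = y) := by
    rintro a b hab (rfl | rfl)
    exacts [(hv b).1 hab, (hvy b).1 hab]
  have partner : ∀ z, z ∉ O.legs → ∃ z', z' ≠ z ∧ O.edge z z' := fun z hz => by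
    simp only [legs, Set.mem_ofPred_eq, not_forall] at hz
    obtain ⟨z', h1, h3⟩ := hz
    exact ⟨z', h3, h1⟩
  -- A leg and an internal half-edge on the bivalent vertex: the edge at the latter is a bridge.
  have hbridge : ∀ p q, (∀ z, (z = x ∨ z = y) ↔ (z = p ∨ z = q)) → p ∈ O.legs → q ∉ O.legs →
      False := by
    intro p q hpq hp hq
    obtain ⟨b, hbq, hb⟩ := partner q hq
    have := ((cutEdge_isConnected_iff _ _).1 (hi q hq)).2 (fun z => z = x ∨ z = y) hpv (by
      intro u v huv hqu hu
      rw [hpq] at hu ⊢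
      rcases hu with rfl | rfl
      · exact Or.inl (hp v huv)
      · exact absurd (O.edge.refl' u) hqu) q b ((hpq q).2 (Or.inr rfl))
    rcases (hpq b).1 this with rfl | rfl
    · exact hq (hp q (O.edge.symm' hb) ▸ hp)
    · exact hbq rfl
  -- Otherwise, if the vertex is not joined to other half-edges, it is the whole graph.
  have hall : (∀ u v, O.edge u v → (u = x ∨ u = y) → (v = x ∨ v = y)) → ∀ z, z = x ∨ z = y :=
    fun h z => ((isConnected_iff _).1 hc).2 (fun z => z = x ∨ z = y) hpv h x z (Or.inl rfl)
  have hx : x ∉ O.legs := by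
    intro hx
    by_cases hy : y ∈ O.legs
    · refine hne (Set.eq_univ_of_forall fun z => ?_)
      rcases hall (by
        rintro u v huv (rfl | rfl)
        · exact Or.inl (hx v huv)
        · exact Or.inr (hy v huv)) z with rfl | rfl
      exacts [hx, hy]
    · exact hbridge x y (fun _ => Iff.rfl) hx hy
  have hy : y ∉ O.legs := fun hy => hbridge y x (fun _ => or_comm) hy hx
  have hnxy : ¬ O.edge x y := by
    intro he
    have h1 := edge_iff_of_edge_le_two h2 hxy.symm he
    have h3 := edge_iff_of_edge_le_two h2 hxy (O.edge.symm' he)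
    obtain ⟨z, hz⟩ := hl
    rcases hall (by
      rintro u v huv (rfl | rfl)
      · exact (h1 v).1 huv
      · exact ((h3 v).1 huv).symm) z with rfl | rfl
    exacts [hx hz, hy hz]
  obtain ⟨a, hax, ha⟩ := partner x hx
  obtain ⟨b, hby, hb⟩ := partner y hy
  have hay : a ≠ y := by rintro rfl; exact hnxy ha
  have hbx : b ≠ x := by rintro rfl; exact hnxy (O.edge.symm' hb)
  have hab : (⟨a, hax, hay⟩ : {z // z ≠ x ∧ z ≠ y}) ≠ ⟨b, hbx, hby⟩ := by
    intro h
    have h' : a = b := congrArg Subtype.val h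
    subst h'
    exact hnxy (O.edge.trans' ha (O.edge.symm' hb))
  obtain ⟨O', h⟩ := exists_removal O hxy hab hv (edge_iff_of_edge_le_two h2 hax ha)
    (edge_iff_of_edge_le_two h2 hby hb)
  exact ⟨hx, hy, O', _, _, h⟩

open Classical in
/-- The sum of the smoothed graphs over all outer graphs with legs `R` and `j` half-edges on
bivalent vertices. -/
noncomputable def outerSum (k : Type*) [Field k] (L : Type) [Finite L] (R : Set L) (j : ℕ) :
    GraphAlgebra k :=
  ∑ O ∈ (outerGraphs L R).filter fun O => {z | {w | O.vert z w}.ncard = 2}.ncard = j,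
    O.smooth.toAlgebra k

/-- The half-edges `x` and `y` form a bivalent vertex. -/
def IsBivalentPair (O : FeynmanGraph L) (x y : L) : Prop := ∀ z, O.vert x z ↔ z = x ∨ z = y

open Classical in
/-- The outer graphs with a bivalent vertex `{x, y}` correspond to the pairs of an outer graph
without it and an internal half-edge `a` (the partner of `x`). -/
theorem sum_pair (k : Type*) [Field k] [Finite L] {R : Set L} (hR : R.Nonempty) (hxy : x ≠ y)
    (hx : x ∉ R) (hy : y ∉ R) (j : ℕ) :
    ∑ O ∈ ((outerGraphs L R).filter fun O => {z | {w | O.vert z w}.ncard = 2}.ncard = j + 2).filter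
        fun O => O.IsBivalentPair x y, O.smooth.toAlgebra k =
      (Rᶜ.ncard - 2) • outerSum k {z // z ≠ x ∧ z ≠ y} (Subtype.val ⁻¹' R) j := by
  have : Fintype L := Fintype.ofFinite L
  let A : Finset {z // z ≠ x ∧ z ≠ y} := Finset.univ.filter fun z => z.1 ∉ R
  have hA : A.card = Rᶜ.ncard - 2 := by
    have h1 : A.card = (Rᶜ \ {x, y}).ncard := by
      rw [← Set.ncard_coe_finset, ← Set.ncard_image_of_injective _ Subtype.val_injective]
      congr 1
      ext z
      constructor
      · rintro ⟨z, hz, rfl⟩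
        refine ⟨by simpa [A] using hz, ?_⟩
        rintro (h | h)
        exacts [z.2.1 h, z.2.2 h]
      · rintro ⟨hz, hz'⟩
        have hz2 : z ≠ x ∧ z ≠ y := by simpa using hz'
        exact ⟨⟨z, hz2⟩, by simpa [A] using hz, rfl⟩
    rw [h1, Set.ncard_sdiff (by rintro _ (rfl | rfl) <;> assumption), Set.ncard_pair hxy]
  have hRu : R ≠ Set.univ := fun h => hx (h ▸ Set.mem_univ x)
  unfold outerSum
  rw [← hA, ← Finset.sum_const]
  refine Eq.trans ?_ (Finset.sum_product' A _
    fun _ (O' : FeynmanGraph {z // z ≠ x ∧ z ≠ y}) => O'.smooth.toAlgebra k)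
  symm
  have hins : ∀ p ∈ A ×ˢ (outerGraphs {z // z ≠ x ∧ z ≠ y} (Subtype.val ⁻¹' R)).filter
      (fun O => {z | {w | O.vert z w}.ncard = 2}.ncard = j),
      ∃ O : FeynmanGraph L, ∃ b, IsInsertion O x y p.2 p.1 b := by
    rintro ⟨a, O'⟩ hp
    obtain ⟨ha, hO'⟩ := Finset.mem_product.1 hp
    obtain ⟨-, h1, hl⟩ := mem_outerGraphs.1 (Finset.mem_filter.1 hO').1
    have hal : a ∉ O'.legs := by
      rw [hl]
      exact (Finset.mem_filter.1 ha).2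
    simp only [legs, Set.mem_ofPred_eq, not_forall] at hal
    obtain ⟨b, hb, hba⟩ := hal
    obtain ⟨O, hO⟩ := exists_insertion hxy O' (Ne.symm hba)
      (edge_iff_of_edge_le_two h1.edge_le_two hba hb)
    exact ⟨O, b, hO⟩
  choose f g hfg using hins
  refine Finset.sum_bij (fun p hp => f p hp) ?_ ?_ ?_ ?_
  · intro p hp
    obtain ⟨-, hO'⟩ := Finset.mem_product.1 hp
    obtain ⟨hO'1, hO'2⟩ := Finset.mem_filter.1 hO'
    have h := hfg p hp
    refine Finset.mem_filter.2 ⟨Finset.mem_filter.2 ⟨(h.mem_outerGraphs_iff hx hy).2 hO'1, ?_⟩,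
      h.pair⟩
    rw [h.ncard_bivalent, hO'2]
  · intro p hp p' hp' heq
    have h := hfg p hp
    have h' := hfg p' hp'
    rw [← heq] at h'
    obtain ⟨h1, h2⟩ := h.unique_right h'
    exact Prod.ext h2.symm h1.symm
  · intro O hO
    obtain ⟨hO1, hv⟩ := Finset.mem_filter.1 hO
    obtain ⟨hO1, hj⟩ := Finset.mem_filter.1 hO1
    obtain ⟨-, h1, rfl⟩ := mem_outerGraphs.1 hO1
    obtain ⟨-, -, O', a, b, h⟩ := exists_isInsertion h1 hR hRu hxy hv
    have hp : (a, O') ∈ A ×ˢ (outerGraphs {z // z ≠ x ∧ z ≠ y} (Subtype.val ⁻¹' O.legs)).filter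
        (fun O => {z | {w | O.vert z w}.ncard = 2}.ncard = j) := by
      refine Finset.mem_product.2
        ⟨?_, Finset.mem_filter.2 ⟨(h.mem_outerGraphs_iff hx hy).1 hO1, ?_⟩⟩
      · refine Finset.mem_filter.2 ⟨Finset.mem_univ _, fun hl => ?_⟩
        exact a.2.1 (hl x (O.edge.symm' h.edge_xa)).symm
      · have := h.ncard_bivalent
        change {z | {w | O'.vert z w}.ncard = 2}.ncard = j
        omega
    refine ⟨(a, O'), hp, ?_⟩
    have h' := hfg _ hp
    have hb : g (a, O') hp = b := by
      have e1 := (h'.edge_a b).1 h.edge_ab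
      rcases e1 with e1 | e1
      · exact absurd e1.symm h.ab
      · exact e1.symm
    rw [hb] at h'
    exact h.unique_left h'
  · intro p hp
    exact (hfg p hp).toAlgebra_smooth k

open Classical in
/-- The recursion for the number of bivalent vertices: mark a bivalent vertex and order its two
half-edges, remove it, and remember where it was. -/
theorem outerSum_add_two (k : Type*) [Field k] [Finite L] {R : Set L} (hR : R.Nonempty)
    (hne : R ≠ Set.univ) (j : ℕ) (c : GraphAlgebra k)
    (hc : 2 < Rᶜ.ncard → ∀ x y, x ≠ y → x ∉ R → y ∉ R →
      outerSum k {z // z ≠ x ∧ z ≠ y} (Subtype.val ⁻¹' R) j = c) :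
    (j + 2) • outerSum k L R (j + 2) =
      (Rᶜ.ncard * (Rᶜ.ncard - 1) * (Rᶜ.ncard - 2)) • c := by
  have : Fintype L := Fintype.ofFinite L
  let U : Finset L := Finset.univ.filter fun z => z ∉ R
  have hU : U.card = Rᶜ.ncard := by
    rw [← Set.ncard_coe_finset]
    congr 1
    ext z
    simp [U]
  have hoff : U.offDiag.card = Rᶜ.ncard * (Rᶜ.ncard - 1) := by
    rw [Finset.offDiag_card, hU, Nat.mul_sub, mul_one]
  let pair : FeynmanGraph L → L × L → Prop := fun O p => O.IsBivalentPair p.1 p.2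
  -- A bivalent half-edge determines the other half-edge at its vertex.
  have hcount : ∀ O ∈ (outerGraphs L R).filter
      (fun O => {z | {w | O.vert z w}.ncard = 2}.ncard = j + 2),
      (U.offDiag.filter (pair O)).card = j + 2 := by
    intro O hO
    obtain ⟨hO1, hj⟩ := Finset.mem_filter.1 hO
    obtain ⟨-, h1, rfl⟩ := mem_outerGraphs.1 hO1
    refine Eq.trans ?_ hj
    rw [← Set.ncard_coe_finset]
    refine Set.ncard_congr (fun p _ => p.1) ?_ ?_ ?_
    · rintro ⟨p, q⟩ hp
      obtain ⟨hp1, hp2⟩ := Finset.mem_filter.1 (Finset.mem_coe.1 hp)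
      obtain ⟨-, -, hpq⟩ := Finset.mem_offDiag.1 hp1
      have : {w | O.vert p w} = {p, q} := by ext w; exact hp2 w
      change {w | O.vert p w}.ncard = 2
      rw [this, Set.ncard_pair hpq]
    · rintro ⟨p, q⟩ ⟨p', q'⟩ hp hp' heq
      obtain ⟨hp1, hp2⟩ := Finset.mem_filter.1 (Finset.mem_coe.1 hp)
      obtain ⟨-, hp2'⟩ := Finset.mem_filter.1 (Finset.mem_coe.1 hp')
      obtain ⟨-, -, hpq⟩ := Finset.mem_offDiag.1 hp1
      change p = p' at heq
      subst heq
      rcases (hp2' q).1 ((hp2 q).2 (Or.inr rfl)) with h | h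
      · exact absurd h.symm hpq
      · exact Prod.ext rfl h
    · intro p hp
      obtain ⟨u, v, huv, hset⟩ := Set.ncard_eq_two.1 hp
      have hmem : ∀ w, O.vert p w ↔ w = u ∨ w = v := fun w => Set.ext_iff.1 hset w
      have hex : ∃ q, p ≠ q ∧ ∀ w, O.vert p w ↔ w = p ∨ w = q := by
        rcases (hmem p).1 (O.vert.refl' p) with rfl | rfl
        · exact ⟨v, huv, hmem⟩
        · exact ⟨u, huv.symm, fun w => (hmem w).trans or_comm⟩
      obtain ⟨q, hpq, hv⟩ := hex
      obtain ⟨hx, hy, -⟩ := exists_isInsertion h1 hR hne hpq hv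
      exact ⟨(p, q), Finset.mem_coe.2 (Finset.mem_filter.2 ⟨Finset.mem_offDiag.2
        ⟨by simpa [U] using hx, by simpa [U] using hy, hpq⟩, hv⟩), rfl⟩
  calc (j + 2) • outerSum k L R (j + 2)
      = ∑ O ∈ (outerGraphs L R).filter
          (fun O => {z | {w | O.vert z w}.ncard = 2}.ncard = j + 2),
          ∑ p ∈ U.offDiag, if pair O p then O.smooth.toAlgebra k else 0 := by
        unfold outerSum
        rw [Finset.smul_sum]
        refine Finset.sum_congr rfl fun O hO => ?_
        rw [← Finset.sum_filter, Finset.sum_const, hcount O hO]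
    _ = ∑ p ∈ U.offDiag, (Rᶜ.ncard - 2) • c := by
        rw [Finset.sum_comm]
        refine Finset.sum_congr rfl fun p hp => ?_
        obtain ⟨hp1, hp2, hpq⟩ := Finset.mem_offDiag.1 hp
        have hp1' : p.1 ∉ R := (Finset.mem_filter.1 hp1).2
        have hp2' : p.2 ∉ R := (Finset.mem_filter.1 hp2).2
        have h := sum_pair k hR hpq hp1' hp2' j
        rw [← Finset.sum_filter]
        by_cases h2 : 2 < Rᶜ.ncard
        · rw [← hc h2 p.1 p.2 hpq hp1' hp2', ← h]
        · rw [Nat.sub_eq_zero_of_le (not_lt.1 h2), zero_smul] at h ⊢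
          exact h
    _ = _ := by rw [Finset.sum_const, hoff, smul_smul]

theorem outerSum_zero (k : Type*) [Field k] [Finite L] (R : Set L) :
    outerSum k L R 0 = pieceSum k L R := by
  classical
  unfold outerSum pieceSum
  have h4 : ∀ O : FeynmanGraph L, (O ∈ (outerGraphs L R).filter
      fun O => {z | {w | O.vert z w}.ncard = 2}.ncard = 0) ↔ O ∈ pieces L R := by
    intro O
    rw [Finset.mem_filter, mem_outerGraphs, mem_pieces, Set.ncard_eq_zero]
    constructor
    · rintro ⟨⟨h1, h2, h3⟩, h4⟩
      refine ⟨fun z => (h1 z).resolve_left fun h => ?_, h2, h3⟩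
      exact (Set.eq_empty_iff_forall_notMem.1 h4 z) h
    · rintro ⟨h1, h2, h3⟩
      refine ⟨⟨fun z => Or.inr (h1 z), h2, h3⟩, Set.eq_empty_iff_forall_notMem.2 fun z hz => ?_⟩
      have hz' : {w | O.vert z w}.ncard = 2 := hz
      rw [h1 z] at hz'
      omega
  refine Finset.sum_congr (Finset.ext h4) fun O hO => ?_
  have hv := (mem_pieces.1 hO).1
  refine toAlgebra_congr k _ _ (Equiv.subtypeUnivEquiv hv) (fun _ _ => Iff.rfl) fun x y => ?_
  rw [smooth_edge_iff]
  constructor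
  · intro h
    refine h (fun z => O.edge x.1 z) (fun a b hab ha => O.edge.trans' ha hab) (fun a b ha => ?_)
      (O.edge.refl' _)
    rw [hv a] at ha
    omega
  · intro h P h1 _
    exact h1 _ _ h

open Nat in
/-- The contribution of the outer graphs with `d` bivalent vertices. There are `m + 2 * d` internal
half-edges, `m` of which remain after smoothing; the bivalent vertices form chains on the `m / 2`
edges of the smoothed graph. -/
theorem outerSum_eq (k : Type*) [Field k] [CharZero k] (d : ℕ) :
    ∀ {L : Type} [Finite L] (R : Set L), R.Nonempty → R ≠ Set.univ →
    (Rᶜ.ncard ≤ 2 * d → outerSum k L R (2 * d) = 0) ∧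
    ∀ m, Rᶜ.ncard = m + 2 * d → (2 ^ d * d !) • outerSum k L R (2 * d) =
      (Rᶜ.ncard ! * ∏ i ∈ Finset.range d, (m + 2 * i)) • pieceCoeff k R.ncard m := by
  induction d with
  | zero =>
    intro L _ R hR hne
    have hpos : 0 < Rᶜ.ncard := by
      rw [Set.ncard_pos]
      exact Set.nonempty_compl.2 hne
    refine ⟨fun h => by omega, fun m hm => ?_⟩
    rw [mul_zero, outerSum_zero, pieceSum_eq, ← Nat.cast_smul_eq_nsmul k,
      ← Nat.cast_smul_eq_nsmul k, hm]
    simp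
  | succ d ih =>
    intro L _ R hR hne
    have hpos : 0 < Rᶜ.ncard := by
      rw [Set.ncard_pos]
      exact Set.nonempty_compl.2 hne
    have hsub : ∀ x y, x ≠ y → x ∉ R → y ∉ R →
        ((Subtype.val : {z // z ≠ x ∧ z ≠ y} → L) ⁻¹' R).ncard = R.ncard ∧
        ((Subtype.val : {z // z ≠ x ∧ z ≠ y} → L) ⁻¹' R)ᶜ.ncard + 2 = Rᶜ.ncard ∧
        ((Subtype.val : {z // z ≠ x ∧ z ≠ y} → L) ⁻¹' R).Nonempty := by
      intro x y hxy hx hy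
      have hsubR : R ⊆ Set.range (Subtype.val : {z // z ≠ x ∧ z ≠ y} → L) := fun z hz =>
        ⟨⟨z, by rintro rfl; exact hx hz, by rintro rfl; exact hy hz⟩, rfl⟩
      refine ⟨Set.ncard_preimage_of_injective_subset_range Subtype.val_injective hsubR, ?_, ?_⟩
      · have h1 : ((Subtype.val : {z // z ≠ x ∧ z ≠ y} → L) ⁻¹' R)ᶜ.ncard =
            (Rᶜ \ {x, y}).ncard := by
          rw [← Set.ncard_image_of_injective _ Subtype.val_injective]
          congr 1
          ext z
          constructor
          · rintro ⟨z, hz, rfl⟩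
            refine ⟨hz, ?_⟩
            rintro (h | h)
            exacts [z.2.1 h, z.2.2 h]
          · rintro ⟨hz, hz'⟩
            have hz2 : z ≠ x ∧ z ≠ y := by simpa using hz'
            exact ⟨⟨z, hz2⟩, hz, rfl⟩
        have hs : ({x, y} : Set L) ⊆ Rᶜ := by rintro _ (rfl | rfl) <;> assumption
        rw [h1, ← Set.ncard_pair hxy, Set.ncard_sdiff_add_ncard_of_subset hs]
      · obtain ⟨z, hz⟩ := hR
        obtain ⟨w, rfl⟩ := hsubR hz
        exact ⟨w, hz⟩
    have huniv : ∀ {α : Type} [Finite α] (T : Set α), 0 < Tᶜ.ncard → T ≠ Set.univ := by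
      rintro α _ T hT rfl
      simp at hT
    have hcast : ∀ {n : ℕ} {z : GraphAlgebra k}, n ≠ 0 → n • z = 0 → z = 0 := fun {n z} hn hz => by
      rw [← Nat.cast_smul_eq_nsmul k, smul_eq_zero] at hz
      exact hz.resolve_left (Nat.cast_ne_zero.2 hn)
    constructor
    · intro hle
      refine hcast (n := 2 * d + 2) (by omega) ?_
      refine (outerSum_add_two k hR hne (2 * d) 0 fun h2 x y hxy hx hy => ?_).trans (smul_zero _)
      obtain ⟨-, h4, h5⟩ := hsub x y hxy hx hy
      exact (ih _ h5 (huniv _ (by omega))).1 (by omega)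
    · intro m hm
      set N : ℕ := (Rᶜ.ncard - 2)! * ∏ i ∈ Finset.range d, (m + 2 * i)
      set M : ℕ := 2 ^ d * (d !)
      have hM : M ≠ 0 := by positivity
      let c : GraphAlgebra k := (M : k)⁻¹ • (N : k) • pieceCoeff k R.ncard m
      have hMc : M • c = N • pieceCoeff k R.ncard m := by
        rw [← Nat.cast_smul_eq_nsmul k, ← Nat.cast_smul_eq_nsmul k, smul_smul,
          mul_inv_cancel₀ (Nat.cast_ne_zero.2 hM), one_smul]
      have h := outerSum_add_two k hR hne (2 * d) c fun h2 x y hxy hx hy => by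
        obtain ⟨h3, h4, h5⟩ := hsub x y hxy hx hy
        have h6 := (ih _ h5 (huniv _ (by omega))).2 m (by omega)
        rw [h3, show (((Subtype.val : {z // z ≠ x ∧ z ≠ y} → L) ⁻¹' R)ᶜ.ncard) = Rᶜ.ncard - 2 by
          omega] at h6
        rw [← sub_eq_zero]
        refine hcast hM ?_
        rw [smul_sub, hMc, sub_eq_zero]
        exact h6
      have h7 : 2 ^ (d + 1) * (d + 1)! = M * (2 * d + 2) := by
        rw [Nat.factorial_succ, pow_succ]
        ring
      have h8 : Rᶜ.ncard ! * ∏ i ∈ Finset.range (d + 1), (m + 2 * i) =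
          (Rᶜ.ncard * (Rᶜ.ncard - 1) * (Rᶜ.ncard - 2)) * N := by
        obtain ⟨v, hv⟩ : ∃ v, Rᶜ.ncard = v + 2 := ⟨m + 2 * d, by omega⟩
        have hv' : v = m + 2 * d := by omega
        simp only [N, hv, Nat.add_sub_cancel]
        rw [Finset.prod_range_succ, Nat.factorial_succ, Nat.factorial_succ, ← hv',
          show v + 2 - 1 = v + 1 by omega]
        ring
      rw [show 2 * (d + 1) = 2 * d + 2 by ring, h7, h8, mul_smul, h, smul_smul, mul_comm M,
        mul_smul, hMc, ← mul_smul]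

end FeynmanGraph

namespace FeynmanGraph

/-! ### The coproduct of the sum of all pieces -/

section

variable (k : Type*) [Field k] {H : Type}

open Classical in
theorem coproduct_eq_sum [Fintype H] (G : FeynmanGraph H) :
    G.coproduct k = ∑ S : Set H, if G.IsDivergentSubgraph S then
      G.subgraphMonomial k S ⊗ₜ[k] (G.outer S).smooth.toAlgebra k else 0 := by
  unfold coproduct
  rw [finsum_eq_sum_of_fintype, ← Finset.sum_filter, ← Finset.sum_subtype_eq_sum_filter]
  refine Finset.sum_bij (fun S _ => ⟨S.1, S.2⟩) ?_ ?_ ?_ ?_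
  · intro S _
    simp
  · intro S _ S' _ h
    exact Subtype.ext (Subtype.mk.inj h)
  · intro S _
    exact ⟨⟨S.1, S.2⟩, Finset.mem_univ _, rfl⟩
  · intro S _
    rw [toAlgebra_contract]

open Classical Nat in
/-- The pairs of a graph and a subgraph are sorted by the set `S` of inner half-edges and the outer
graph `O`. -/
theorem comul_pieceSum [CharZero k] [Fintype H] {R : Set H} (hR : R.ncard = 2 ∨ R.ncard = 4)
    (hne : R ≠ Set.univ) :
    GraphAlgebra.comul k (pieceSum k H R) = ∑ S ∈ Finset.univ.filter fun S : Set H => Disjoint S R,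
      ∑ O ∈ outerGraphs {x // x ∉ S} (Subtype.val ⁻¹' R),
        ((S.ncard ! : k) • PowerSeries.coeff S.ncard
          (∏ q : Quotient O.vert, pieceSeries k {x | Quotient.mk O.vert x = q}.ncard)) ⊗ₜ[k]
        O.smooth.toAlgebra k := by
  unfold pieceSum
  rw [map_sum]
  have h1 : ∀ G ∈ pieces H R, GraphAlgebra.comul k (G.toAlgebra k) =
      ∑ S : Set H, if G.IsDivergentSubgraph S then
        G.subgraphMonomial k S ⊗ₜ[k] (G.outer S).smooth.toAlgebra k else 0 := fun G hG => by
    rw [comul_toAlgebra k G (isDivergent1PI_of_mem_pieces hG hR hne), coproduct_eq_sum]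
  rw [Finset.sum_congr rfl h1, Finset.sum_comm, Finset.sum_filter]
  refine Finset.sum_congr rfl fun S _ => ?_
  have h2 : ∀ G ∈ pieces H R, (if G.IsDivergentSubgraph S then
        G.subgraphMonomial k S ⊗ₜ[k] (G.outer S).smooth.toAlgebra k else 0) =
      if Disjoint S R then ∑ O ∈ outerGraphs {x // x ∉ S} (Subtype.val ⁻¹' R),
        if G.IsDivergentSubgraph S ∧ G.outer S = O then
          G.subgraphMonomial k S ⊗ₜ[k] O.smooth.toAlgebra k else 0 else 0 := by
    intro G hG
    by_cases hS : G.IsDivergentSubgraph S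
    · obtain ⟨hd, ho⟩ := outer_mem hS hG
      simp only [hS, true_and, if_true, hd]
      rw [Finset.sum_ite_eq, if_pos ho]
    · simp [hS]
  rw [Finset.sum_congr rfl h2]
  by_cases hd : Disjoint S R
  · simp only [hd, if_true]
    rw [Finset.sum_comm]
    refine Finset.sum_congr rfl fun O hO => ?_
    rw [← Finset.sum_filter, ← TensorProduct.sum_tmul, sum_subgraphMonomial k S R O hd hO]
  · simp [hd]

open Classical in
/-- Bivalent and four-valent vertices contribute one factor each. -/
theorem prod_pieceSeries {L : Type} [Fintype L] {R : Set L} {O : FeynmanGraph L}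
    (hO : O ∈ outerGraphs L R) : ∃ d v, {z | {w | O.vert z w}.ncard = 2}.ncard = 2 * d ∧
      2 * d + 4 * v = Fintype.card L ∧
      ∏ q : Quotient O.vert, pieceSeries k {x | Quotient.mk O.vert x = q}.ncard =
        pieceSeries k 2 ^ d * pieceSeries k 4 ^ v := by
  obtain ⟨h24, -, -⟩ := mem_outerGraphs.1 hO
  let size : Quotient O.vert → ℕ := fun q => {x | Quotient.mk O.vert x = q}.ncard
  have hsize : ∀ q, size q = 2 ∨ size q = 4 := fun q => by
    induction q using Quotient.inductionOn with
    | h y =>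
      change {x | Quotient.mk O.vert x = Quotient.mk O.vert y}.ncard = 2 ∨
        {x | Quotient.mk O.vert x = Quotient.mk O.vert y}.ncard = 4
      rw [setOf_mk_eq]
      exact h24 y
  have h4 : ∀ q, ¬ size q = 2 → size q = 4 := fun q h => (hsize q).resolve_left h
  refine ⟨(Finset.univ.filter fun q => size q = 2).card,
    (Finset.univ.filter fun q => ¬ size q = 2).card, ?_, ?_, ?_⟩
  · have hb : {z | {w | O.vert z w}.ncard = 2} =
        ((Finset.univ.filter fun z => size (Quotient.mk O.vert z) = 2 : Finset L) : Set L) := by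
      ext z
      simp only [Finset.coe_filter, Finset.mem_univ, true_and, Set.mem_ofPred_eq, size, setOf_mk_eq]
    rw [hb, Set.ncard_coe_finset,
      Finset.card_eq_sum_card_fiberwise (f := fun z => Quotient.mk O.vert z)
        (t := Finset.univ.filter fun q => size q = 2)
        (fun z hz => by simpa using hz), mul_comm]
    refine Finset.sum_const_nat fun q hq => ?_
    have hq2 : size q = 2 := (Finset.mem_filter.1 hq).2
    refine Eq.trans ?_ hq2
    change _ = {x | Quotient.mk O.vert x = q}.ncard
    rw [← Set.ncard_coe_finset]
    congr 1
    ext z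
    simp only [Finset.coe_filter, Finset.mem_filter, Finset.mem_univ, true_and, Set.mem_ofPred_eq]
    exact ⟨fun h => h.2, fun h => ⟨h ▸ hq2, h⟩⟩
  · have h := sum_ncard_classes O.vert
    rw [Nat.card_eq_fintype_card] at h
    rw [← h]
    change _ = ∑ q, size q
    rw [← Finset.sum_filter_add_sum_filter_not _ (fun q => size q = 2),
      Finset.sum_const_nat fun q hq => (Finset.mem_filter.1 hq).2,
      Finset.sum_const_nat fun q hq => h4 q (Finset.mem_filter.1 hq).2]
    ring
  · change ∏ q, pieceSeries k (size q) = _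
    rw [← Finset.prod_filter_mul_prod_filter_not _ (fun q => size q = 2),
      Finset.prod_congr rfl fun q hq => by rw [(Finset.mem_filter.1 hq).2],
      Finset.prod_congr (s₁ := Finset.univ.filter fun q => ¬ size q = 2) rfl
        fun q hq => by rw [h4 q (Finset.mem_filter.1 hq).2],
      Finset.prod_const, Finset.prod_const]

/-- The coefficient of the `r`-point pieces with `m` internal half-edges in the sum of the graphs
obtained from them by inserting `d` bivalent vertices. -/
noncomputable def chainCoeff (d m : ℕ) : k :=
  open Nat in ((2 ^ d * d ! : ℕ) : k)⁻¹ * ((∏ i ∈ Finset.range d, (m + 2 * i) : ℕ) : k)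

/-- The sum of the smoothed outer graphs with `d` bivalent vertices and `u` internal half-edges,
divided by `u!`. The case `u = 0` is a single vertex. -/
noncomputable def outerCoeff (r d u : ℕ) : GraphAlgebra k :=
  if u = 0 then if 2 * d + r = 4 then 1 else 0
  else if u ≤ 2 * d then 0 else chainCoeff k d (u - 2 * d) • pieceCoeff k r (u - 2 * d)

theorem outerGraphs_univ {L : Type} [Fintype L] (hL : Fintype.card L = 2 ∨ Fintype.card L = 4) :
    outerGraphs L Set.univ = {⟨⊤, ⊥⟩} := by
  have hne : Nonempty L := Fintype.card_pos_iff.1 (by omega)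
  ext O
  rw [mem_outerGraphs, Finset.mem_singleton]
  constructor
  · rintro ⟨-, h, hl⟩
    have he : O.edge = ⊥ := by
      refine Setoid.ext fun x y => ⟨fun hxy => ?_, fun hxy => ?_⟩
      · have hx : x ∈ O.legs := hl ▸ Set.mem_univ x
        exact (hx y hxy).symm
      · obtain rfl : x = y := hxy
        exact O.edge.refl' x
    have hv := h.connected.2
    rw [he, sup_bot_eq] at hv
    obtain ⟨v, e⟩ := O
    obtain rfl : v = ⊤ := hv
    obtain rfl : e = ⊥ := he
    rfl
  · rintro rfl
    have hl : (⟨⊤, ⊥⟩ : FeynmanGraph L).legs = Set.univ :=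
      Set.eq_univ_of_forall fun x y hxy => Eq.symm hxy
    refine ⟨fun h => ?_, ⟨fun h => ?_, ⟨hne, sup_bot_eq _⟩, fun h hh => ?_⟩, hl⟩
    · have : {x | (⊤ : Setoid L) h x} = Set.univ := Set.eq_univ_of_forall fun _ => trivial
      simpa only [this, Set.ncard_univ, Nat.card_eq_fintype_card] using hL
    · have : {x | (⊥ : Setoid L) h x} = {h} := by
        ext x
        exact ⟨fun e => Eq.symm e, fun e => Eq.symm e⟩
      simp only [this, Set.ncard_singleton]
      norm_num
    · exact (hh (hl ▸ Set.mem_univ h)).elim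

/-- The only outer graph all of whose half-edges are legs is a single vertex. -/
theorem outerSum_univ {L : Type} [Fintype L] (hL : Fintype.card L = 2 ∨ Fintype.card L = 4)
    (d : ℕ) : outerSum k L Set.univ (2 * d) = if 2 * d + Fintype.card L = 4 then 1 else 0 := by
  have hcl : ∀ z : L, {w | (⊤ : Setoid L) z w}.ncard = Fintype.card L := fun z => by
    have : {x | (⊤ : Setoid L) z x} = Set.univ := Set.eq_univ_of_forall fun _ => trivial
    rw [this, Set.ncard_univ, Nat.card_eq_fintype_card]
  have hs : (⟨⊤, ⊥⟩ : FeynmanGraph L).smooth.toAlgebra k = 1 := by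
    refine toAlgebra_of_not k fun h => ?_
    obtain ⟨x, hx⟩ := h.exists_internal
    refine hx fun y hxy => ?_
    have h4 : Fintype.card L = 4 := (hcl x.1).symm.trans x.2
    refine Subtype.ext ((smooth_edge_iff _ x y).1 hxy (fun z => z = x.1) ?_ ?_ rfl)
    · rintro a b hab rfl
      exact Eq.symm hab
    · intro a b ha
      have := (hcl a).symm.trans ha
      omega
  have hb : {z : L | {w | (⊤ : Setoid L) z w}.ncard = 2}.ncard = 2 * d ↔
      2 * d + Fintype.card L = 4 := by
    simp only [hcl]
    rcases hL with h | h
    · have : {z : L | Fintype.card L = 2} = Set.univ := Set.eq_univ_of_forall fun _ => h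
      rw [this, Set.ncard_univ, Nat.card_eq_fintype_card]
      omega
    · have : {z : L | Fintype.card L = 2} = ∅ := Set.eq_empty_of_forall_notMem fun _ h' => by
        have h' : Fintype.card L = 2 := h'
        omega
      rw [this, Set.ncard_empty]
      omega
  unfold outerSum
  rw [outerGraphs_univ hL, Finset.filter_singleton]
  simp only [hb]
  split_ifs with h
  · rw [Finset.sum_singleton, hs]
  · rfl

open Nat in
theorem outerSum_eq_outerCoeff [CharZero k] {L : Type} [Fintype L] {R : Set L}
    (hR : R.ncard = 2 ∨ R.ncard = 4) (d : ℕ) :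
    outerSum k L R (2 * d) = (Rᶜ.ncard ! : k) • outerCoeff k R.ncard d Rᶜ.ncard := by
  unfold outerCoeff
  by_cases hu : R = Set.univ
  · subst hu
    rw [Set.ncard_univ, Nat.card_eq_fintype_card] at hR
    rw [outerSum_univ k hR]
    simp
  · have hne : R.Nonempty := by
      rw [← Set.ncard_pos]
      omega
    have hpos : Rᶜ.ncard ≠ 0 := by
      rw [Ne, Set.ncard_eq_zero, Set.compl_empty_iff]
      exact hu
    obtain ⟨h1, h2⟩ := outerSum_eq k d R hne hu
    rw [if_neg hpos]
    split_ifs with h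
    · rw [h1 h, smul_zero]
    · have h3 := h2 (Rᶜ.ncard - 2 * d) (by omega)
      have hd : ((2 ^ d * d ! : ℕ) : k) ≠ 0 := by
        rw [Nat.cast_ne_zero]
        positivity
      rw [← Nat.cast_smul_eq_nsmul k, ← Nat.cast_smul_eq_nsmul k] at h3
      have h4 := congrArg (fun z => ((2 ^ d * d ! : ℕ) : k)⁻¹ • z) h3
      simp only [smul_smul, inv_mul_cancel₀ hd, one_smul] at h4
      rw [h4, smul_smul, chainCoeff, Nat.cast_mul (Rᶜ.ncard !), mul_left_comm]

open Classical in
/-- The outer graphs are sorted by the number `d` of bivalent vertices. -/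
theorem sum_outerGraphs_tmul {L : Type} [Fintype L] (R : Set L) (t N : ℕ)
    (hN : Fintype.card L < N) :
    ∑ O ∈ outerGraphs L R, PowerSeries.coeff t
        (∏ q : Quotient O.vert, pieceSeries k {x | Quotient.mk O.vert x = q}.ncard) ⊗ₜ[k]
        O.smooth.toAlgebra k =
      ∑ d ∈ Finset.range N, PowerSeries.coeff t
        (pieceSeries k 2 ^ d * pieceSeries k 4 ^ ((Fintype.card L - 2 * d) / 4)) ⊗ₜ[k]
        outerSum k L R (2 * d) := by
  have h1 : ∀ d, PowerSeries.coeff t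
        (pieceSeries k 2 ^ d * pieceSeries k 4 ^ ((Fintype.card L - 2 * d) / 4)) ⊗ₜ[k]
        outerSum k L R (2 * d) = ∑ O ∈ outerGraphs L R,
          if {z | {w | O.vert z w}.ncard = 2}.ncard = 2 * d then PowerSeries.coeff t
        (pieceSeries k 2 ^ d * pieceSeries k 4 ^ ((Fintype.card L - 2 * d) / 4)) ⊗ₜ[k]
        O.smooth.toAlgebra k else 0 := fun d => by
    unfold outerSum
    rw [TensorProduct.tmul_sum, Finset.sum_filter]
  rw [Finset.sum_congr rfl fun d _ => h1 d, Finset.sum_comm]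
  refine Finset.sum_congr rfl fun O hO => ?_
  obtain ⟨d, v, hd, hv, hp⟩ := prod_pieceSeries k hO
  rw [Finset.sum_eq_single d]
  · rw [if_pos hd, hp]
    congr 4
    omega
  · intro d' _ hne
    rw [if_neg (by omega)]
  · intro h
    rw [Finset.mem_range] at h
    omega

theorem sum_disjoint_apply_ncard {M : Type*} [AddCommMonoid M] {H : Type} [Fintype H] (R : Set H)
    [DecidablePred fun S : Set H => Disjoint S R] (f : ℕ → M) :
    ∑ S ∈ (Finset.univ : Finset (Set H)).filter fun S => Disjoint S R, f S.ncard =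
      ∑ t ∈ Finset.range (Rᶜ.ncard + 1), Rᶜ.ncard.choose t • f t := by
  classical
  have h := Finset.sum_powerset_apply_card f (x := Rᶜ.toFinset)
  rw [← Set.ncard_eq_toFinset_card'] at h
  rw [← h]
  refine (Finset.sum_bij (fun (S : Finset H) _ => (S : Set H)) ?_ ?_ ?_ ?_).symm
  · intro S hS
    rw [Finset.mem_powerset] at hS
    refine Finset.mem_filter.2 ⟨Finset.mem_univ _, ?_⟩
    rw [Set.disjoint_left]
    intro x hx
    exact Set.mem_toFinset.1 (hS hx)
  · intro S _ S' _ h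
    exact Finset.coe_injective h
  · intro S hS
    refine ⟨S.toFinset, ?_, Set.coe_toFinset S⟩
    rw [Finset.mem_powerset]
    intro x hx
    exact Set.mem_toFinset.2
      (Set.disjoint_left.1 (Finset.mem_filter.1 hS).2 (Set.mem_toFinset.1 hx))
  · intro S _
    rw [Set.ncard_coe_finset]

open Classical Nat in
/-- The coproduct of the `r`-point pieces with `s` internal half-edges; `t` is the number of inner
half-edges, and `d` the number of two-point components of the subgraph. -/
theorem comul_pieceCoeff [CharZero k] {r s : ℕ} (hr : r = 2 ∨ r = 4) (hs : s ≠ 0) :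
    GraphAlgebra.comul k (pieceCoeff k r s) = ∑ t ∈ Finset.range (s + 1),
      ∑ d ∈ Finset.range (s + r + 1), PowerSeries.coeff t
        (pieceSeries k 2 ^ d * pieceSeries k 4 ^ ((s - t + r - 2 * d) / 4)) ⊗ₜ[k]
        outerCoeff k r d (s - t) := by
  set R : Set (Fin s ⊕ Fin r) := Set.range Sum.inr with hRdef
  have hRc : R.ncard = r := by
    rw [hRdef, ← Set.image_univ, Set.ncard_image_of_injective _ Sum.inr_injective, Set.ncard_univ,
      Nat.card_fin]
  have hcard : R.ncard + Rᶜ.ncard = s + r := by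
    rw [Set.ncard_add_ncard_compl, Nat.card_eq_fintype_card, Fintype.card_sum, Fintype.card_fin,
      Fintype.card_fin]
  have hsc : Rᶜ.ncard = s := by omega
  have hne : R ≠ Set.univ := by
    intro h
    rw [h, Set.compl_univ, Set.ncard_empty] at hsc
    exact hs hsc.symm
  have hsum := comul_pieceSum k (hRc.symm ▸ hr) hne
  obtain ⟨F, hF⟩ : ∃ F : ℕ → GraphAlgebra k ⊗[k] GraphAlgebra k, ∀ t, F t =
      (t ! * (s - t)! : k) • ∑ d ∈ Finset.range (s + r + 1), PowerSeries.coeff t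
        (pieceSeries k 2 ^ d * pieceSeries k 4 ^ ((s - t + r - 2 * d) / 4)) ⊗ₜ[k]
        outerCoeff k r d (s - t) := ⟨_, fun _ => rfl⟩
  have hterm : ∀ S ∈ (Finset.univ : Finset (Set (Fin s ⊕ Fin r))).filter (fun S => Disjoint S R),
      ∑ O ∈ outerGraphs {x // x ∉ S} (Subtype.val ⁻¹' R),
        ((S.ncard ! : k) • PowerSeries.coeff S.ncard
          (∏ q : Quotient O.vert, pieceSeries k {x | Quotient.mk O.vert x = q}.ncard)) ⊗ₜ[k]
        O.smooth.toAlgebra k = F S.ncard := by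
    intro S hS
    rw [hF]
    have hd : Disjoint S R := (Finset.mem_filter.1 hS).2
    have hr' : (Subtype.val ⁻¹' R : Set {x // x ∉ S}).ncard = r := by
      rw [← Set.ncard_image_of_injective _ Subtype.val_injective]
      refine Eq.trans (congrArg Set.ncard ?_) hRc
      ext x
      exact ⟨fun ⟨y, hy, hyx⟩ => hyx ▸ hy,
        fun h => ⟨⟨x, fun hx => Set.disjoint_left.1 hd hx h⟩, h, rfl⟩⟩
    have hS' : S.ncard + Fintype.card {x // x ∉ S} = s + r := by
      have := Set.ncard_add_ncard_compl S
      rw [Nat.card_eq_fintype_card, Fintype.card_sum, Fintype.card_fin, Fintype.card_fin] at this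
      rw [← this, ← Nat.card_eq_fintype_card]
      rfl
    have hrc : (Subtype.val ⁻¹' R : Set {x // x ∉ S}).ncard +
        (Subtype.val ⁻¹' R : Set {x // x ∉ S})ᶜ.ncard = Fintype.card {x // x ∉ S} := by
      rw [Set.ncard_add_ncard_compl, Nat.card_eq_fintype_card]
    have hu : (Subtype.val ⁻¹' R : Set {x // x ∉ S})ᶜ.ncard = s - S.ncard := by omega
    have hcl : Fintype.card {x // x ∉ S} = s - S.ncard + r := by omega
    simp only [← TensorProduct.smul_tmul']
    rw [← Finset.smul_sum, sum_outerGraphs_tmul k _ _ (s + r + 1) (by omega), mul_smul]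
    congr 1
    rw [Finset.smul_sum]
    refine Finset.sum_congr rfl fun d _ => ?_
    rw [outerSum_eq_outerCoeff k (hr'.symm ▸ hr), hu, hr', hcl, TensorProduct.tmul_smul]
  rw [(Finset.sum_congr rfl hterm).trans (sum_disjoint_apply_ncard R F), hsc] at hsum
  unfold pieceCoeff
  rw [map_smul, hsum, Finset.smul_sum]
  refine Finset.sum_congr rfl fun t ht => ?_
  have hts : t ≤ s := Nat.lt_succ_iff.1 (Finset.mem_range.1 ht)
  rw [hF, ← Nat.cast_smul_eq_nsmul k, smul_smul, smul_smul]
  have h0 : (s ! : k) ≠ 0 := Nat.cast_ne_zero.2 (Nat.factorial_ne_zero s)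
  have h1 : (s.choose t : k) * (t ! * (s - t)! : k) = (s ! : k) := by
    rw [← mul_assoc]
    exact_mod_cast Nat.choose_mul_factorial_mul_factorial hts
  rw [mul_assoc, h1, inv_mul_cancel₀ h0, one_smul]

end

end FeynmanGraph

/-! ### The coproduct of the sums of `r`-point graphs -/

theorem one_sub_mul_sum_multichoose {A : Type*} [CommRing A] (q : A) (e N : ℕ) :
    (1 - q) * ∑ d ∈ Finset.range (N + 1), (Nat.multichoose (e + 1) d : A) * q ^ d =
      ∑ d ∈ Finset.range (N + 1), (Nat.multichoose e d : A) * q ^ d -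
        Nat.multichoose (e + 1) N * q ^ (N + 1) := by
  induction N with
  | zero => simp
  | succ N ih =>
    rw [Finset.sum_range_succ, mul_add, ih, Finset.sum_range_succ _ (N + 1),
      Nat.multichoose_succ_succ]
    push_cast
    ring

/-- The negative binomial series, cut off after `N + 1` terms. -/
theorem pow_dvd_sum_multichoose {A : Type*} [CommRing A] {q w : A} (h : (1 - q) * w = 1) (N : ℕ) :
    ∀ e, q ^ (N + 1) ∣ ∑ d ∈ Finset.range (N + 1), (Nat.multichoose e d : A) * q ^ d - w ^ e
  | 0 => by
    rw [Finset.sum_range_succ', Finset.sum_eq_zero fun d _ => by simp]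
    simp
  | e + 1 => by
    obtain ⟨r, hr⟩ := pow_dvd_sum_multichoose h N e
    refine ⟨w * (r - Nat.multichoose (e + 1) N), ?_⟩
    have h1 := one_sub_mul_sum_multichoose q e N
    linear_combination w * hr + w * h1 - (∑ d ∈ Finset.range (N + 1),
      (Nat.multichoose (e + 1) d : A) * q ^ d) * h

namespace GraphAlgebra

open FeynmanGraph

variable (k : Type*) [Field k]

/-- The negative powers of `z_φ` as sums over chains of two-point graphs. The sum may be cut off at
any `M ≥ N`. -/
theorem coeff_zphiInv_pow_mul (e N : ℕ) (f : PowerSeries (GraphAlgebra k)) (M : ℕ) (hM : N ≤ M) :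
    PowerSeries.coeff N (f * zphiInv k ^ e) = ∑ d ∈ Finset.range (M + 1),
      (Nat.multichoose e d : GraphAlgebra k) * PowerSeries.coeff N ((1 - zphi k) ^ d * f) := by
  have hX : PowerSeries.X ∣ 1 - zphi k := by
    rw [PowerSeries.X_dvd_iff]
    simp [zphi]
  have h1 := pow_dvd_sum_multichoose (q := 1 - zphi k) (w := zphiInv k)
    (by rw [sub_sub_cancel, zphi_mul_zphiInv]) M e
  have h2 := ((pow_dvd_pow_of_dvd hX _).trans h1).mul_left f
  have h3 := PowerSeries.X_pow_dvd_iff.1 h2 N (by omega)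
  rw [mul_sub, map_sub, sub_eq_zero] at h3
  rw [← h3, Finset.mul_sum, map_sum]
  refine Finset.sum_congr rfl fun d _ => ?_
  rw [mul_comm f, mul_assoc, ← map_natCast (PowerSeries.C (R := GraphAlgebra k)),
    PowerSeries.coeff_C_mul]

variable [CharZero k]

theorem pieceSeries_four : pieceSeries k 4 = PowerSeries.expand 4 four_ne_zero (zg k) := by
  ext1 s
  rw [PowerSeries.coeff_expand, pieceSeries, PowerSeries.coeff_mk]
  split_ifs with h
  · obtain ⟨n, rfl⟩ := h
    rw [Nat.mul_div_cancel_left _ four_pos, zg, PowerSeries.coeff_mk]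
    split_ifs with hn
    · subst hn
      exact pieceCoeff_four_zero k
    · rw [pointSum_eq k (Or.inr rfl) (by omega) rfl]
  · exact pieceCoeff_eq_zero k (by omega)

theorem X_sq_mul_pieceSeries_two :
    PowerSeries.X ^ 2 * pieceSeries k 2 = PowerSeries.expand 4 four_ne_zero (1 - zphi k) := by
  ext1 s
  rw [PowerSeries.coeff_expand, PowerSeries.coeff_X_pow_mul', pieceSeries, PowerSeries.coeff_mk]
  split_ifs with h2 h h
  · obtain ⟨n, rfl⟩ := h
    have hn : n ≠ 0 := by omega
    rw [Nat.mul_div_cancel_left _ four_pos, map_sub, zphi, PowerSeries.coeff_mk, if_neg hn,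
      PowerSeries.coeff_one, if_neg hn, zero_sub, neg_neg,
      pointSum_eq k (Or.inl rfl) (s := 4 * n - 2) (by omega) (by omega)]
  · exact pieceCoeff_eq_zero k (by omega)
  · obtain rfl : s = 0 := by omega
    simp [zphi]
  · rfl

theorem coeff_pieceSeries_mul (d v N : ℕ) (h : d ≤ 2 * N) :
    PowerSeries.coeff (4 * N - 2 * d) (pieceSeries k 2 ^ d * pieceSeries k 4 ^ v) =
      PowerSeries.coeff N ((1 - zphi k) ^ d * zg k ^ v) := by
  rw [← PowerSeries.coeff_expand_mul 4 four_ne_zero ((1 - zphi k) ^ d * zg k ^ v),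
    map_mul (PowerSeries.expand _ _),
    map_pow (PowerSeries.expand _ _), map_pow (PowerSeries.expand _ _), ← pieceSeries_four,
    ← X_sq_mul_pieceSeries_two, mul_pow, ← pow_mul, mul_assoc,
    PowerSeries.coeff_X_pow_mul', if_pos (by omega)]

/-- Inserting `d` bivalent vertices into `e` edges. -/
theorem chainCoeff_two_mul (d e : ℕ) : chainCoeff k d (2 * e) = Nat.multichoose e d := by
  have h1 : ∏ i ∈ Finset.range d, (2 * e + 2 * i) =
      (2 ^ d * Nat.factorial d) * Nat.multichoose e d := by
    rw [Finset.prod_congr rfl fun i _ => (Nat.mul_add 2 e i).symm, Finset.prod_mul_distrib,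
      Finset.prod_const, Finset.card_range, ← Nat.ascFactorial_eq_prod_range,
      Nat.multichoose_eq, Nat.ascFactorial_eq_factorial_mul_choose', mul_assoc]
  unfold chainCoeff
  rw [h1, Nat.cast_mul (2 ^ d * _), inv_mul_cancel_left₀]
  rw [Nat.cast_ne_zero]
  positivity

/-- The coproduct of `Γ⁽ʳ⁾ₙ` with `r = 2 * c`. A graph with `j` loops and `r` legs has `j + c - 1`
vertices and `2 * j + c - 2` internal edges. The left tensor factor fills the vertices with
four-point graphs and the edges with chains of two-point graphs. The term `Γ⁽ʳ⁾ₙ ⊗ 1` comes from the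
full subgraphs. -/
theorem comul_pointSum {c n : ℕ} (hc : c = 1 ∨ c = 2) (hn : n ≠ 0) :
    comul k (pointSum k (2 * c) n) = pointSum k (2 * c) n ⊗ₜ[k] 1 +
      ∑ j ∈ Finset.Icc 1 n, PowerSeries.coeff (n - j)
        (zg k ^ (j + c - 1) * zphiInv k ^ (2 * j + c - 2)) ⊗ₜ[k] pointSum k (2 * c) j := by
  have hr : 2 * c = 2 ∨ 2 * c = 4 := by omega
  have hp : ∀ j, j ≠ 0 → pointSum k (2 * c) j = pieceCoeff k (2 * c) (4 * j + 2 * c - 4) :=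
    fun j hj => pointSum_eq k hr (by omega) (by omega)
  rw [hp n hn, comul_pieceCoeff k hr (by omega), Finset.sum_range_succ, add_comm]
  congr 1
  · rw [Finset.sum_eq_single (2 - c)]
    · rw [outerCoeff, if_pos (by omega), if_pos (by omega)]
      congr 1
      rcases hc with rfl | rfl <;> simp [pieceSeries]
    · intro d _ hd
      rw [outerCoeff, if_pos (by omega), if_neg (by omega), TensorProduct.tmul_zero]
    · intro h
      exact (h (Finset.mem_range.2 (by omega))).elim
  · have hj : ∀ j ∈ Finset.Icc 1 n, PowerSeries.coeff (n - j)
        (zg k ^ (j + c - 1) * zphiInv k ^ (2 * j + c - 2)) ⊗ₜ[k] pointSum k (2 * c) j =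
        ∑ d ∈ Finset.range (2 * (n - j) + 1), PowerSeries.coeff (4 * (n - j) - 2 * d)
          (pieceSeries k 2 ^ d * pieceSeries k 4 ^ (j + c - 1)) ⊗ₜ[k]
          (chainCoeff k d (2 * (2 * j + c - 2)) • pieceCoeff k (2 * c) (4 * j + 2 * c - 4)) := by
      intro j hj
      rw [Finset.mem_Icc] at hj
      rw [coeff_zphiInv_pow_mul k _ _ _ (2 * (n - j)) (by omega), TensorProduct.sum_tmul]
      refine Finset.sum_congr rfl fun d hd => ?_
      rw [Finset.mem_range] at hd
      rw [coeff_pieceSeries_mul k _ _ _ (by omega), chainCoeff_two_mul, hp j (by omega),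
        ← TensorProduct.smul_tmul, Nat.cast_smul_eq_nsmul, nsmul_eq_mul]
    rw [Finset.sum_congr rfl hj, Finset.sum_sigma', Finset.sum_sigma']
    -- Only terms with `s - t - 2 * d = 4 * j + 2 * c - 4` for some `j ≥ 1` are nonzero, where
    -- `s = 4 * n + 2 * c - 4`; that is, `t = 4 * (n - j) - 2 * d`.
    symm
    refine Finset.sum_of_injOn (fun x => ⟨4 * (n - x.1) - 2 * x.2, x.2⟩) ?_ ?_ ?_ ?_
    · rintro ⟨j, d⟩ h ⟨j', d'⟩ h' he
      simp only [Finset.coe_sigma, Set.mem_sigma_iff, Finset.coe_Icc, Set.mem_Icc, Finset.coe_range,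
        Set.mem_Iio] at h h'
      simp only [Sigma.mk.injEq, heq_eq_eq] at he ⊢
      omega
    · rintro ⟨j, d⟩ h
      simp only [Finset.coe_sigma, Set.mem_sigma_iff, Finset.coe_Icc, Set.mem_Icc, Finset.coe_range,
        Set.mem_Iio] at h ⊢
      omega
    · rintro ⟨t, d⟩ h h'
      simp only [Finset.mem_sigma, Finset.mem_range] at h
      simp only [outerCoeff]
      rw [if_neg (by omega)]
      split_ifs with hd
      · rw [TensorProduct.tmul_zero]
      · rw [pieceCoeff_eq_zero, smul_zero, TensorProduct.tmul_zero]
        rintro ⟨j, hj⟩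
        refine h' ⟨⟨j + 1 - c, d⟩, ?_, ?_⟩
        · simp only [Finset.coe_sigma, Set.mem_sigma_iff, Finset.coe_Icc, Set.mem_Icc,
            Finset.coe_range, Set.mem_Iio]
          omega
        · simp only [Sigma.mk.injEq, heq_eq_eq, and_true]
          omega
    · rintro ⟨j, d⟩ h
      simp only [Finset.mem_sigma, Finset.mem_range, Finset.mem_Icc] at h
      simp only [outerCoeff]
      rw [if_neg (by omega), if_neg (by omega)]
      have h1 : (4 * n + 2 * c - 4 - (4 * (n - j) - 2 * d) + 2 * c - 2 * d) / 4 = j + c - 1 := by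
        omega
      have h2 : 4 * n + 2 * c - 4 - (4 * (n - j) - 2 * d) - 2 * d = 4 * j + 2 * c - 4 := by omega
      have h3 : 2 * (2 * j + c - 2) = 4 * j + 2 * c - 4 := by omega
      rw [h1, h2, h3]

end GraphAlgebra

/-! ### The coproduct of the bare coupling -/

theorem sum_antidiagonal_eq_add_sum_Icc {M : Type*} [AddCommMonoid M] (f : ℕ → ℕ → M) (n : ℕ) :
    ∑ p ∈ Finset.HasAntidiagonal.antidiagonal n, f p.1 p.2 =
      f n 0 + ∑ j ∈ Finset.Icc 1 n, f (n - j) j := by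
  rw [← Finset.Nat.sum_antidiagonal_swap, Finset.Nat.sum_antidiagonal_eq_sum_range_succ_mk,
    Finset.range_eq_Ico, Finset.sum_eq_sum_Ico_succ_bot (Nat.succ_pos n)]
  rfl

section

variable {k A : Type*} [Field k] [CommRing A] [Algebra k A] (b : PowerSeries A)

/-- The series `∑ₘ h bᵐ ⊗ gₘ`, with values in the tensor product. -/
noncomputable def tensorSeries (h g : PowerSeries A) : PowerSeries (A ⊗[k] A) :=
  PowerSeries.mk fun n => ∑ p ∈ Finset.HasAntidiagonal.antidiagonal n,
    PowerSeries.coeff p.1 (h * b ^ p.2) ⊗ₜ[k] PowerSeries.coeff p.2 g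

theorem tensorSeries_mul (h g h' g' : PowerSeries A) :
    tensorSeries (k := k) b (h * h') (g * g') =
      tensorSeries b h g * tensorSeries b h' g' := by
  have hl : ∀ p : ℕ × ℕ, PowerSeries.coeff p.1 (h * h' * b ^ p.2) ⊗ₜ[k]
      PowerSeries.coeff p.2 (g * g') =
      ∑ y ∈ Finset.HasAntidiagonal.antidiagonal p.2, ∑ x ∈ Finset.HasAntidiagonal.antidiagonal p.1,
        (PowerSeries.coeff x.1 (h * b ^ y.1) * PowerSeries.coeff x.2 (h' * b ^ y.2)) ⊗ₜ[k]
        (PowerSeries.coeff y.1 g * PowerSeries.coeff y.2 g') := fun p => by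
    rw [PowerSeries.coeff_mul (φ := g), TensorProduct.tmul_sum]
    refine Finset.sum_congr rfl fun y hy => ?_
    have hb : h * h' * b ^ p.2 = (h * b ^ y.1) * (h' * b ^ y.2) := by
      rw [← Finset.HasAntidiagonal.mem_antidiagonal.1 hy]
      ring
    rw [hb, PowerSeries.coeff_mul, TensorProduct.sum_tmul]
  -- Exchange of the inner indices in `(x₁ + x₂) + (y₁ + y₂) = (x₁ + y₁) + (x₂ + y₂)`.
  ext1 n
  rw [PowerSeries.coeff_mul]
  simp only [tensorSeries, PowerSeries.coeff_mk, hl, Finset.sum_mul_sum,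
    Algebra.TensorProduct.tmul_mul_tmul]
  simp only [Finset.sum_sigma']
  refine Finset.sum_nbij'
    (fun x => ⟨(x.2.2.1 + x.2.1.1, x.2.2.2 + x.2.1.2), (x.2.2.1, x.2.1.1), (x.2.2.2, x.2.1.2)⟩)
    (fun x => ⟨(x.2.1.1 + x.2.2.1, x.2.1.2 + x.2.2.2), (x.2.1.2, x.2.2.2), (x.2.1.1, x.2.2.1)⟩)
    ?_ ?_ ?_ ?_ ?_
  · rintro ⟨⟨p1, p2⟩, ⟨y1, y2⟩, x1, x2⟩ h
    simp only [Finset.mem_sigma, Finset.HasAntidiagonal.mem_antidiagonal, and_self, and_true] at h ⊢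
    omega
  · rintro ⟨⟨p1, p2⟩, ⟨y1, y2⟩, x1, x2⟩ h
    simp only [Finset.mem_sigma, Finset.HasAntidiagonal.mem_antidiagonal, and_self, and_true] at h ⊢
    omega
  · rintro ⟨⟨p1, p2⟩, ⟨y1, y2⟩, x1, x2⟩ h
    simp only [Finset.mem_sigma, Finset.HasAntidiagonal.mem_antidiagonal] at h
    obtain ⟨h1, h2, h3⟩ := h
    simp only [h2, h3]
  · rintro ⟨⟨p1, p2⟩, ⟨y1, y2⟩, x1, x2⟩ h
    simp only [Finset.mem_sigma, Finset.HasAntidiagonal.mem_antidiagonal] at h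
    obtain ⟨h1, h2, h3⟩ := h
    simp only [h2, h3]
  · rintro ⟨⟨p1, p2⟩, ⟨y1, y2⟩, x1, x2⟩ _
    rfl

end

namespace GraphAlgebra

open FeynmanGraph

variable (k : Type*) [Field k]

theorem zB_mul_zphi_sq : zB k * zphi k ^ 2 = zg k := by
  rw [zB, mul_assoc, ← mul_pow, mul_comm (zphiInv k), zphi_mul_zphiInv, one_pow, mul_one]

theorem bare_zero : bare k 0 = 1 := by
  simp [bare, zB, zg, zphiInv]

variable [CharZero k]

theorem map_comul_zg : PowerSeries.map (comul k).toRingHom (zg k) =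
    tensorSeries (zB k) (zg k) (zg k) := by
  ext1 n
  rw [PowerSeries.coeff_map, tensorSeries, PowerSeries.coeff_mk, sum_antidiagonal_eq_add_sum_Icc
    fun i j => PowerSeries.coeff i (zg k * zB k ^ j) ⊗ₜ[k] PowerSeries.coeff j (zg k)]
  have hc : ∀ j, j ≠ 0 → PowerSeries.coeff j (zg k) = pointSum k 4 j := fun j hj => by
    rw [zg, PowerSeries.coeff_mk, if_neg hj]
  have h0 : PowerSeries.coeff 0 (zg k) = 1 := by
    rw [zg, PowerSeries.coeff_mk, if_pos rfl]
  rw [pow_zero, mul_one, h0]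
  by_cases hn : n = 0
  · subst hn
    rw [h0, map_one, Finset.Icc_eq_empty_of_lt zero_lt_one, Finset.sum_empty, add_zero]
    rfl
  · rw [hc n hn]
    refine (comul_pointSum k (c := 2) (Or.inr rfl) hn).trans (congrArg₂ _ rfl ?_)
    refine Finset.sum_congr rfl fun j hj => ?_
    have hz : zg k ^ (j + 2 - 1) * zphiInv k ^ (2 * j + 2 - 2) = zg k * zB k ^ j := by
      rw [zB, mul_pow, ← mul_assoc, ← pow_succ', ← pow_mul]
      rfl
    rw [hc j (by rw [Finset.mem_Icc] at hj; omega), hz]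

theorem map_comul_zphi : PowerSeries.map (comul k).toRingHom (zphi k) =
    tensorSeries (zB k) (zphi k) (zphi k) := by
  ext1 n
  rw [PowerSeries.coeff_map, tensorSeries, PowerSeries.coeff_mk, sum_antidiagonal_eq_add_sum_Icc
    fun i j => PowerSeries.coeff i (zphi k * zB k ^ j) ⊗ₜ[k] PowerSeries.coeff j (zphi k)]
  have hc : ∀ j, j ≠ 0 → PowerSeries.coeff j (zphi k) = - pointSum k 2 j := fun j hj => by
    rw [zphi, PowerSeries.coeff_mk, if_neg hj]
  have h0 : PowerSeries.coeff 0 (zphi k) = 1 := by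
    rw [zphi, PowerSeries.coeff_mk, if_pos rfl]
  rw [pow_zero, mul_one, h0]
  by_cases hn : n = 0
  · subst hn
    rw [h0, map_one, Finset.Icc_eq_empty_of_lt zero_lt_one, Finset.sum_empty, add_zero]
    rfl
  · rw [hc n hn, map_neg]
    refine (congrArg Neg.neg (comul_pointSum k (c := 1) (Or.inl rfl) hn)).trans ?_
    rw [neg_add, ← TensorProduct.neg_tmul, ← Finset.sum_neg_distrib]
    refine congrArg₂ _ rfl ?_
    refine Finset.sum_congr rfl fun j hj => ?_
    obtain ⟨i, rfl⟩ : ∃ i, j = i + 1 := ⟨j - 1, by rw [Finset.mem_Icc] at hj; omega⟩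
    have hz : zg k ^ (i + 1 + 1 - 1) * zphiInv k ^ (2 * (i + 1) + 1 - 2) =
        zphi k * zB k ^ (i + 1) := by
      have h1 : 2 * (i + 1) + 1 - 2 = 2 * i + 1 := by omega
      rw [h1, Nat.add_sub_cancel, zB]
      linear_combination (-zg k ^ (i + 1) * zphiInv k ^ (2 * i + 1)) * zphi_mul_zphiInv k
    rw [hc (i + 1) (Nat.succ_ne_zero i), TensorProduct.tmul_neg, hz]

theorem map_comul_zB : PowerSeries.map (comul k).toRingHom (zB k) =
    tensorSeries (zB k) (zB k) (zB k) := by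
  have hu : IsUnit (PowerSeries.map (comul k).toRingHom (zphi k) ^ 2) :=
    (IsUnit.of_mul_eq_one _ (by rw [← map_mul, zphi_mul_zphiInv, map_one])).pow 2
  refine hu.mul_right_cancel ?_
  conv_rhs => rw [map_comul_zphi, pow_two, ← tensorSeries_mul, ← tensorSeries_mul, ← pow_two,
    zB_mul_zphi_sq]
  rw [← map_pow, ← map_mul, zB_mul_zphi_sq, map_comul_zg]

end GraphAlgebra

/-! ### Homogeneity and the counit -/

namespace GraphAlgebra

open FeynmanGraph MvPolynomial

variable (k : Type*) [Field k]

theorem pointSum_induction (P : GraphAlgebra k → Prop) (r n : ℕ) (h0 : P 0)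
    (hadd : ∀ x y, P x → P y → P (x + y))
    (h : ∀ (c : k) (Γ : Generator), Γ.loops = n → P (C c * X Γ)) : P (pointSum k r n) := by
  have : Fintype {Λ : LegLabelledClass r // Λ.graph.loops = n} := Fintype.ofFinite _
  unfold pointSum
  rw [finsum_eq_sum_of_fintype]
  refine Finset.sum_induction _ P hadd h0 fun Λ _ => ?_
  obtain ⟨Γ, h1, h2⟩ := exists_generator k Λ.1.graph Λ.1.isDivergent1PI
  rw [h1]
  exact h _ Γ (h2.trans Λ.2)

theorem isWeightedHomogeneous_pointSum (r n : ℕ) :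
    IsWeightedHomogeneous Generator.loops (pointSum k r n) n :=
  pointSum_induction k (fun x => IsWeightedHomogeneous Generator.loops x n) r n
    (isWeightedHomogeneous_zero _ _ _) (fun _ _ hx hy => hx.add hy)
    fun c Γ hΓ => (hΓ ▸ isWeightedHomogeneous_X k Generator.loops Γ).C_mul c

theorem isWeightedHomogeneous_coeff_mul {f g : PowerSeries (GraphAlgebra k)}
    (hf : ∀ n, IsWeightedHomogeneous Generator.loops (PowerSeries.coeff n f) n)
    (hg : ∀ n, IsWeightedHomogeneous Generator.loops (PowerSeries.coeff n g) n) (n : ℕ) :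
    IsWeightedHomogeneous Generator.loops (PowerSeries.coeff n (f * g)) n := by
  rw [PowerSeries.coeff_mul]
  refine IsWeightedHomogeneous.sum _ _ _ fun p hp => ?_
  rw [← Finset.HasAntidiagonal.mem_antidiagonal.1 hp]
  exact (hf _).mul (hg _)

theorem isWeightedHomogeneous_coeff_zphi (n : ℕ) :
    IsWeightedHomogeneous Generator.loops (PowerSeries.coeff n (zphi k)) n := by
  rw [zphi, PowerSeries.coeff_mk]
  split_ifs with h
  · exact h ▸ isWeightedHomogeneous_one k _
  · exact (isWeightedHomogeneous_pointSum k 2 n).neg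

theorem isWeightedHomogeneous_coeff_zphiInv (n : ℕ) :
    IsWeightedHomogeneous Generator.loops (PowerSeries.coeff n (zphiInv k)) n := by
  induction n using Nat.strong_induction_on with
  | _ n ih =>
    rw [zphiInv, PowerSeries.coeff_invOfUnit]
    split_ifs with h
    · rw [inv_one, Units.val_one]
      exact h ▸ isWeightedHomogeneous_one k _
    · rw [inv_one, Units.val_one, neg_one_mul]
      refine (IsWeightedHomogeneous.sum _ _ _ fun p hp => ?_).neg
      split_ifs with h2
      · rw [← Finset.HasAntidiagonal.mem_antidiagonal.1 hp]
        exact (isWeightedHomogeneous_coeff_zphi k _).mul (ih _ h2)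
      · exact isWeightedHomogeneous_zero _ _ _

theorem isWeightedHomogeneous_bare (n : ℕ) :
    IsWeightedHomogeneous Generator.loops (bare k n) n := by
  unfold bare zB
  refine isWeightedHomogeneous_coeff_mul k (fun n => ?_) (fun n => ?_) n
  · rw [zg, PowerSeries.coeff_mk]
    split_ifs with h
    · exact h ▸ isWeightedHomogeneous_one k _
    · exact isWeightedHomogeneous_pointSum k 4 n
  · rw [pow_two]
    exact isWeightedHomogeneous_coeff_mul k (isWeightedHomogeneous_coeff_zphiInv k)
      (isWeightedHomogeneous_coeff_zphiInv k) n

theorem counit_pointSum (r n : ℕ) : counit k (pointSum k r n) = 0 :=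
  pointSum_induction k (fun x => counit k x = 0) r n (map_zero _)
    (fun x y hx hy => by rw [map_add, hx, hy, add_zero]) fun c Γ _ => by
      rw [map_mul, counit, aeval_X, mul_zero]

theorem map_counit_zB : PowerSeries.map (counit k).toRingHom (zB k) = 1 := by
  have h1 : PowerSeries.map (counit k).toRingHom (zg k) = 1 := by
    ext1 n
    rw [PowerSeries.coeff_map, zg, PowerSeries.coeff_mk, PowerSeries.coeff_one]
    split_ifs
    · exact map_one _
    · exact counit_pointSum k 4 n
  have h2 : PowerSeries.map (counit k).toRingHom (zphi k) = 1 := by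
    ext1 n
    rw [PowerSeries.coeff_map, zphi, PowerSeries.coeff_mk, PowerSeries.coeff_one]
    split_ifs
    · exact map_one _
    · rw [map_neg]
      exact neg_eq_zero.2 (counit_pointSum k 2 n)
  rw [← zB_mul_zphi_sq, map_mul, map_pow, h2, one_pow, mul_one] at h1
  exact h1

theorem counit_bare {n : ℕ} (hn : n ≠ 0) : counit k (bare k n) = 0 := by
  have h := congrArg (PowerSeries.coeff n) (map_counit_zB k)
  rw [PowerSeries.coeff_map, PowerSeries.coeff_one, if_neg hn] at h
  exact h

end GraphAlgebra

/-! ### The Faà di Bruno Hopf algebra -/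

theorem PowerSeries.coeff_pow_eq_sum_antidiagonalTuple {A : Type*} [CommRing A]
    (f : PowerSeries A) (m n : ℕ) : PowerSeries.coeff n (f ^ m) =
      ∑ l ∈ Finset.Nat.antidiagonalTuple m n, ∏ i, PowerSeries.coeff (l i) f := by
  have h := PowerSeries.coeff_prod (fun _ : Fin m => f) n Finset.univ
  rw [Finset.prod_const, Finset.card_univ, Fintype.card_fin] at h
  rw [h]
  refine Finset.sum_bij' (fun l _ => ⇑l) (fun l _ => Finsupp.equivFunOnFinite.symm l) ?_ ?_ ?_ ?_ ?_
  · intro l hl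
    rw [Finset.Nat.mem_antidiagonalTuple]
    exact (Finset.mem_finsuppAntidiag.1 hl).1
  · intro l hl
    exact Finset.mem_finsuppAntidiag.2
      ⟨Finset.Nat.mem_antidiagonalTuple.1 hl, Finset.subset_univ _⟩
  · intro l _
    exact Finsupp.equivFunOnFinite.symm_apply_apply l
  · intro l _
    rfl
  · intro l _
    rfl

namespace FaaDiBruno

open MvPolynomial

variable (k : Type*) [Field k]

/-- The homogeneous polynomials of weight `n`, the weight of `aᵢ` being `i`. -/
noncomputable def weightSubmodule (n : ℕ) : Submodule k (FaaDiBruno k) :=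
  weightedHomogeneousSubmodule k (fun i : ℕ => i + 1) n

theorem a_mem (n : ℕ) : a k n ∈ weightSubmodule k n := by
  cases n with
  | zero => exact isWeightedHomogeneous_one k _
  | succ n => exact isWeightedHomogeneous_X k (fun i : ℕ => i + 1) n

/-- The span of the elementary tensors whose left factor has weight less than `n`. -/
noncomputable def leftWeightLT (n : ℕ) : Submodule k (FaaDiBruno k ⊗[k] FaaDiBruno k) :=
  Submodule.span k {t | ∃ m < n, ∃ y ∈ weightSubmodule k m, ∃ z, t = y ⊗ₜ[k] z}

variable {k}

theorem tmul_mem_leftWeightLT {m n : ℕ} (h : m < n) {y : FaaDiBruno k}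
    (hy : y ∈ weightSubmodule k m) (z : FaaDiBruno k) : y ⊗ₜ[k] z ∈ leftWeightLT k n :=
  Submodule.subset_span ⟨m, h, y, hy, z, rfl⟩

theorem mul_mem_leftWeightLT {m n : ℕ} {s t : FaaDiBruno k ⊗[k] FaaDiBruno k}
    (hs : s ∈ leftWeightLT k (m + 1)) (ht : t ∈ leftWeightLT k n) :
    s * t ∈ leftWeightLT k (m + n) := by
  have h := Submodule.mul_mem_mul hs ht
  unfold leftWeightLT at h
  rw [Submodule.span_mul_span] at h
  refine Submodule.span_mono ?_ h
  rintro _ ⟨_, ⟨i, hi, y, hy, z, rfl⟩, _, ⟨j, hj, y', hy', z', rfl⟩, rfl⟩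
  refine ⟨i + j, by omega, y * y', IsWeightedHomogeneous.mul hy hy', z * z', ?_⟩
  exact Algebra.TensorProduct.tmul_mul_tmul _ _ _ _

theorem comul_X_sub_mem (i : ℕ) :
    comul k (X i) - X i ⊗ₜ[k] 1 ∈ leftWeightLT k (i + 1) := by
  rw [comul, aeval_X, coproduct, Finset.sum_range_succ', Nat.sub_zero,
    Finset.Nat.antidiagonalTuple_one, Finset.sum_singleton, Fin.prod_univ_one]
  -- The term with `m = 0` is `aᵢ₊₁ ⊗ 1`.
  change _ + X i ⊗ₜ[k] 1 - _ ∈ _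
  rw [add_sub_cancel_right]
  refine Submodule.sum_mem _ fun m hm => Submodule.sum_mem _ fun l hl => ?_
  rw [Finset.mem_range] at hm
  refine tmul_mem_leftWeightLT (m := i + 1 - (m + 1)) (by omega) ?_ _
  rw [← Finset.Nat.mem_antidiagonalTuple.1 hl]
  exact IsWeightedHomogeneous.prod _ _ _ fun j _ => a_mem k (l j)

/-- The property of an element of weight `n` that its coproduct is `x ⊗ 1` up to terms of smaller
weight on the left is multiplicative. -/
theorem comul_mul_sub_mem {m n : ℕ} {x y : FaaDiBruno k} (hx : x ∈ weightSubmodule k m)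
    (hy : y ∈ weightSubmodule k n) (h : comul k x - x ⊗ₜ[k] 1 ∈ leftWeightLT k m)
    (h' : comul k y - y ⊗ₜ[k] 1 ∈ leftWeightLT k n) :
    comul k (x * y) - (x * y) ⊗ₜ[k] 1 ∈ leftWeightLT k (m + n) := by
  have hle : leftWeightLT k m ≤ leftWeightLT k (m + 1) := Submodule.span_mono
    fun t ⟨i, hi, h⟩ => ⟨i, by omega, h⟩
  have h1 : comul k x ∈ leftWeightLT k (m + 1) := by
    rw [← sub_add_cancel (comul k x) (x ⊗ₜ[k] 1)]
    exact Submodule.add_mem _ (hle h) (tmul_mem_leftWeightLT (Nat.lt_succ_self m) hx 1)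
  have h2 : y ⊗ₜ[k] 1 ∈ leftWeightLT k (n + 1) := tmul_mem_leftWeightLT (Nat.lt_succ_self n) hy 1
  have e : (x * y) ⊗ₜ[k] (1 : FaaDiBruno k) = x ⊗ₜ[k] 1 * y ⊗ₜ[k] 1 := by
    rw [Algebra.TensorProduct.tmul_mul_tmul, mul_one]
  have h3 : comul k (x * y) - (x * y) ⊗ₜ[k] 1 = comul k x * (comul k y - y ⊗ₜ[k] 1) +
      y ⊗ₜ[k] 1 * (comul k x - x ⊗ₜ[k] 1) := by
    rw [map_mul, e]
    ring
  rw [h3]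
  refine Submodule.add_mem _ (mul_mem_leftWeightLT h1 h') ?_
  rw [add_comm m]
  exact mul_mem_leftWeightLT h2 h

theorem monomial_mem (σ : ℕ →₀ ℕ) :
    monomial σ (1 : k) ∈ weightSubmodule k (Finsupp.weight (fun i : ℕ => i + 1) σ) :=
  isWeightedHomogeneous_monomial _ _ _ rfl

theorem comul_monomial_sub_mem (σ : ℕ →₀ ℕ) :
    comul k (monomial σ 1) - monomial σ 1 ⊗ₜ[k] 1 ∈
      leftWeightLT k (Finsupp.weight (fun i : ℕ => i + 1) σ) := by
  have h0 : comul k (monomial 0 1) - monomial 0 1 ⊗ₜ[k] 1 ∈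
      leftWeightLT k (Finsupp.weight (fun i : ℕ => i + 1) (0 : ℕ →₀ ℕ)) := by
    have h1 : (monomial 0 1 : FaaDiBruno k) = 1 := rfl
    rw [h1, map_one, Algebra.TensorProduct.one_def, sub_self]
    exact Submodule.zero_mem _
  have hadd : ∀ σ τ : ℕ →₀ ℕ, comul k (monomial σ 1) - monomial σ 1 ⊗ₜ[k] 1 ∈
      leftWeightLT k (Finsupp.weight (fun i : ℕ => i + 1) σ) →
      comul k (monomial τ 1) - monomial τ 1 ⊗ₜ[k] 1 ∈
      leftWeightLT k (Finsupp.weight (fun i : ℕ => i + 1) τ) →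
      comul k (monomial (σ + τ) 1) - monomial (σ + τ) 1 ⊗ₜ[k] 1 ∈
      leftWeightLT k (Finsupp.weight (fun i : ℕ => i + 1) (σ + τ)) := by
    intro σ τ hσ hτ
    have h1 : (monomial (σ + τ) 1 : FaaDiBruno k) = monomial σ 1 * monomial τ 1 := by
      rw [monomial_mul, one_mul]
    rw [h1, map_add]
    exact comul_mul_sub_mem (monomial_mem σ) (monomial_mem τ) hσ hτ
  induction σ using Finsupp.induction_linear with
  | zero => exact h0
  | add σ τ hσ hτ => exact hadd σ τ hσ hτ
  | single i e =>
    induction e with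
    | zero =>
      rw [Finsupp.single_zero]
      exact h0
    | succ e ih =>
      rw [Finsupp.single_add]
      refine hadd _ _ ih ?_
      have hw : Finsupp.weight (fun i : ℕ => i + 1) (Finsupp.single i 1) = i + 1 := by
        rw [Finsupp.weight_single, one_smul]
      rw [hw]
      exact comul_X_sub_mem i

/-- A linear map with `D ⋆ φ = 0` vanishes, since the coproduct of `x` is `x ⊗ 1` up to terms with
left factors of smaller weight. -/
theorem eq_zero_of_convolution_eq_zero {A : Type*} [CommRing A] [Algebra k A]
    (D : FaaDiBruno k →ₗ[k] A) (φ : FaaDiBruno k →ₐ[k] A)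
    (h : ∀ x, LinearMap.mul' k A (TensorProduct.map D φ.toLinearMap (comul k x)) = 0) : D = 0 := by
  have hmon : ∀ n, ∀ σ : ℕ →₀ ℕ, Finsupp.weight (fun i : ℕ => i + 1) σ = n →
      D (monomial σ 1) = 0 := by
    intro n
    induction n using Nat.strong_induction_on with
    | _ n ih =>
      have hw : ∀ m < n, ∀ y ∈ weightSubmodule k m, D y = 0 := by
        intro m hm y hy
        rw [← support_sum_monomial_coeff y, map_sum]
        refine Finset.sum_eq_zero fun σ hσ => ?_
        rw [← mul_one (coeff σ y), ← smul_eq_mul, ← smul_monomial, map_smul,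
          ih m hm σ (hy (mem_support_iff.1 hσ)), smul_zero]
      have hK : ∀ t ∈ leftWeightLT k n,
          LinearMap.mul' k A (TensorProduct.map D φ.toLinearMap t) = 0 := by
        intro t ht
        have hle : leftWeightLT k n ≤
            LinearMap.ker (LinearMap.mul' k A ∘ₗ TensorProduct.map D φ.toLinearMap) := by
          refine Submodule.span_le.2 ?_
          rintro _ ⟨m, hm, y, hy, z, rfl⟩
          change LinearMap.mul' k A (TensorProduct.map D φ.toLinearMap (y ⊗ₜ[k] z)) = 0
          rw [TensorProduct.map_tmul, hw m hm y hy, TensorProduct.zero_tmul, map_zero]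
        exact hle ht
      intro σ hσ
      have h1 := hK _ (hσ ▸ comul_monomial_sub_mem σ)
      rw [map_sub, map_sub, h, TensorProduct.map_tmul, LinearMap.mul'_apply,
        AlgHom.toLinearMap_apply, map_one φ, mul_one, zero_sub, neg_eq_zero] at h1
      exact h1
  refine LinearMap.ext fun x => ?_
  rw [← support_sum_monomial_coeff x, map_sum, LinearMap.zero_apply]
  refine Finset.sum_eq_zero fun σ _ => ?_
  rw [← mul_one (coeff σ x), ← smul_eq_mul, ← smul_monomial, map_smul, hmon _ σ rfl, smul_zero]

/-- A bialgebra morphism from the Faà di Bruno Hopf algebra commutes with antipodes. -/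
theorem antipode_comm {A : Type*} [CommRing A] [Algebra k A] {Δ : A →ₐ[k] A ⊗[k] A}
    {ε : A →ₐ[k] k} {φ : FaaDiBruno k →ₐ[k] A}
    (hΔ : ∀ x, Δ (φ x) = Algebra.TensorProduct.map φ φ (comul k x))
    (hε : ∀ x, ε (φ x) = counit k x) {S : FaaDiBruno k →ₗ[k] FaaDiBruno k} {T : A →ₗ[k] A}
    (hS : IsAntipode (comul k) (counit k) S) (hT : IsAntipode Δ ε T) (x : FaaDiBruno k) :
    T (φ x) = φ (S x) := by
  have h1 : ∀ t : FaaDiBruno k ⊗[k] FaaDiBruno k, LinearMap.mul' k A (TensorProduct.map T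
      LinearMap.id (Algebra.TensorProduct.map φ φ t)) = LinearMap.mul' k A
      (TensorProduct.map (T ∘ₗ φ.toLinearMap) φ.toLinearMap t) := fun t => by
    induction t with
    | zero => simp only [map_zero]
    | tmul y z => rfl
    | add s t hs ht => simp only [map_add, hs, ht]
  have h2 : ∀ t : FaaDiBruno k ⊗[k] FaaDiBruno k, φ (LinearMap.mul' k (FaaDiBruno k)
      (TensorProduct.map S LinearMap.id t)) = LinearMap.mul' k A
      (TensorProduct.map (φ.toLinearMap ∘ₗ S) φ.toLinearMap t) := fun t => by
    induction t with
    | zero => simp only [map_zero]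
    | tmul y z => exact map_mul φ _ _
    | add s t hs ht => simp only [map_add, hs, ht]
  have h3 : ∀ t : FaaDiBruno k ⊗[k] FaaDiBruno k, LinearMap.mul' k A
      (TensorProduct.map (T ∘ₗ φ.toLinearMap - φ.toLinearMap ∘ₗ S) φ.toLinearMap t) =
      LinearMap.mul' k A (TensorProduct.map (T ∘ₗ φ.toLinearMap) φ.toLinearMap t) -
      LinearMap.mul' k A (TensorProduct.map (φ.toLinearMap ∘ₗ S) φ.toLinearMap t) := fun t => by
    induction t with
    | zero => simp only [map_zero, sub_zero]
    | tmul y z => exact sub_mul _ _ _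
    | add s t hs ht =>
      simp only [map_add, hs, ht]
      ring
  have h4 := eq_zero_of_convolution_eq_zero (T ∘ₗ φ.toLinearMap - φ.toLinearMap ∘ₗ S) φ fun y => by
    rw [h3, ← h1, ← h2, ← hΔ, (hT _).1,
      (hS _).1, hε, AlgHom.commutes, sub_self]
  exact sub_eq_zero.1 (LinearMap.congr_fun h4 x)

end FaaDiBruno

/-! ### The Hopf algebra morphism -/

theorem proposition3p9 (k : Type*) [Field k] [CharZero k] :
    (∀ n, GraphAlgebra.bare k n ∈
      MvPolynomial.weightedHomogeneousSubmodule k FeynmanGraph.Generator.loops n) ∧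
    PowerSeries.map (GraphAlgebra.comul k).toRingHom (GraphAlgebra.zB k) =
      PowerSeries.mk (fun n => ∑ p ∈ Finset.HasAntidiagonal.antidiagonal n,
        (PowerSeries.coeff p.1 (GraphAlgebra.zB k ^ (p.2 + 1))) ⊗ₜ[k] GraphAlgebra.bare k p.2) ∧
    ∃ Φ : FaaDiBruno k →ₐ[k] GraphAlgebra k,
      (∀ n, Φ (FaaDiBruno.a k n) = GraphAlgebra.bare k n) ∧
      (∀ x, GraphAlgebra.comul k (Φ x) =
        Algebra.TensorProduct.map Φ Φ (FaaDiBruno.comul k x)) ∧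
      (∀ x, GraphAlgebra.counit k (Φ x) = FaaDiBruno.counit k x) ∧
      (∀ S T, IsAntipode (FaaDiBruno.comul k) (FaaDiBruno.counit k) S →
        IsAntipode (GraphAlgebra.comul k) (GraphAlgebra.counit k) T →
        ∀ x, T (Φ x) = Φ (S x)) := by
  have hmap : PowerSeries.map (GraphAlgebra.comul k).toRingHom (GraphAlgebra.zB k) =
      PowerSeries.mk (fun n => ∑ p ∈ Finset.HasAntidiagonal.antidiagonal n,
        (PowerSeries.coeff p.1 (GraphAlgebra.zB k ^ (p.2 + 1))) ⊗ₜ[k]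
          GraphAlgebra.bare k p.2) := by
    rw [GraphAlgebra.map_comul_zB]
    unfold tensorSeries
    simp only [← pow_succ']
    rfl
  let Φ : FaaDiBruno k →ₐ[k] GraphAlgebra k :=
    MvPolynomial.aeval fun n => GraphAlgebra.bare k (n + 1)
  have ha : ∀ n, Φ (FaaDiBruno.a k n) = GraphAlgebra.bare k n := fun n => by
    cases n with
    | zero => exact (map_one Φ).trans (GraphAlgebra.bare_zero k).symm
    | succ n => exact MvPolynomial.aeval_X _ n
  have hΔ : ∀ x, GraphAlgebra.comul k (Φ x) =
      Algebra.TensorProduct.map Φ Φ (FaaDiBruno.comul k x) := by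
    intro x
    refine DFunLike.congr_fun (f := (GraphAlgebra.comul k).comp Φ)
      (g := (Algebra.TensorProduct.map Φ Φ).comp (FaaDiBruno.comul k))
      (MvPolynomial.algHom_ext fun i => ?_) x
    have h1 := congrArg (PowerSeries.coeff (i + 1)) hmap
    rw [PowerSeries.coeff_map, PowerSeries.coeff_mk, ← Finset.Nat.sum_antidiagonal_swap,
      Finset.Nat.sum_antidiagonal_eq_sum_range_succ_mk] at h1
    rw [AlgHom.comp_apply, AlgHom.comp_apply, FaaDiBruno.comul, MvPolynomial.aeval_X,
      MvPolynomial.aeval_X]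
    refine Eq.trans h1 ?_
    rw [FaaDiBruno.coproduct, map_sum]
    refine Finset.sum_congr rfl fun m _ => ?_
    rw [map_sum, Prod.fst_swap, Prod.snd_swap, PowerSeries.coeff_pow_eq_sum_antidiagonalTuple,
      TensorProduct.sum_tmul]
    refine Finset.sum_congr rfl fun l _ => ?_
    rw [Algebra.TensorProduct.map_tmul, map_prod, ha]
    simp only [ha]
    rfl
  have hε : ∀ x, GraphAlgebra.counit k (Φ x) = FaaDiBruno.counit k x := by
    intro x
    refine DFunLike.congr_fun (f := (GraphAlgebra.counit k).comp Φ) (g := FaaDiBruno.counit k)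
      (MvPolynomial.algHom_ext fun i => ?_) x
    rw [AlgHom.comp_apply, FaaDiBruno.counit, MvPolynomial.aeval_X, MvPolynomial.aeval_X]
    exact GraphAlgebra.counit_bare k (Nat.succ_ne_zero i)
  exact ⟨GraphAlgebra.isWeightedHomogeneous_bare k, hmap, Φ, ha, hΔ, hε,
    fun S T hS hT => FaaDiBruno.antipode_comm hΔ hε hS hT⟩
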